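/- For each $N\ge 1$ let $G_N=(g_{ij})$ be an $N\times N$ Gaussian (GUE) random matrix: $g_{ji}=\overline{g_{ij}}$, and $\{g_{ij}: i\le j\}$ are independent centred Gaussians of variance $1/N$, real if $i=j$ and complex (real and imaginary parts independent, each of variance $1/(2N)$) if $i<j$. Let $\sigma_N,\tau_N$ be uniformly distributed random permutations of $[N]^2=\{1,\dots,N\}^2$ such that the sequences $(\sigma_N)_N$, $(\tau_N)_N$ and $(G_N)_N$ are independent. For a permutation $\sigma$ of $[N]^2$ let $G_N^{\sigma}$ be the matrix with $[G_N^\sigma]_{i,j}=g_{\sigma(i,j)}$. For random matrices $A_N^{(1)},\dots,A_N^{(k)}$ of size $N$ and $P\in\mathbb C\langle X_1,X_1^*,\dots,X_k,X_k^*\rangle$ put $\varphi_N(P)=\frac1N E\,\mathrm{Tr}\,P(A_N^{(1)},(A_N^{(1)})^*,\dots,A_N^{(k)},(A_N^{(k)})^*)$. The asymptotic infinitesimal distribution of the tuple is the pair $(\varphi,\varphi')$ with $\varphi(P)=\lim_N\varphi_N(P)$ and $\varphi'(P)=\lim_N N(\varphi_N(P)-\varphi(P))$, if these limits exist for all $P$.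 The tuple is asymptotically infinitesimally free if $(\varphi,\varphi')$ exists and the unital algebras $\mathcal A_l$ generated by $X_l,X_l^*$ ($l=1,\dots,k$) satisfy: whenever $n\ge1$, $a_j\in\mathcal A_{i_j}$, $\varphi(a_j)=0$ for $1\le j\le n$ and $i_1\ne i_2\ne\cdots\ne i_n$, then $$\varphi(a_1\cdots a_n)=0,\qquad \varphi'(a_1\cdots a_n)=\sum_{j=1}^n\varphi'(a_j)\,\varphi(a_1\cdots a_{j-1}a_{j+1}\cdots a_n).$$ A single sequence $A_N$ is asymptotically circular with zero infinitesimal distribution if $(\varphi,\varphi')$ exists, $\varphi'=0$, and under $\varphi$ the elements $(X+X^*)/\sqrt2$ and $(X-X^*)/(i\sqrt2)$ are free and both have the standard semicircular distribution. **Theorem.** For almost every realization of the permutation sequences $(\sigma_N)_N$ and $(\tau_N)_N$, when these sequences are held fixed and $E$ denotes the expectation over the Gaussian matrices only, $G_N^{\sigma_N}$ and $G_N^{\tau_N}$ are each asymptotically circular with zero infinitesimal distribution, and $G_N$, $G_N^{\sigma_N}$, $G_N^{\tau_N}$ are asymptotically infinitesimally free. -/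

import Mathlib

open MeasureTheory ProbabilityTheory Filter Topology
open scoped NNReal Matrix

noncomputable section

/-! ### Non-commutative probability -/

section Free

variable {A : Type*} [Ring A] [Algebra ℂ A] {I : Type*}

/-- The unital subalgebras `B k` are free with respect to `φ`: an alternating product of
(at least one) centred elements is centred. -/
def IsFree (φ : A →ₗ[ℂ] ℂ) (B : I → Subalgebra ℂ A) : Prop :=
  ∀ (n : ℕ) (i : Fin (n + 1) → I) (a : Fin (n + 1) → A),
    (∀ j, a j ∈ B (i j)) → (∀ j, φ (a j) = 0) →
    (∀ j : Fin n, i j.castSucc ≠ i j.succ) →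
      φ (List.ofFn a).prod = 0

/-- The unital subalgebras `B k` are infinitesimally free with respect to `(φ, φ')`: they are
free, and for an alternating tuple of `φ`-centred elements
`φ' (a₁ ⋯ aₙ) = ∑ⱼ φ' (aⱼ) φ (a₁ ⋯ aⱼ₋₁ aⱼ₊₁ ⋯ aₙ)`. -/
def IsInfinitesimallyFree (φ φ' : A →ₗ[ℂ] ℂ) (B : I → Subalgebra ℂ A) : Prop :=
  IsFree φ B ∧
  ∀ (n : ℕ) (i : Fin (n + 1) → I) (a : Fin (n + 1) → A),
    (∀ j, a j ∈ B (i j)) → (∀ j, φ (a j) = 0) →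
    (∀ j : Fin n, i j.castSucc ≠ i j.succ) →
      φ' (List.ofFn a).prod =
        ∑ j, φ' (a j) * φ (List.ofFn fun k : Fin n => a (j.succAbove k)).prod

/-- `x` has the moments of the standard (variance one) semicircle law. -/
def IsSemicircular (φ : A →ₗ[ℂ] ℂ) (x : A) : Prop :=
  ∀ k : ℕ, φ (x ^ (2 * k)) = (catalan k : ℂ) ∧ φ (x ^ (2 * k + 1)) = 0

/-- For `c` with adjoint `c'`: `c` is a (standard) circular element, that is
`c = (x₁ + i x₂) / √2`, where `x₁ = (c + c') / √2` and `x₂ = (c - c') / (i √2)` are free and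
both standard semicircular. -/
def IsCircular (φ : A →ₗ[ℂ] ℂ) (c c' : A) : Prop :=
  let x : Bool → A := fun b =>
    if b then ((Real.sqrt 2 : ℂ)⁻¹ * (Complex.I)⁻¹) • (c - c')
    else (Real.sqrt 2 : ℂ)⁻¹ • (c + c')
  (∀ b, IsSemicircular φ (x b)) ∧ IsFree φ (fun b => Algebra.adjoin ℂ {x b})

end Free

/-! ### Asymptotic distributions of random matrices -/

section RandomMatrices

variable {Ω : Type*} [MeasurableSpace Ω] {ι : Type*}

/-- `φ_N(P) = (1/N) E Tr P(A_N^{(1)}, …)` for a family of `N × N` random matrices and a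
polynomial `P` in non-commuting indeterminates. -/
def traceMoment (μ : Measure Ω) {N : ℕ} (A : ι → Ω → Matrix (Fin N) (Fin N) ℂ)
    (P : FreeAlgebra ℂ ι) : ℂ :=
  (N : ℂ)⁻¹ * ∫ ω, (FreeAlgebra.lift ℂ (fun k => A k ω) P).trace ∂μ

/-- The sequence (in `N`) of families `A N` of random matrices has asymptotic infinitesimal
distribution `(φ, φ')`: for all `P`, `φ(P) = lim φ_N(P)` and
`φ'(P) = lim N (φ_N(P) - φ(P))`, all the expectations being well defined. -/
def HasAsymptoticInfinitesimalDistribution (μ : Measure Ω)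
    (A : (N : ℕ) → ι → Ω → Matrix (Fin N) (Fin N) ℂ) (φ φ' : FreeAlgebra ℂ ι →ₗ[ℂ] ℂ) : Prop :=
  ∀ P : FreeAlgebra ℂ ι,
    (∀ N, Integrable (fun ω => (FreeAlgebra.lift ℂ (fun k => A N k ω) P).trace) μ) ∧
    Tendsto (fun N => traceMoment μ (A N) P) atTop (𝓝 (φ P)) ∧
    Tendsto (fun N : ℕ => (N : ℂ) * (traceMoment μ (A N) P - φ P)) atTop (𝓝 (φ' P))

/-- A family of random matrices together with their adjoints: the index `(k, false)` stands for
`A k` and `(k, true)` for `(A k)ᴴ`. -/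
def withAdjoints {N : ℕ} (A : ι → Ω → Matrix (Fin N) (Fin N) ℂ) :
    ι × Bool → Ω → Matrix (Fin N) (Fin N) ℂ :=
  fun k ω => if k.2 then (A k.1 ω)ᴴ else A k.1 ω

/-- The random matrices `A N` are asymptotically circular with zero infinitesimal distribution:
`(A N, (A N)ᴴ)` has an asymptotic infinitesimal distribution `(φ, 0)` under which the
indeterminate standing for `A N` is circular. -/
def AsymptoticallyCircularZeroInfinitesimal (μ : Measure Ω)
    (A : (N : ℕ) → Ω → Matrix (Fin N) (Fin N) ℂ) : Prop :=
  ∃ φ : FreeAlgebra ℂ (Unit × Bool) →ₗ[ℂ] ℂ,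
    HasAsymptoticInfinitesimalDistribution μ (fun N => withAdjoints fun _ : Unit => A N) φ 0 ∧
    IsCircular φ (FreeAlgebra.ι ℂ ((), false)) (FreeAlgebra.ι ℂ ((), true))

/-- The random matrices `A N k`, `k : ι`, are asymptotically infinitesimally free: together with
their adjoints they have a joint asymptotic infinitesimal distribution `(φ, φ')`, and with respect
to it the unital algebras generated by the `k`-th indeterminate and its adjoint are
infinitesimally free. -/
def AsymptoticallyInfinitesimallyFree (μ : Measure Ω)
    (A : (N : ℕ) → ι → Ω → Matrix (Fin N) (Fin N) ℂ) : Prop :=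
  ∃ φ φ' : FreeAlgebra ℂ (ι × Bool) →ₗ[ℂ] ℂ,
    HasAsymptoticInfinitesimalDistribution μ (fun N => withAdjoints (A N)) φ φ' ∧
    IsInfinitesimallyFree φ φ' (fun k : ι =>
      Algebra.adjoin ℂ {FreeAlgebra.ι ℂ (k, false), FreeAlgebra.ι ℂ (k, true)})

end RandomMatrices

/-! ### Gaussian random matrices and permutations of entries -/

/-- The centred complex Gaussian law of variance `v`: independent real and imaginary parts, each
centred Gaussian of variance `v / 2`. -/
def complexGaussian (v : ℝ≥0) : Measure ℂ :=
  ((gaussianReal 0 (v / 2)).prod (gaussianReal 0 (v / 2))).map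
    (fun p : ℝ × ℝ => (⟨p.1, p.2⟩ : ℂ))

/-- `G` is an `N × N` Gaussian random matrix (GUE, entries of variance `1 / N`). -/
structure IsGaussianRandomMatrix {Ω : Type*} [MeasurableSpace Ω] (μ : Measure Ω) {N : ℕ}
    (G : Ω → Matrix (Fin N) (Fin N) ℂ) : Prop where
  measurable_entry : ∀ i j, Measurable fun ω => G ω i j
  hermitian : ∀ᵐ ω ∂μ, (G ω).IsHermitian
  indep : iIndepFun (fun (p : {p : Fin N × Fin N // p.1 ≤ p.2}) ω => G ω p.1.1 p.1.2) μ
  law_diag : ∀ i, μ.map (fun ω => (G ω i i).re) = gaussianReal 0 (N : ℝ≥0)⁻¹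
  law_offDiag : ∀ i j, i < j → μ.map (fun ω => G ω i j) = complexGaussian (N : ℝ≥0)⁻¹

/-- `A ^ s`, the matrix whose `(i, j)` entry is the `s (i, j)` entry of `A`. -/
def permuteEntries {N : ℕ} (s : Equiv.Perm (Fin N × Fin N)) (A : Matrix (Fin N) (Fin N) ℂ) :
    Matrix (Fin N) (Fin N) ℂ :=
  Matrix.of fun i j => A (s (i, j)).1 (s (i, j)).2

/-- The finite set of permutations of `[N]²` carries the discrete σ-algebra. -/
instance instMeasurableSpacePermSquare (N : ℕ) :
    MeasurableSpace (Equiv.Perm (Fin N × Fin N)) := ⊤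

/-- `s` is a uniform random permutation of `[N]²`. -/
structure IsUniformPerm {Ω : Type*} [MeasurableSpace Ω] (μ : Measure Ω) {N : ℕ}
    (s : Ω → Equiv.Perm (Fin N × Fin N)) : Prop where
  measurable : Measurable s
  law : ∀ p, μ (s ⁻¹' {p}) = (Nat.factorial (N ^ 2) : ENNReal)⁻¹

end

/-!
Expand the trace of a word of length `n` in `G, G^σ, G^τ` and their adjoints over the closed walks of
length `n` in `[N]`, and apply Wick's formula (`IsGaussianFunctional.map_list_prod`): a pairing of the
sides of the walk contributes when it pairs entries of `G` that sit, after permutation, at transposed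
positions. Some of these coincidences hold for every choice of the permutations (`Matched`): an entry
of `G` against the transposed entry of `G`, or an entry of `G^σ` against the transposed entry of its
adjoint. Keeping only them amounts to replacing the three matrices by independent ones, a GUE matrix
and two matrices with independent complex Gaussian entries. All other contributions come from walks
with an unmatched side and depend on the permutations.

The independent model. Integration by parts gives loop equations for products of traces, and hence, by
induction on the total length (`isBigO_traceProd`), the moments of a semicircular family with
covariance `jointCov`, up to `O(N⁻²)`. In that family the first indeterminate is semicircular, the two
others are circular (`isCircular_ι`), and the three algebras are free because letters of different
classes are uncorrelated (`isFree_classAlgebra`). So there is no term of order `1 / N`, and with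
`φ' = 0` infinitesimal freeness is just freeness.

The other walks. Fix a pairing and consider two closed walks, each with an unmatched side, that are
compatible with the pairing for the same permutations. If `ℓ` labels are attached to the unmatched
sides, compatibility has probability `O(N ^ (-ℓ))` (`card_perm_conjugate_mul_le`), because a label
prescribes on average one of the two coordinates of each value of the permutations. On the other hand
the two walks have together at most `n - 2 + ℓ` vertices (`card_vertices_pair_le`), since gluing the
matched sides identifies vertices. Hence the second moment of the number of such walks is
`O(N ^ n * N⁻²)` (`sum_sq_card_unmatchedWalks_le`). This is summable after division by `N ^ n`, so
that by monotone convergence the contribution of these walks to `N * φ_N` tends to zero almost surely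
(`ae_isGenericSequence`), for the countably many words and pairings simultaneously.
-/

/-! ### Splittings and pairings of lists -/

/-- All the ways of writing the list `w` as `u ++ b :: v`, as triples `(u, b, v)`. -/
def splits {α : Type*} : List α → List (List α × α × List α)
  | [] => []
  | b :: w => ([], b, w) :: (splits w).map fun t => (b :: t.1, t.2.1, t.2.2)

section Lists

variable {α β : Type*}

theorem mem_splits {w : List α} {t : List α × α × List α} :
    t ∈ splits w ↔ w = t.1 ++ t.2.1 :: t.2.2 := by
  induction w generalizing t with
  | nil => simp [splits]
  | cons b w ih =>
    obtain ⟨u, c, v⟩ := t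
    cases u with
    | nil => simp [splits, eq_comm]
    | cons d u =>
      simp only [splits, List.mem_cons, Prod.mk.injEq, List.mem_map, Prod.exists, reduceCtorEq,
        false_and, false_or, List.cons_append, List.cons.injEq]
      constructor
      · rintro ⟨u', c', v', h, ⟨rfl, rfl⟩, rfl, rfl⟩
        exact ⟨rfl, ih.1 h⟩
      · rintro ⟨rfl, h⟩
        exact ⟨u, c, v, ih.2 h, ⟨rfl, rfl⟩, rfl, rfl⟩

theorem splits_append (w w' : List α) :
    splits (w ++ w') = ((splits w).map fun t => (t.1, t.2.1, t.2.2 ++ w')) ++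
      (splits w').map fun t => (w ++ t.1, t.2.1, t.2.2) := by
  induction w with
  | nil => simp [splits]
  | cons b w ih => simp [splits, ih, Function.comp_def]

theorem splits_map (f : α → β) (w : List α) :
    splits (w.map f) = (splits w).map fun t => (t.1.map f, f t.2.1, t.2.2.map f) := by
  induction w with
  | nil => rfl
  | cons b w ih => simp [splits, ih, Function.comp_def]

theorem length_of_mem_splits {w : List α} {t : List α × α × List α} (h : t ∈ splits w) :
    w.length = t.1.length + t.2.2.length + 1 := by
  rw [mem_splits.1 h]
  simp
  omega

/-- The pairings of (the positions of) a list, each of them given as a list of pairs. The first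
entry is paired with some later entry, and the remaining entries are paired among themselves. -/
def pairings : List α → List (List (α × α))
  | [] => [[]]
  | x :: l => (splits l).attach.flatMap fun t =>
      (pairings (t.1.1 ++ t.1.2.2)).map (List.cons (x, t.1.2.1))
termination_by l => l.length
decreasing_by
  have := length_of_mem_splits t.2
  simp
  omega

theorem pairings_nil : pairings ([] : List α) = [[]] := by
  rw [pairings]

theorem pairings_cons (x : α) (l : List α) :
    pairings (x :: l) = (splits l).flatMap fun t =>
      (pairings (t.1 ++ t.2.2)).map (List.cons (x, t.2.1)) := by
  rw [pairings, List.flatMap_def, List.flatMap_def]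
  congr 1
  conv_rhs => rw [← List.attach_map_subtype_val (splits l), List.map_map]
  rfl

theorem pairings_map (f : α → β) (l : List α) :
    pairings (l.map f) = (pairings l).map (List.map (Prod.map f f)) := by
  induction hn : l.length using Nat.strong_induction_on generalizing l with
  | _ n ih =>
    cases l with
    | nil => simp [pairings_nil]
    | cons x l =>
      rw [List.map_cons, pairings_cons, pairings_cons, splits_map, List.flatMap_map,
        List.map_flatMap]
      refine List.flatMap_congr fun t ht => ?_
      have hl := length_of_mem_splits ht
      simp only [List.length_cons] at hn
      rw [← List.map_append, ih _ (by simp; omega) _ rfl]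
      simp [Function.comp_def]

/-- A pairing of a list without repetitions is the graph of a fixed-point free involution. -/
theorem exists_involution_of_mem_pairings [DecidableEq α] {l : List α} (hl : l.Nodup)
    {p : List (α × α)} (hp : p ∈ pairings l) :
    2 * p.length = l.length ∧ ∃ π : α → α,
      (∀ a ∈ l, π a ∈ l ∧ π (π a) = a ∧ π a ≠ a ∧ ((a, π a) ∈ p ∨ (π a, a) ∈ p)) ∧
      ∀ t ∈ p, t.1 ∈ l ∧ t.2 = π t.1 := by
  induction hn : l.length using Nat.strong_induction_on generalizing l p with
  | _ n ih =>
    cases l with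
    | nil =>
      rw [pairings_nil, List.mem_singleton] at hp
      subst hp
      simp at hn
      subst hn
      exact ⟨rfl, id, by simp, by simp⟩
    | cons x l =>
      rw [pairings_cons, List.mem_flatMap] at hp
      obtain ⟨⟨u, y, v⟩, ht, hp⟩ := hp
      have hlen := length_of_mem_splits ht
      have hl' := mem_splits.1 ht
      simp only at hl' hp hlen
      rw [List.mem_map] at hp
      obtain ⟨p, hp, rfl⟩ := hp
      have hxl := (List.nodup_cons.1 hl).1
      have hnd := (List.nodup_cons.1 hl).2
      have hperm : l.Perm (y :: (u ++ v)) := by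
        rw [hl']; exact List.perm_middle
      have hnd2 := hperm.nodup_iff.1 hnd
      have hmem : ∀ a, a ∈ l ↔ a = y ∨ a ∈ u ++ v := fun a => by
        rw [hperm.mem_iff, List.mem_cons]
      have hy : y ∉ u ++ v := (List.nodup_cons.1 hnd2).1
      have hxy : x ≠ y := fun h => hxl ((hmem x).2 (Or.inl h))
      have hx : x ∉ u ++ v := fun h => hxl ((hmem x).2 (Or.inr h))
      simp only [List.length_cons] at hn
      obtain ⟨h1, π, h2, h3⟩ := ih (u ++ v).length (by simp; omega) (List.nodup_cons.1 hnd2).2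
        hp rfl
      refine ⟨by simp at h1 ⊢; omega, fun a => if a = x then y else if a = y then x else π a,
        ?_, ?_⟩
      · intro a ha
        rw [List.mem_cons, hmem] at ha
        rcases ha with rfl | rfl | ha
        · simp [hmem, hxy.symm]
        · simp [hxy, hxy.symm]
        · have hax : a ≠ x := fun h => hx (h ▸ ha)
          have hay : a ≠ y := fun h => hy (h ▸ ha)
          obtain ⟨k1, k2, k3, k4⟩ := h2 a ha
          have hax' : π a ≠ x := fun h => hx (h ▸ k1)
          have hay' : π a ≠ y := fun h => hy (h ▸ k1)
          simp only [hax, hay, hax', hay', if_false]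
          refine ⟨List.mem_cons_of_mem _ ((hmem _).2 (Or.inr k1)), k2, k3, ?_⟩
          exact k4.imp (List.mem_cons_of_mem _) (List.mem_cons_of_mem _)
      · intro t ht
        rcases List.mem_cons.1 ht with rfl | ht
        · simp
        · obtain ⟨k1, k2⟩ := h3 t ht
          have hax : t.1 ≠ x := fun h => hx (h ▸ k1)
          have hay : t.1 ≠ y := fun h => hy (h ▸ k1)
          exact ⟨List.mem_cons_of_mem _ ((hmem _).2 (Or.inr k1)), by simp [hax, hay, k2]⟩

end Lists

/-! ### Semicircular families: moments and the conjugate relation -/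

section Semicircular

open FreeAlgebra

variable {κ : Type*}

/-- The monomial of the free algebra spelled by a list of indeterminates. -/
def word (w : List κ) : FreeAlgebra ℂ κ := (w.map (ι ℂ)).prod

@[simp]
theorem word_nil : word ([] : List κ) = 1 := rfl

theorem word_cons (a : κ) (w : List κ) : word (a :: w) = ι ℂ a * word w := by
  simp [word]

theorem word_append (u v : List κ) : word (u ++ v) = word u * word v := by
  simp [word]

theorem basisFreeMonoid_eq_word (w : FreeMonoid κ) :
    basisFreeMonoid ℂ κ w = word w.toList := by
  simp only [basisFreeMonoid, Module.Basis.map_apply, Finsupp.coe_basisSingleOne]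
  change (equivMonoidAlgebraFreeMonoid (R := ℂ)).symm (MonoidAlgebra.single w 1) = _
  simp only [equivMonoidAlgebraFreeMonoid, AlgEquiv.ofAlgHom_symm_apply]
  rw [MonoidAlgebra.lift_single, one_smul, FreeMonoid.lift_apply]
  rfl

/-- A property of elements of the free algebra that is stable under linear combinations holds as
soon as it holds for all monomials. -/
theorem word_induction {motive : FreeAlgebra ℂ κ → Prop} (hw : ∀ w, motive (word w))
    (hadd : ∀ x y, motive x → motive y → motive (x + y))
    (hsmul : ∀ (c : ℂ) x, motive x → motive (c • x)) (x : FreeAlgebra ℂ κ) : motive x := by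
  have hx : x ∈ Submodule.span ℂ (Set.range (basisFreeMonoid ℂ κ)) := by
    rw [Module.Basis.span_eq]; trivial
  induction hx using Submodule.span_induction with
  | mem x h =>
    obtain ⟨w, rfl⟩ := h
    rw [basisFreeMonoid_eq_word]
    exact hw _
  | zero => simpa using hsmul 0 _ (hw [])
  | add x y _ _ hx hy => exact hadd x y hx hy
  | smul c x _ hx => exact hsmul c x hx

/-- The joint moments of a centred semicircular family with covariance `c`, given by the
recursion `m (a w) = ∑ c(a, b) m(u) m(v)` over the decompositions `w = u b v`. -/
noncomputable def semicircularMoment (c : κ → κ → ℂ) : List κ → ℂ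
  | [] => 1
  | a :: w => ((splits w).attach.map fun t =>
      c a t.1.2.1 * (semicircularMoment c t.1.1 * semicircularMoment c t.1.2.2)).sum
termination_by w => w.length
decreasing_by
  all_goals
    have := length_of_mem_splits t.2
    simp
    omega

theorem semicircularMoment_nil (c : κ → κ → ℂ) : semicircularMoment c [] = 1 := by
  rw [semicircularMoment]

theorem semicircularMoment_cons (c : κ → κ → ℂ) (a : κ) (w : List κ) :
    semicircularMoment c (a :: w) = ((splits w).map fun t =>
      c a t.2.1 * (semicircularMoment c t.1 * semicircularMoment c t.2.2)).sum := by
  rw [semicircularMoment]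
  conv_rhs => rw [← List.attach_map_subtype_val (splits w), List.map_map]
  rfl

/-- The linear functional on the free algebra whose moments are those of a semicircular family
with covariance `c`. -/
noncomputable def semicircularFunctional (c : κ → κ → ℂ) : FreeAlgebra ℂ κ →ₗ[ℂ] ℂ :=
  (basisFreeMonoid ℂ κ).constr ℂ fun w => semicircularMoment c w.toList

theorem semicircularFunctional_word (c : κ → κ → ℂ) (w : List κ) :
    semicircularFunctional c (word w) = semicircularMoment c w := by
  have := (basisFreeMonoid ℂ κ).constr_basis ℂ
    (fun w => semicircularMoment c w.toList) (FreeMonoid.ofList w)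
  rwa [basisFreeMonoid_eq_word] at this

/-- The trilinear form sending `(q, p, r)`, where `q` is a monomial, to
`∑ c(a, b) φ(p u) φ(v r)`, the sum being over the decompositions `q = u b v`. It is
`(φ ⊗ φ)(p · ∂ₐ q · r)` for the free difference quotient `∂ₐ` twisted by the covariance `c`. -/
noncomputable def splitForm (c : κ → κ → ℂ) (a : κ) :
    FreeAlgebra ℂ κ →ₗ[ℂ] FreeAlgebra ℂ κ →ₗ[ℂ] FreeAlgebra ℂ κ →ₗ[ℂ] ℂ :=
  (basisFreeMonoid ℂ κ).constr ℂ fun w => ((splits w.toList).map fun t => c a t.2.1 •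
    (LinearMap.mul ℂ ℂ).compl₁₂
      (semicircularFunctional c ∘ₗ LinearMap.mulRight ℂ (word t.1))
      (semicircularFunctional c ∘ₗ LinearMap.mulLeft ℂ (word t.2.2))).sum

variable (c : κ → κ → ℂ)

theorem splitForm_word (a : κ) (w : List κ) (p r : FreeAlgebra ℂ κ) :
    splitForm c a (word w) p r = ((splits w).map fun t => c a t.2.1 *
      (semicircularFunctional c (p * word t.1) * semicircularFunctional c (word t.2.2 * r))).sum := by
  have := (basisFreeMonoid ℂ κ).constr_basis ℂ (fun w => ((splits w.toList).map fun t => c a t.2.1 •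
    (LinearMap.mul ℂ ℂ).compl₁₂
      (semicircularFunctional c ∘ₗ LinearMap.mulRight ℂ (word t.1))
      (semicircularFunctional c ∘ₗ LinearMap.mulLeft ℂ (word t.2.2))).sum) (FreeMonoid.ofList w)
  rw [basisFreeMonoid_eq_word] at this
  rw [splitForm]
  simp only [FreeMonoid.toList_ofList] at this
  rw [this]
  induction splits w with
  | nil => simp
  | cons t l ih => simp [ih]

theorem splitForm_one (a : κ) (p r : FreeAlgebra ℂ κ) : splitForm c a 1 p r = 0 := by
  rw [← word_nil, splitForm_word]
  simp [splits]

theorem splitForm_mul (a : κ) (q q' p r : FreeAlgebra ℂ κ) :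
    splitForm c a (q * q') p r = splitForm c a q p (q' * r) + splitForm c a q' (p * q) r := by
  induction q using word_induction with
  | hw w =>
    induction q' using word_induction with
    | hw w' =>
      rw [← word_append, splitForm_word, splitForm_word, splitForm_word, splits_append]
      simp [Function.comp_def, word_append, mul_assoc]
    | hadd x y hx hy =>
      simp only [mul_add, map_add, LinearMap.add_apply, add_mul, hx, hy]; ring
    | hsmul k x hx =>
      simp only [mul_smul_comm, map_smul, LinearMap.smul_apply, smul_mul_assoc, hx, smul_add]
  | hadd x y hx hy =>
    simp only [mul_add, map_add, LinearMap.add_apply, add_mul, hx, hy]; ring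
  | hsmul k x hx =>
    simp only [mul_smul_comm, map_smul, LinearMap.smul_apply, smul_mul_assoc, hx, smul_add]

/-- The Schwinger–Dyson equation `φ(x_a q) = (φ ⊗ φ)(∂ₐ q)`, which characterises semicircular
families. -/
theorem semicircularFunctional_ι_mul (a : κ) (q : FreeAlgebra ℂ κ) :
    semicircularFunctional c (ι ℂ a * q) = splitForm c a q 1 1 := by
  induction q using word_induction with
  | hw w =>
    rw [← word_cons, semicircularFunctional_word, semicircularMoment_cons, splitForm_word]
    simp [semicircularFunctional_word]
  | hadd x y hx hy => simp only [mul_add, map_add, LinearMap.add_apply, hx, hy]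
  | hsmul k x hx => simp only [mul_smul_comm, map_smul, LinearMap.smul_apply, hx]

theorem semicircularFunctional_one : semicircularFunctional c 1 = 1 := by
  rw [← word_nil, semicircularFunctional_word, semicircularMoment_nil]

theorem splitForm_ι (a b : κ) (p r : FreeAlgebra ℂ κ) : splitForm c a (ι ℂ b) p r =
    c a b * (semicircularFunctional c p * semicircularFunctional c r) := by
  have : ι ℂ b = word [b] := by simp [word]
  rw [this, splitForm_word]
  simp [splits]

/-! ### Freeness in semicircular families -/

theorem mem_adjoin_induction {s : Set κ} {motive : FreeAlgebra ℂ κ → Prop}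
    (hw : ∀ w : List κ, (∀ a ∈ w, a ∈ s) → motive (word w))
    (hadd : ∀ x y, motive x → motive y → motive (x + y))
    (hsmul : ∀ (k : ℂ) x, motive x → motive (k • x)) {x : FreeAlgebra ℂ κ}
    (hx : x ∈ Algebra.adjoin ℂ (ι ℂ '' s)) : motive x := by
  rw [← Subalgebra.mem_toSubmodule, Algebra.adjoin_eq_span] at hx
  induction hx using Submodule.span_induction with
  | mem x h =>
    obtain ⟨l, hl, rfl⟩ := Submonoid.exists_list_of_mem_closure h
    have : ∃ w : List κ, (∀ a ∈ w, a ∈ s) ∧ w.map (ι ℂ) = l := by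
      clear h
      induction l with
      | nil => exact ⟨[], by simp, rfl⟩
      | cons y l ih =>
        obtain ⟨w, h1, h2⟩ := ih fun y hy => hl y (List.mem_cons_of_mem _ hy)
        obtain ⟨a, ha, rfl⟩ := hl y List.mem_cons_self
        exact ⟨a :: w, by simpa using ⟨ha, h1⟩, by simp [h2]⟩
    obtain ⟨w, h1, rfl⟩ := this
    exact hw w h1
  | zero => simpa using hsmul 0 _ (hw [] (by simp))
  | add x y _ _ hx hy => exact hadd x y hx hy
  | smul c x _ hx => exact hsmul c x hx

variable {I : Type*} (cl : κ → I)

/-- The unital algebra generated by the indeterminates of class `k`. -/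
def classAlgebra (k : I) : Subalgebra ℂ (FreeAlgebra ℂ κ) :=
  Algebra.adjoin ℂ (ι ℂ '' {a | cl a = k})

variable {cl c}

theorem splitForm_eq_zero_of_mem_classAlgebra (hc : ∀ a b, cl a ≠ cl b → c a b = 0) {a : κ}
    {k : I} (hk : cl a ≠ k) {x : FreeAlgebra ℂ κ} (hx : x ∈ classAlgebra cl k)
    (p r : FreeAlgebra ℂ κ) : splitForm c a x p r = 0 := by
  refine mem_adjoin_induction (motive := fun x => splitForm c a x p r = 0) ?_ ?_ ?_ hx
  · intro w hw
    rw [splitForm_word]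
    refine List.sum_eq_zero fun y hy => ?_
    obtain ⟨t, ht, rfl⟩ := List.mem_map.1 hy
    have : t.2.1 ∈ w := by rw [mem_splits.1 ht]; simp
    rw [hc a t.2.1 (by rw [show cl t.2.1 = k from hw _ this]; exact hk), zero_mul]
  · intro x y hx hy
    simp [hx, hy]
  · intro k x hx
    simp [hx]

theorem word_mem_classAlgebra {k : I} {w : List κ} (hw : ∀ a ∈ w, cl a = k) :
    word w ∈ classAlgebra cl k := by
  refine Subalgebra.list_prod_mem _ fun x hx => ?_
  obtain ⟨a, ha, rfl⟩ := List.mem_map.1 hx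
  exact Algebra.subset_adjoin ⟨a, hw a ha, rfl⟩

/-- A list of elements `(k, x)`, with `x` a centred element of the `k`-th algebra. -/
def IsCentredList (cl : κ → I) (c : κ → κ → ℂ) (L : List (I × FreeAlgebra ℂ κ)) : Prop :=
  ∀ y ∈ L, y.2 ∈ classAlgebra cl y.1 ∧ semicircularFunctional c y.2 = 0

/-- Induction step for freeness: if alternating centred products of length at most `n` vanish in
expectation, then they still do when multiplied by a monomial in the indeterminates of a class
different from that of the first factor. Expanding the first letter of the monomial by the
Schwinger–Dyson equation cuts the product at a later factor of the same class, and everything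
between the two letters is again an alternating product. -/
theorem semicircularFunctional_word_mul_eq_zero (hc : ∀ a b, cl a ≠ cl b → c a b = 0) {n : ℕ}
    (hn : ∀ L : List (I × FreeAlgebra ℂ κ), L ≠ [] → L.length ≤ n → IsCentredList cl c L →
      (L.map Prod.fst).IsChain (· ≠ ·) → semicircularFunctional c (L.map Prod.snd).prod = 0)
    {k : I} (w : List κ) (hw : ∀ a ∈ w, cl a = k) (L : List (I × FreeAlgebra ℂ κ))
    (hL0 : L ≠ []) (hLn : L.length ≤ n) (hL : IsCentredList cl c L)
    (hch : (k :: L.map Prod.fst).IsChain (· ≠ ·)) :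
    semicircularFunctional c (word w * (L.map Prod.snd).prod) = 0 := by
  induction hm : w.length using Nat.strong_induction_on generalizing w L with
  | _ m ih =>
    cases w with
    | nil => simpa using hn L hL0 hLn hL hch.tail
    | cons a w =>
      simp only [List.length_cons] at hm
      have hak : cl a = k := hw a List.mem_cons_self
      have hw' : ∀ b ∈ w, cl b = k := fun b hb => hw b (List.mem_cons_of_mem _ hb)
      rw [word_cons, mul_assoc, semicircularFunctional_ι_mul, splitForm_mul, one_mul, mul_one]
      have h1 : splitForm c a (word w) 1 (L.map Prod.snd).prod = 0 := by
        rw [splitForm_word]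
        refine List.sum_eq_zero fun y hy => ?_
        obtain ⟨t, ht, rfl⟩ := List.mem_map.1 hy
        have hlen := length_of_mem_splits ht
        have hsub : ∀ b ∈ t.2.2, cl b = k := fun b hb => hw' b (by
          rw [mem_splits.1 ht]; simp [hb])
        rw [ih t.2.2.length (by omega) t.2.2 hsub L hL0 hLn hL hch rfl]
        simp
      rw [h1, zero_add]
      suffices H : ∀ suf pre : List (I × FreeAlgebra ℂ κ), pre ++ suf = L →
          splitForm c a (suf.map Prod.snd).prod (word w * (pre.map Prod.snd).prod) 1 = 0 by
        simpa using H L [] rfl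
      intro suf
      induction suf with
      | nil => intro pre _; exact splitForm_one c a _ _
      | cons y suf ihs =>
        intro pre hpre
        obtain ⟨j, x⟩ := y
        have hx := hL (j, x) (by rw [← hpre]; simp)
        rw [List.map_cons, List.prod_cons, splitForm_mul, mul_one, mul_assoc]
        have h2 := ihs (pre ++ [(j, x)]) (by rw [← hpre]; simp)
        simp only [List.map_append, List.map_cons, List.map_nil, List.prod_append,
          List.prod_singleton] at h2
        rw [h2, add_zero]
        by_cases hjk : j = k
        swap
        · exact splitForm_eq_zero_of_mem_classAlgebra hc (by rw [hak]; exact Ne.symm hjk) hx.1 _ _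
        subst hjk
        rw [← hpre] at hch hLn hL
        have hpre0 : pre ≠ [] := by
          rintro rfl
          simp at hch
        have hch1 : (j :: pre.map Prod.fst).IsChain (· ≠ ·) := by
          rw [List.map_append, ← List.cons_append] at hch
          exact (List.isChain_append.1 hch).1
        have hch2 : (j :: (pre.map Prod.fst ++ [j])).IsChain (· ≠ ·) := by
          have : j :: (pre ++ (j, x) :: suf).map Prod.fst =
              (j :: (pre.map Prod.fst ++ [j])) ++ suf.map Prod.fst := by simp
          rw [this] at hch
          exact (List.isChain_append.1 hch).1
        have hlenL : (pre ++ (j, x) :: suf).length = pre.length + suf.length + 1 := by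
          simp; omega
        have hpreC : IsCentredList cl c pre := fun y hy => hL y (by simp [hy])
        -- The part of the product before the cut vanishes: centre its last factor.
        have key : ∀ u : List κ, (∀ b ∈ u, cl b = j) →
            semicircularFunctional c (word w * (pre.map Prod.snd).prod * word u) = 0 := by
          intro u hu
          set z : FreeAlgebra ℂ κ := word u - algebraMap ℂ _ (semicircularFunctional c (word u))
          have hz : word u = z + algebraMap ℂ _ (semicircularFunctional c (word u)) := by simp [z]
          have e1 := ih w.length (by omega) w hw' pre hpre0 (by omega) hpreC hch1 rfl
          have e2 := ih w.length (by omega) w hw' (pre ++ [(j, z)]) (by simp)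
            (by simp; omega) (by
              intro y hy
              rcases List.mem_append.1 hy with hy | hy
              · exact hpreC y hy
              · rw [List.mem_singleton] at hy
                subst hy
                refine ⟨Subalgebra.sub_mem _ (word_mem_classAlgebra hu)
                  (Subalgebra.algebraMap_mem _ _), ?_⟩
                simp [z, Algebra.algebraMap_eq_smul_one, semicircularFunctional_one])
            (by simpa using hch2) rfl
          simp only [List.map_append, List.map_cons, List.map_nil, List.prod_append,
            List.prod_singleton, ← mul_assoc] at e2
          rw [hz, mul_add, map_add, e2, Algebra.algebraMap_eq_smul_one, mul_smul_comm, mul_one,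
            map_smul, e1]
          simp
        refine mem_adjoin_induction (motive := fun x => splitForm c a x
          (word w * (pre.map Prod.snd).prod) (suf.map Prod.snd).prod = 0) ?_ ?_ ?_ hx.1
        · intro w2 hw2
          rw [splitForm_word]
          refine List.sum_eq_zero fun y hy => ?_
          obtain ⟨t, ht, rfl⟩ := List.mem_map.1 hy
          rw [key t.1 fun b hb => hw2 b (by rw [mem_splits.1 ht]; simp [hb])]
          simp
        · intro x y hx hy
          simp [hx, hy]
        · intro k x hx
          simp [hx]

/-- In a semicircular family whose covariance vanishes between different classes of
indeterminates, the algebras generated by the classes are free. -/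
theorem isFree_classAlgebra (hc : ∀ a b, cl a ≠ cl b → c a b = 0) :
    IsFree (semicircularFunctional c) (classAlgebra cl) := by
  have H : ∀ n, ∀ L : List (I × FreeAlgebra ℂ κ), L ≠ [] → L.length ≤ n → IsCentredList cl c L →
      (L.map Prod.fst).IsChain (· ≠ ·) → semicircularFunctional c (L.map Prod.snd).prod = 0 := by
    intro n
    induction n with
    | zero =>
      intro L h0 hn
      exact absurd (List.length_eq_zero_iff.1 (Nat.le_zero.1 hn)) h0
    | succ n ih =>
      intro L h0 hn hL hch
      cases L with
      | nil => exact absurd rfl h0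
      | cons y L =>
        obtain ⟨k, x⟩ := y
        have hx := hL (k, x) List.mem_cons_self
        by_cases hL0 : L = []
        · subst hL0
          simpa using hx.2
        rw [List.map_cons, List.prod_cons]
        refine mem_adjoin_induction (motive := fun x => semicircularFunctional c
          (x * (L.map Prod.snd).prod) = 0) ?_ ?_ ?_ hx.1
        · intro w hw
          exact semicircularFunctional_word_mul_eq_zero hc ih w hw L hL0 (by simpa using hn)
            (fun y hy => hL y (List.mem_cons_of_mem _ hy)) hch
        · intro x y hx hy
          simp [add_mul, hx, hy]
        · intro k x hx
          simp [hx]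
  intro n i a ha h0 hi
  have := H (n + 1) (List.ofFn fun j => (i j, a j)) (by simp) (by simp) (by
    intro y hy
    obtain ⟨j, rfl⟩ := (List.mem_ofFn' _ _).1 hy
    exact ⟨ha j, h0 j⟩) (by
    rw [List.map_ofFn, List.isChain_iff_getElem]
    intro j hj
    simp only [List.length_ofFn] at hj
    simp only [List.getElem_ofFn, Function.comp_apply]
    exact hi ⟨j, by omega⟩)
  rwa [List.map_ofFn] at this

/-! ### Circular elements -/

/-- Freeness is inherited along a homomorphism that intertwines the functionals. -/
theorem IsFree.comap {A B : Type*} [Ring A] [Algebra ℂ A] [Ring B] [Algebra ℂ B] {J : Type*}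
    {φ : B →ₗ[ℂ] ℂ} {S : J → Subalgebra ℂ B} (h : IsFree φ S) (f : A →ₐ[ℂ] B)
    {R : J → Subalgebra ℂ A} (hR : ∀ k, ∀ x ∈ R k, f x ∈ S k) :
    IsFree (φ ∘ₗ f.toLinearMap) R := by
  intro n i a ha h0 hi
  have := h n i (fun j => f (a j)) (fun j => hR _ _ (ha j)) h0 hi
  simpa [map_list_prod, List.map_ofFn, Function.comp_def] using this

/-- A linear substitution `x_a ↦ ∑ⱼ M(a, j) s_j` turns a semicircular family with covariance `d`
into one with covariance `M d Mᵀ`. -/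
theorem semicircularFunctional_eq_comp {J : Type*} [Fintype J] {d : J → J → ℂ}
    {c : κ → κ → ℂ} (M : κ → J → ℂ) (hM : ∀ a b, c a b = ∑ i, ∑ j, M a i * M b j * d i j) :
    semicircularFunctional c = semicircularFunctional d ∘ₗ
      (lift ℂ fun a => ∑ j, M a j • ι ℂ j).toLinearMap := by
  set f := lift ℂ fun a => ∑ j, M a j • ι ℂ j with hf
  have hι : ∀ a, f (ι ℂ a) = ∑ j, M a j • ι ℂ j := fun a => by simp [hf]
  have key : ∀ (a : κ) (w : List κ) (p : FreeAlgebra ℂ J),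
      ∑ j, M a j * splitForm d j (f (word w)) p 1 = ((splits w).map fun t => c a t.2.1 *
        (semicircularFunctional d (p * f (word t.1)) *
          semicircularFunctional d (f (word t.2.2)))).sum := by
    intro a w
    induction w with
    | nil => intro p; simp [splits, splitForm_one]
    | cons b w ih =>
      intro p
      simp only [word_cons, map_mul, splitForm_mul, mul_one, mul_add, Finset.sum_add_distrib, ih,
        splits, List.map_cons, List.sum_cons, word_nil, map_one, List.map_map, Function.comp_def,
        mul_assoc]
      congr 1
      rw [hι, hM, Finset.sum_mul]
      refine Finset.sum_congr rfl fun i _ => ?_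
      simp only [map_sum, map_smul, LinearMap.sum_apply, LinearMap.smul_apply, splitForm_ι,
        smul_eq_mul, Finset.mul_sum, Finset.sum_mul]
      refine Finset.sum_congr rfl fun j _ => ?_
      ring
  have hw : ∀ n (w : List κ), w.length = n →
      semicircularFunctional c (word w) = semicircularFunctional d (f (word w)) := by
    intro n
    induction n using Nat.strong_induction_on with
    | _ n ih =>
      intro w hn
      cases w with
      | nil => simp [semicircularFunctional_one]
      | cons a w =>
        simp only [List.length_cons] at hn
        rw [semicircularFunctional_word, semicircularMoment_cons, word_cons, map_mul, hι,
          Finset.sum_mul]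
        simp only [map_sum, smul_mul_assoc, map_smul, semicircularFunctional_ι_mul, smul_eq_mul]
        rw [key]
        congr 1
        refine List.map_congr_left fun t ht => ?_
        have hlen := length_of_mem_splits ht
        rw [← semicircularFunctional_word, ← semicircularFunctional_word,
          ih _ (by omega) t.1 rfl, ih _ (by omega) t.2.2 rfl, one_mul]
  ext x
  induction x using word_induction with
  | hw w => exact hw _ w rfl
  | hadd x y hx hy => rw [map_add, map_add, hx, hy]
  | hsmul k x hx => rw [map_smul, map_smul, hx]

theorem sum_map_splits_replicate (a : κ) (n : ℕ) (F : List κ → κ → List κ → ℂ) :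
    ((splits (List.replicate n a)).map fun t => F t.1 t.2.1 t.2.2).sum =
      ∑ i ∈ Finset.range n, F (List.replicate i a) a (List.replicate (n - 1 - i) a) := by
  induction n generalizing F with
  | zero => simp [splits]
  | succ n ih =>
    rw [List.replicate_succ, splits, List.map_cons, List.sum_cons, List.map_map,
      Finset.sum_range_succ']
    have := ih fun u b v => F (a :: u) b v
    simp only [Function.comp_def, this]
    rw [add_comm]
    congr 1
    refine Finset.sum_congr rfl fun i hi => ?_
    rw [List.replicate_succ]
    congr 2
    have := Finset.mem_range.1 hi
    omega

theorem isSemicircular_ι {a : κ} (ha : c a a = 1) :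
    IsSemicircular (semicircularFunctional c) (ι ℂ a) := by
  have hrec : ∀ n, semicircularFunctional c (ι ℂ a ^ (n + 1)) = ∑ i ∈ Finset.range n,
      semicircularFunctional c (ι ℂ a ^ i) * semicircularFunctional c (ι ℂ a ^ (n - 1 - i)) := by
    have hp : ∀ n, ι ℂ a ^ n = word (List.replicate n a) := fun n => by simp [word]
    intro n
    simp only [hp, semicircularFunctional_word]
    rw [List.replicate_succ, semicircularMoment_cons, sum_map_splits_replicate a n fun u b v =>
      c a b * (semicircularMoment c u * semicircularMoment c v)]
    simp [ha]
  have hodd : ∀ k, semicircularFunctional c (ι ℂ a ^ (2 * k + 1)) = 0 := by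
    intro k
    induction k using Nat.strong_induction_on with
    | _ k ih =>
      rw [hrec]
      refine Finset.sum_eq_zero fun i hi => ?_
      have hi := Finset.mem_range.1 hi
      rcases Nat.even_or_odd' i with ⟨j, rfl | rfl⟩
      · rw [show 2 * k - 1 - 2 * j = 2 * (k - 1 - j) + 1 by omega, ih _ (by omega), mul_zero]
      · rw [ih _ (by omega), zero_mul]
  refine fun k => ⟨?_, hodd k⟩
  induction k using Nat.strong_induction_on with
  | _ k ih =>
    cases k with
    | zero => simp [semicircularFunctional_one]
    | succ k =>
      rw [show 2 * (k + 1) = 2 * k + 1 + 1 by ring, hrec, catalan_succ,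
        Finset.sum_range_succ_comm]
      have hs : ∀ (g : ℕ → ℂ), (∀ j, g (2 * j + 1) = 0) → ∀ k,
          ∑ i ∈ Finset.range (2 * k), g i = ∑ j ∈ Finset.range k, g (2 * j) := by
        intro g hg k
        induction k with
        | zero => simp
        | succ k ih =>
          rw [show 2 * (k + 1) = 2 * k + 1 + 1 by ring, Finset.sum_range_succ,
            Finset.sum_range_succ, hg, add_zero, ih, Finset.sum_range_succ]
      rw [hs _ (fun j => by rw [hodd, zero_mul]), add_comm, ← Finset.sum_range_succ
        (fun j => semicircularFunctional c (ι ℂ a ^ (2 * j)) *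
          semicircularFunctional c (ι ℂ a ^ (2 * k + 1 - 1 - 2 * j))), ← Fin.sum_univ_eq_sum_range]
      push_cast
      refine Finset.sum_congr rfl fun j _ => ?_
      have hj := j.2
      rw [show 2 * k - 2 * (j : ℕ) = 2 * (k - j) by omega, ih _ (by omega),
        ih _ (by omega)]

/-- The covariance of a circular element and its adjoint. -/
def circularCov (a b : Unit × Bool) : ℂ := if a.2 = b.2 then 0 else 1

/-- Two centred semicircular elements with the covariance of a circular element and its adjoint are
the combinations `(s₁ ± i s₂) / √2` of two free standard semicircular elements. -/
theorem isCircular_ι : IsCircular (semicircularFunctional circularCov) (ι ℂ ((), false))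
    (ι ℂ ((), true)) := by
  have h2 : ((Real.sqrt 2 : ℂ)⁻¹) * (Real.sqrt 2 : ℂ)⁻¹ = 2⁻¹ := by
    rw [← mul_inv, ← Complex.ofReal_mul, Real.mul_self_sqrt (by norm_num)]
    norm_num
  set r : ℂ := (Real.sqrt 2 : ℂ)⁻¹ with hr
  set d : Bool → Bool → ℂ := fun i j => if i = j then 1 else 0 with hd
  set M : Unit × Bool → Bool → ℂ := fun a j =>
    if j then (if a.2 then -(r * Complex.I) else r * Complex.I) else r with hM
  have hI : r * Complex.I * (r * Complex.I) = -2⁻¹ := by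
    rw [mul_mul_mul_comm, h2, Complex.I_mul_I]; ring
  have hφ := semicircularFunctional_eq_comp (c := circularCov) (d := d) M (by
    rintro ⟨⟨⟩, a⟩ ⟨⟨⟩, b⟩
    cases a <;> cases b <;> simp [hM, hd, circularCov, h2, hI] <;> norm_num)
  set f : FreeAlgebra ℂ (Unit × Bool) →ₐ[ℂ] FreeAlgebra ℂ Bool :=
    lift ℂ fun a => ∑ j, M a j • ι ℂ j with hf
  rw [hφ]
  unfold IsCircular
  intro x
  have hx : ∀ b, f (x b) = ι ℂ b := by
    intro b
    cases b
    · simp [x, hf, hM, ← hr]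
      trans (2 * (r * r)) • ι ℂ false
      · module
      · rw [h2]; simp
    · simp [x, hf, hM, ← hr]
      trans (-2 * (r * Complex.I * (r * Complex.I))) • ι ℂ true
      · module
      · rw [hI]; simp
  refine ⟨fun b k => ?_, ?_⟩
  · have := isSemicircular_ι (c := d) (a := b) (by simp [hd]) k
    simpa [hx] using this
  · have hfree := isFree_classAlgebra (cl := id) (c := d) (fun a b hab => by
      simpa [hd] using hab)
    refine hfree.comap f fun b y hy => ?_
    have : Algebra.adjoin ℂ {x b} ≤ (classAlgebra id b).comap f := by
      rw [Algebra.adjoin_le_iff, Set.singleton_subset_iff]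
      rw [SetLike.mem_coe, Subalgebra.mem_comap, hx]
      exact Algebra.subset_adjoin ⟨b, rfl, rfl⟩
    exact this hy

end Semicircular

/-! ### Gaussian functionals and the Wick formula -/

section GaussianFunctional

open MvPolynomial

variable {V : Type*} [Fintype V]

/-- `E` is the expectation functional, on polynomials, of a centred Gaussian family with covariance
`C`. It is pinned down by Gaussian integration by parts. -/
structure IsGaussianFunctional (E : MvPolynomial V ℂ →ₗ[ℂ] ℂ) (C : V → V → ℂ) : Prop where
  map_one : E 1 = 1
  map_X_mul : ∀ v f, E (X v * f) = ∑ v', C v v' * E (pderiv v' f)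

/-- Linear combinations of Gaussian variables form a Gaussian family. -/
theorem IsGaussianFunctional.comp_linear {V' : Type*} [Fintype V']
    {E : MvPolynomial V' ℂ →ₗ[ℂ] ℂ} {C : V' → V' → ℂ} (h : IsGaussianFunctional E C)
    (M : V → V' → ℂ) :
    IsGaussianFunctional
      (E ∘ₗ (aeval fun v => ∑ j, M v j • (X j : MvPolynomial V' ℂ)).toLinearMap)
      (fun v v' => ∑ i, ∑ j, M v i * M v' j * C i j) := by
  classical
  set F := aeval (R := ℂ) fun v => ∑ j, M v j • (X j : MvPolynomial V' ℂ) with hF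
  have hchain : ∀ (u : V') (f : MvPolynomial V ℂ),
      pderiv u (F f) = ∑ v, M v u • F (pderiv v f) := by
    intro u f
    induction f using MvPolynomial.induction_on with
    | C a => simp [hF]
    | add p q hp hq => simp [hp, hq, Finset.sum_add_distrib]
    | mul_X p w hp =>
      have hX : pderiv u (F (X w)) = MvPolynomial.C (M w u) := by
        simp [hF, pderiv_X, Pi.single_apply, smul_eq_C_mul]
      rw [map_mul, Derivation.leibniz, hp, hX]
      simp only [Derivation.leibniz, map_add, smul_add, Finset.sum_add_distrib, smul_eq_mul,
        map_mul, pderiv_X, Finset.mul_sum, mul_smul_comm]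
      congr 1
      rw [Finset.sum_eq_single w]
      · simp [smul_eq_C_mul, mul_comm]
      · intro b _ hb
        simp [hb.symm]
      · simp
  refine ⟨by simp [h.map_one], fun v f => ?_⟩
  have h1 : F (X v) = ∑ j, M v j • X j := by simp [hF]
  simp only [LinearMap.comp_apply, AlgHom.toLinearMap_apply, map_mul, h1, smul_mul_assoc,
    map_smul, h.map_X_mul, hchain, map_sum, Finset.mul_sum, Finset.sum_mul, smul_eq_mul]
  conv_lhs =>
    enter [2, i]
    rw [Finset.sum_comm]
  rw [Finset.sum_comm]
  refine Finset.sum_congr rfl fun w _ => Finset.sum_congr rfl fun i _ =>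
    Finset.sum_congr rfl fun j _ => ?_
  ring

theorem derivation_list_prod {R A α : Type*} [CommRing R] [CommRing A] [Algebra R A]
    (D : Derivation R A A) (f : α → A) (l : List α) :
    D (l.map f).prod = ((splits l).map fun t =>
      ((t.1 ++ t.2.2).map f).prod * D (f t.2.1)).sum := by
  induction l with
  | nil => simp [splits]
  | cons a l ih =>
    simp only [List.map_cons, List.prod_cons, Derivation.leibniz, ih, smul_eq_mul, splits,
      List.sum_cons, List.nil_append, List.map_map, Function.comp_def, List.cons_append,
      mul_assoc, List.sum_map_mul_left]
    rw [add_comm]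

/-- The Wick formula. -/
theorem IsGaussianFunctional.map_list_prod [DecidableEq V] {E : MvPolynomial V ℂ →ₗ[ℂ] ℂ}
    {C : V → V → ℂ} (h : IsGaussianFunctional E C) (l : List V) :
    E (l.map X).prod = ((pairings l).map fun p => (p.map fun t => C t.1 t.2).prod).sum := by
  induction hn : l.length using Nat.strong_induction_on generalizing l with
  | _ n ih =>
    cases l with
    | nil => simp [pairings_nil, h.map_one]
    | cons v l =>
      simp only [List.length_cons] at hn
      have key : ∀ v', E (pderiv v' (l.map X).prod) = ((splits l).map fun t =>
          if t.2.1 = v' then ((pairings (t.1 ++ t.2.2)).map fun p =>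
            (p.map fun t => C t.1 t.2).prod).sum else 0).sum := by
        intro v'
        rw [derivation_list_prod, map_list_sum, List.map_map]
        congr 1
        refine List.map_congr_left fun t ht => ?_
        have hl := length_of_mem_splits ht
        simp only [Function.comp_apply, pderiv_X, Pi.single_apply]
        split_ifs
        · rw [mul_one, ih _ (by simp; omega) _ rfl]
        · simp
      rw [List.map_cons, List.prod_cons, h.map_X_mul, pairings_cons]
      simp only [key, List.map_flatMap, List.map_map]
      have hsum : ∀ L : List (List V × V × List V), ∑ v', C v v' * (L.map fun t =>
          if t.2.1 = v' then ((pairings (t.1 ++ t.2.2)).map fun p =>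
            (p.map fun t => C t.1 t.2).prod).sum else 0).sum =
          (L.flatMap fun t => (pairings (t.1 ++ t.2.2)).map
            ((fun p => (p.map fun t => C t.1 t.2).prod) ∘ List.cons (v, t.2.1))).sum := by
        intro L
        induction L with
        | nil => simp
        | cons t L ihL =>
          simp only [List.map_cons, List.sum_cons, mul_add, Finset.sum_add_distrib, ihL,
            List.flatMap_cons, List.sum_append]
          congr 1
          simp [Function.comp_def, List.sum_map_mul_left]
      exact hsum _

end GaussianFunctional

/-! ### Loop equations for Gaussian matrices -/

section LoopEquations

open MvPolynomial Matrix Asymptotics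

variable {κ : Type*} {N : ℕ}

/-- The generic matrix with label `a`: its entries are independent indeterminates. -/
noncomputable def genericMatrix (N : ℕ) (a : κ) :
    Matrix (Fin N) (Fin N) (MvPolynomial (κ × (Fin N × Fin N)) ℂ) :=
  Matrix.of fun i j => X (a, (i, j))

/-- The product of the generic matrices along a word. -/
noncomputable def genericWord (N : ℕ) (w : List κ) :
    Matrix (Fin N) (Fin N) (MvPolynomial (κ × (Fin N × Fin N)) ℂ) :=
  (w.map (genericMatrix N)).prod

/-- The product of the traces of several words in the generic matrices. -/
noncomputable def traceProd (N : ℕ) (ws : List (List κ)) : MvPolynomial (κ × (Fin N × Fin N)) ℂ :=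
  (ws.map fun w => (genericWord N w).trace).prod

/-- The covariance of the entries of independent Gaussian matrices, with covariance `c` between
the letters: the `(i, j)` entry is only correlated to the `(j, i)` entries. -/
noncomputable def matrixCov (c : κ → κ → ℂ) (N : ℕ) (v v' : κ × (Fin N × Fin N)) : ℂ :=
  if v'.2 = v.2.swap then (N : ℂ)⁻¹ * c v.1 v'.1 else 0

theorem genericWord_append (u v : List κ) :
    genericWord N (u ++ v) = genericWord N u * genericWord N v := by
  simp [genericWord]

variable [DecidableEq κ]

theorem pderiv_genericWord (b : κ) (p : Fin N × Fin N) (w : List κ) :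
    (genericWord N w).map (pderiv (b, p)) = ((splits w).map fun t => if t.2.1 = b then
      genericWord N t.1 * Matrix.single p.1 p.2 1 * genericWord N t.2.2 else 0).sum := by
  have hmul : ∀ A B : Matrix (Fin N) (Fin N) (MvPolynomial (κ × (Fin N × Fin N)) ℂ),
      (A * B).map (pderiv (b, p)) = A.map (pderiv (b, p)) * B + A * B.map (pderiv (b, p)) := by
    intro A B
    ext1 i j
    simp [Matrix.mul_apply, Finset.sum_add_distrib, Derivation.leibniz, mul_comm, add_comm]
  have hgen : ∀ a : κ, (genericMatrix N a).map (pderiv (b, p)) =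
      if a = b then Matrix.single p.1 p.2 1 else 0 := by
    intro a
    ext1 i j
    by_cases hab : a = b
    · by_cases hp : p.1 = i ∧ p.2 = j
      · obtain ⟨rfl, rfl⟩ := hp
        simp [genericMatrix, hab, pderiv_X]
      · have : (a, (i, j)) ≠ (b, p) := by
          rintro h
          cases h
          simp at hp
        rw [if_pos hab, Matrix.single_apply_of_ne _ _ _ _ _ hp]
        simp only [genericMatrix, Matrix.map_apply, Matrix.of_apply]
        exact pderiv_X_of_ne this
    · have : (a, (i, j)) ≠ (b, p) := fun h => hab (Prod.mk.inj h).1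
      simp [genericMatrix, hab, pderiv_X_of_ne this]
  induction w with
  | nil =>
    ext1 i j
    by_cases hij : i = j <;> simp [genericWord, splits, hij]
  | cons a w ih =>
    have hcons : ∀ w, genericWord N (a :: w) = genericMatrix N a * genericWord N w := fun w => by
      simp [genericWord]
    rw [hcons, hmul, ih, hgen, splits, List.map_cons, List.sum_cons, List.map_map,
      ← List.sum_map_mul_left]
    congr 1
    · split_ifs <;> simp [genericWord]
    · congr 1
      refine List.map_congr_left fun t _ => ?_
      simp only [Function.comp_apply, hcons]
      split_ifs <;> simp [mul_assoc]

theorem matrix_list_sum_apply {α R m n : Type*} [AddCommMonoid R] (l : List α)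
    (f : α → Matrix m n R) (i : m) (j : n) :
    (l.map f).sum i j = (l.map fun t => f t i j).sum := by
  induction l with
  | nil => simp
  | cons a l ih => simp [ih]

theorem sum_list_sum_map {α γ R : Type*} [AddCommMonoid R] (s : Finset γ) (l : List α)
    (f : γ → α → R) : ∑ i ∈ s, (l.map (f i)).sum = (l.map fun t => ∑ i ∈ s, f i t).sum := by
  induction l with
  | nil => simp
  | cons a l ih => simp [ih, Finset.sum_add_distrib]

theorem mul_single_mul_apply {n R : Type*} [Fintype n] [DecidableEq n] [CommRing R]
    (A B : Matrix n n R) (i j k l : n) :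
    (A * Matrix.single i j (1 : R) * B : Matrix n n R) k l = A k i * B j l := by
  rw [Matrix.mul_assoc, Matrix.mul_apply, Finset.sum_eq_single i]
  · simp [Matrix.single_mul_apply_same]
  · intro b _ hb
    simp [Matrix.single_mul_apply_of_ne _ _ _ _ _ hb]
  · simp

theorem sum_pderiv_genericWord (b : κ) (w : List κ) :
    ∑ p : Fin N × Fin N, pderiv (b, p.swap) (genericWord N w p.2 p.1) =
      ((splits w).map fun t => if t.2.1 = b then
        (genericWord N t.1).trace * (genericWord N t.2.2).trace else 0).sum := by
  have h : ∀ p : Fin N × Fin N, pderiv (b, p.swap) (genericWord N w p.2 p.1) =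
      ((splits w).map fun t => if t.2.1 = b then
        genericWord N t.1 p.2 p.2 * genericWord N t.2.2 p.1 p.1 else 0).sum := by
    intro p
    have := congrFun (congrFun (pderiv_genericWord b p.swap w) p.2) p.1
    rw [Matrix.map_apply, matrix_list_sum_apply] at this
    rw [this]
    congr 1
    refine List.map_congr_left fun t _ => ?_
    split_ifs
    · rw [mul_single_mul_apply]; rfl
    · rfl
  simp only [h]
  rw [sum_list_sum_map]
  congr 1
  refine List.map_congr_left fun t _ => ?_
  split_ifs
  · rw [Fintype.sum_prod_type_right, Matrix.trace, Matrix.trace, Finset.sum_mul_sum]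
    rfl
  · simp

theorem sum_mul_pderiv_trace (b : κ)
    (A : Matrix (Fin N) (Fin N) (MvPolynomial (κ × (Fin N × Fin N)) ℂ)) (w : List κ) :
    ∑ p : Fin N × Fin N, A p.2 p.1 * pderiv (b, p.swap) (genericWord N w).trace =
      ((splits w).map fun t => if t.2.1 = b then
        (A * genericWord N (t.2.2 ++ t.1)).trace else 0).sum := by
  have h : ∀ p : Fin N × Fin N, pderiv (b, p.swap) (genericWord N w).trace =
      ((splits w).map fun t => if t.2.1 = b then
        genericWord N (t.2.2 ++ t.1) p.1 p.2 else 0).sum := by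
    intro p
    have h1 : pderiv (b, p.swap) (genericWord N w).trace =
        ((genericWord N w).map (pderiv (b, p.swap))).trace := by
      simp [Matrix.trace]
    rw [h1, pderiv_genericWord, Matrix.trace]
    simp only [Matrix.diag_apply, matrix_list_sum_apply]
    rw [sum_list_sum_map]
    congr 1
    refine List.map_congr_left fun t _ => ?_
    split_ifs
    · simp only [mul_single_mul_apply]
      rw [genericWord_append, Matrix.mul_apply]
      exact Finset.sum_congr rfl fun i _ => mul_comm _ _
    · simp
  simp only [h, ← List.sum_map_mul_left]
  rw [sum_list_sum_map]
  congr 1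
  refine List.map_congr_left fun t _ => ?_
  split_ifs
  · rw [Fintype.sum_prod_type_right, Matrix.trace]
    simp [Matrix.mul_apply]
  · simp

variable [Fintype κ]

/-- The loop equation: integration by parts for the first letter of the first trace either splits
this trace in two or merges it with another one. -/
theorem IsGaussianFunctional.loop_equation {c : κ → κ → ℂ}
    {E : MvPolynomial (κ × (Fin N × Fin N)) ℂ →ₗ[ℂ] ℂ}
    (h : IsGaussianFunctional E (matrixCov c N)) (a : κ) (w : List κ) (ws : List (List κ)) :
    E (traceProd N ((a :: w) :: ws)) = (N : ℂ)⁻¹ *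
      (((splits w).map fun t => c a t.2.1 * E (traceProd N (t.1 :: t.2.2 :: ws))).sum +
        ((splits ws).map fun s => ((splits s.2.1).map fun t => c a t.2.1 *
          E (traceProd N ((w ++ t.2.2 ++ t.1) :: (s.1 ++ s.2.2)))).sum).sum) := by
  have hcons : ∀ (w : List κ) ws, traceProd N (w :: ws) =
      (genericWord N w).trace * traceProd N ws := fun w ws => by simp [traceProd]
  have happ : ∀ ws ws' : List (List κ), traceProd N (ws ++ ws') =
      traceProd N ws * traceProd N ws' := fun ws ws' => by simp [traceProd]
  have htr : (genericWord N (a :: w)).trace =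
      ∑ p : Fin N × Fin N, X (a, p) * genericWord N w p.2 p.1 := by
    have : genericWord N (a :: w) = genericMatrix N a * genericWord N w := by simp [genericWord]
    rw [this, Matrix.trace, Fintype.sum_prod_type]
    simp [Matrix.mul_apply, genericMatrix]
  rw [hcons, htr, Finset.sum_mul, map_sum]
  have hcov : ∀ (p : Fin N × Fin N) (g : κ × (Fin N × Fin N) → ℂ),
      ∑ v', matrixCov c N (a, p) v' * g v' = ∑ b, (N : ℂ)⁻¹ * c a b * g (b, p.swap) := by
    intro p g
    rw [Fintype.sum_prod_type]
    refine Finset.sum_congr rfl fun b _ => ?_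
    rw [Finset.sum_eq_single p.swap]
    · simp [matrixCov]
    · intro q _ hq
      simp [matrixCov, hq]
    · simp
  simp only [mul_assoc, h.map_X_mul]
  simp only [hcov]
  rw [Finset.sum_comm]
  simp only [mul_assoc, ← Finset.mul_sum]
  congr 1
  have hb : ∀ b, ∑ p : Fin N × Fin N,
      E (pderiv (b, p.swap) (genericWord N w p.2 p.1 * traceProd N ws)) =
      ((splits w).map fun t => if t.2.1 = b then E (traceProd N (t.1 :: t.2.2 :: ws)) else 0).sum +
        ((splits ws).map fun s => ((splits s.2.1).map fun t => if t.2.1 = b then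
          E (traceProd N ((w ++ t.2.2 ++ t.1) :: (s.1 ++ s.2.2))) else 0).sum).sum := by
    intro b
    rw [← map_sum]
    have h1 : ∑ p : Fin N × Fin N, pderiv (b, p.swap) (genericWord N w p.2 p.1 * traceProd N ws) =
        (∑ p : Fin N × Fin N, pderiv (b, p.swap) (genericWord N w p.2 p.1)) * traceProd N ws +
        ((splits ws).map fun s => traceProd N (s.1 ++ s.2.2) *
          ∑ p : Fin N × Fin N, genericWord N w p.2 p.1 *
            pderiv (b, p.swap) (genericWord N s.2.1).trace).sum := by
      simp only [Derivation.leibniz, smul_eq_mul, Finset.sum_add_distrib, Finset.sum_mul]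
      rw [add_comm]
      congr 1
      · exact Finset.sum_congr rfl fun p _ => mul_comm _ _
      · have hd : ∀ p : Fin N × Fin N, pderiv (b, p.swap) (traceProd N ws) = ((splits ws).map
            fun s => traceProd N (s.1 ++ s.2.2) *
              pderiv (b, p.swap) (genericWord N s.2.1).trace).sum := fun p =>
          derivation_list_prod _ _ _
        simp only [hd, ← List.sum_map_mul_left]
        rw [sum_list_sum_map]
        congr 1
        refine List.map_congr_left fun s _ => ?_
        rw [Finset.mul_sum]
        exact Finset.sum_congr rfl fun p _ => by ring
    rw [h1, sum_pderiv_genericWord, map_add]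
    congr 1
    · rw [← List.sum_map_mul_right, map_list_sum, List.map_map]
      congr 1
      refine List.map_congr_left fun t _ => ?_
      simp only [Function.comp_apply, hcons]
      split_ifs <;> simp [mul_assoc]
    · rw [map_list_sum, List.map_map]
      congr 1
      refine List.map_congr_left fun s _ => ?_
      simp only [Function.comp_apply]
      rw [sum_mul_pderiv_trace, ← List.sum_map_mul_left, map_list_sum, List.map_map]
      congr 1
      refine List.map_congr_left fun t _ => ?_
      simp only [Function.comp_apply, hcons, List.append_assoc, genericWord_append w]
      split_ifs <;> simp [mul_comm]
  simp only [hb, mul_add, Finset.sum_add_distrib, ← List.sum_map_mul_left]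
  rw [sum_list_sum_map, sum_list_sum_map]
  congr 1
  · congr 1
    refine List.map_congr_left fun t _ => ?_
    simp
  · congr 1
    refine List.map_congr_left fun s _ => ?_
    rw [sum_list_sum_map]
    congr 1
    refine List.map_congr_left fun t _ => ?_
    simp

theorem isBigO_list_sum {α : Type*} (l : List α) (f : α → ℕ → ℂ) {g : ℕ → ℝ}
    (h : ∀ t ∈ l, f t =O[atTop] g) : (fun N => (l.map fun t => f t N).sum) =O[atTop] g := by
  induction l with
  | nil => simpa using isBigO_zero g atTop
  | cons a l ih =>
    simp only [List.map_cons, List.sum_cons]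
    exact (h a List.mem_cons_self).add (ih fun t ht => h t (List.mem_cons_of_mem _ ht))

/-- Expectations of products of traces of independent Gaussian matrices factorize into the moments
of a semicircular family, with a relative error `O(N⁻²)`. -/
theorem isBigO_traceProd {c : κ → κ → ℂ}
    {E : (N : ℕ) → MvPolynomial (κ × (Fin N × Fin N)) ℂ →ₗ[ℂ] ℂ}
    (h : ∀ N, IsGaussianFunctional (E N) (matrixCov c N)) (ws : List (List κ)) :
    (fun N : ℕ => E N (traceProd N ws) * ((N : ℂ)⁻¹) ^ ws.length -
      (ws.map (semicircularMoment c)).prod) =O[atTop] fun N : ℕ => ((N : ℝ)⁻¹) ^ 2 := by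
  induction hn : (ws.map List.length).sum using Nat.strong_induction_on generalizing ws with
  | _ n ih =>
    induction ws generalizing n with
    | nil => simpa [traceProd, (h _).map_one] using isBigO_zero _ _
    | cons w ws ihws =>
      cases w with
      | nil =>
        refine (ihws n ih (by simpa using hn)).congr' ?_ EventuallyEq.rfl
        filter_upwards [eventually_ne_atTop 0] with N hN
        have hN : (N : ℂ) ≠ 0 := Nat.cast_ne_zero.2 hN
        have : traceProd N (([] : List κ) :: ws) = (N : ℂ) • traceProd N ws := by
          simp [traceProd, genericWord, smul_eq_C_mul]
        rw [this, map_smul, List.map_cons, semicircularMoment_nil, List.prod_cons, one_mul,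
          List.length_cons, pow_succ, smul_eq_mul]
        field_simp
      | cons a w =>
        simp only [List.map_cons, List.sum_cons, List.length_cons] at hn
        have h1 : (fun N : ℕ => ((splits w).map fun t => c a t.2.1 *
            (E N (traceProd N (t.1 :: t.2.2 :: ws)) * ((N : ℂ)⁻¹) ^ (ws.length + 2) -
              semicircularMoment c t.1 * semicircularMoment c t.2.2 *
                (ws.map (semicircularMoment c)).prod)).sum) =O[atTop]
            fun N : ℕ => ((N : ℝ)⁻¹) ^ 2 := by
          refine isBigO_list_sum _ _ fun t ht => IsBigO.const_mul_left ?_ _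
          have hl := length_of_mem_splits ht
          have := ih _ (by simp; omega) (t.1 :: t.2.2 :: ws) rfl
          simpa [mul_assoc] using this
        have h2 : (fun N : ℕ => ((splits ws).map fun s => ((splits s.2.1).map fun t => c a t.2.1 *
            (E N (traceProd N ((w ++ t.2.2 ++ t.1) :: (s.1 ++ s.2.2))) *
              ((N : ℂ)⁻¹) ^ (ws.length + 2))).sum).sum) =O[atTop] fun N : ℕ => ((N : ℝ)⁻¹) ^ 2 := by
          refine isBigO_list_sum _ _ fun s hs => isBigO_list_sum _ _ fun t ht =>
            IsBigO.const_mul_left ?_ _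
          have hls := length_of_mem_splits hs
          have hlt := length_of_mem_splits ht
          have hsum : (ws.map List.length).sum =
              (s.1.map List.length).sum + s.2.1.length + (s.2.2.map List.length).sum := by
            conv_lhs => rw [mem_splits.1 hs]
            simp
            omega
          have h3 := ih _ (by simp; omega) ((w ++ t.2.2 ++ t.1) :: (s.1 ++ s.2.2)) rfl
          have h4 : (fun N : ℕ => E N (traceProd N ((w ++ t.2.2 ++ t.1) :: (s.1 ++ s.2.2))) *
              ((N : ℂ)⁻¹) ^ ws.length) =O[atTop] fun _ : ℕ => (1 : ℝ) := by
            have h5 : (fun N : ℕ => ((N : ℝ)⁻¹) ^ 2) =O[atTop] fun _ : ℕ => (1 : ℝ) := by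
              refine IsBigO.of_bound 1 (Eventually.of_forall fun N => ?_)
              rw [norm_pow, norm_one, mul_one, norm_inv, Real.norm_natCast]
              exact pow_le_one₀ (by positivity) (Nat.cast_inv_le_one N)
            have h6 := (h3.trans h5).add (isBigO_const_const
              ((((w ++ t.2.2 ++ t.1) :: (s.1 ++ s.2.2)).map (semicircularMoment c)).prod)
              (one_ne_zero (α := ℝ)) atTop)
            refine h6.congr_left fun N => ?_
            rw [sub_add_cancel]
            congr 2
            simp
            omega
          have h7 : (fun N : ℕ => ((N : ℂ)⁻¹) ^ 2) =O[atTop] fun N : ℕ => ((N : ℝ)⁻¹) ^ 2 :=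
            IsBigO.of_bound 1 (Eventually.of_forall fun N => by simp)
          refine (h4.mul h7).congr (fun N => by ring) (fun N => by ring)
        refine (h1.add h2).congr' ?_ EventuallyEq.rfl
        filter_upwards with N
        rw [(h N).loop_equation, List.map_cons, semicircularMoment_cons, List.prod_cons,
          List.length_cons]
        have e1 : ((splits w).map fun t => c a t.2.1 *
            (E N (traceProd N (t.1 :: t.2.2 :: ws)) * ((N : ℂ)⁻¹) ^ (ws.length + 2) -
              semicircularMoment c t.1 * semicircularMoment c t.2.2 *
                (ws.map (semicircularMoment c)).prod)).sum =
            ((splits w).map fun t => c a t.2.1 * E N (traceProd N (t.1 :: t.2.2 :: ws))).sum *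
              ((N : ℂ)⁻¹) ^ (ws.length + 2) -
            ((splits w).map fun t => c a t.2.1 * (semicircularMoment c t.1 *
              semicircularMoment c t.2.2)).sum * (ws.map (semicircularMoment c)).prod := by
          generalize splits w = L
          induction L with
          | nil => simp
          | cons t L ihL => simp only [List.map_cons, List.sum_cons, ihL]; ring
        rw [e1]
        simp only [← mul_assoc, List.sum_map_mul_right]
        ring

end LoopEquations

/-! ### Integration by parts for Gaussian measures -/

section GaussianMeasures

open MvPolynomial

theorem hasDerivAt_gaussianPDFReal (v : ℝ≥0) (x : ℝ) :
    HasDerivAt (gaussianPDFReal 0 v) (-(x / v) * gaussianPDFReal 0 v x) x := by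
  rw [gaussianPDFReal_def]
  have h : HasDerivAt (fun x : ℝ => -(x - 0) ^ 2 / (2 * v)) (-(x / v)) x := by
    have := (((hasDerivAt_id x).sub_const 0).pow 2).neg.div_const (2 * (v : ℝ))
    refine this.congr_deriv ?_
    simp
    ring
  refine (h.exp.const_mul _).congr_deriv ?_
  ring

theorem integrable_pow_gaussianReal (v : ℝ≥0) (n : ℕ) :
    Integrable (fun x : ℝ => x ^ n) (gaussianReal 0 v) := by
  have := (memLp_id_gaussianReal (μ := 0) (v := v) n).integrable_norm_pow'
  refine (integrable_norm_iff (by fun_prop)).1 ?_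
  simpa using this

/-- Recursion for the moments of a centred Gaussian variable. -/
theorem integral_pow_succ_gaussianReal (v : ℝ≥0) (n : ℕ) :
    ∫ x, x ^ (n + 1) ∂(gaussianReal 0 v) = v * n * ∫ x, x ^ (n - 1) ∂(gaussianReal 0 v) := by
  by_cases hv : v = 0
  · simp [hv]
  have hv' : (v : ℝ) ≠ 0 := by exact_mod_cast hv
  have hint : ∀ k, Integrable (fun x : ℝ => x ^ k * gaussianPDFReal 0 v x) := by
    intro k
    have := integrable_pow_gaussianReal v k
    rw [gaussianReal_of_var_ne_zero _ hv, integrable_withDensity_iff (by fun_prop)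
      (Eventually.of_forall fun x => by simp [gaussianPDF])] at this
    simpa [gaussianPDF, ENNReal.toReal_ofReal (gaussianPDFReal_nonneg _ _ _)] using this
  rw [integral_gaussianReal_eq_integral_smul hv, integral_gaussianReal_eq_integral_smul hv]
  have key := integral_mul_deriv_eq_deriv_mul_of_integrable (u := fun x : ℝ => x ^ n)
    (u' := fun x => n * x ^ (n - 1)) (v := gaussianPDFReal 0 v)
    (v' := fun x => -(x / v) * gaussianPDFReal 0 v x)
    (fun x _ => hasDerivAt_pow n x) (fun x _ => hasDerivAt_gaussianPDFReal v x)
    (((hint (n + 1)).const_mul (-(v : ℝ)⁻¹)).congr (Eventually.of_forall fun x => by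
      simp [div_eq_mul_inv]; ring))
    (((hint (n - 1)).const_mul (n : ℝ)).congr (Eventually.of_forall fun x => by
      simp; ring))
    (hint n)
  have e1 : ∀ x : ℝ, x ^ n * (-(x / v) * gaussianPDFReal 0 v x) =
      (-(v : ℝ)⁻¹) * (gaussianPDFReal 0 v x • x ^ (n + 1)) := fun x => by
    simp [div_eq_mul_inv]; ring
  have e2 : ∀ x : ℝ, n * x ^ (n - 1) * gaussianPDFReal 0 v x =
      n * (gaussianPDFReal 0 v x • x ^ (n - 1)) := fun x => by simp; ring
  simp only [e1, e2, integral_const_mul] at key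
  field_simp at key
  linarith

variable {Ω V : Type*} [MeasurableSpace Ω] {μ : Measure Ω}

/-- Polynomials in random variables with moments of all orders have moments of all orders. -/
theorem memLp_eval [IsFiniteMeasure μ] {Y : V → Ω → ℂ}
    (hY : ∀ v, ∀ p : ℝ≥0, MemLp (Y v) p μ) (f : MvPolynomial V ℂ) (p : ℝ≥0) :
    MemLp (fun ω => eval (fun v => Y v ω) f) p μ := by
  induction f using MvPolynomial.induction_on generalizing p with
  | C a => simpa using memLp_const a
  | add f g hf hg =>
    simp only [map_add]
    exact (hf p).add (hg p)
  | mul_X f v hf =>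
    have h2 : ENNReal.HolderTriple ((2 * p : ℝ≥0) : ENNReal) ((2 * p : ℝ≥0) : ENNReal) p := by
      constructor
      by_cases hp : p = 0
      · simp [hp]
      · have : (2 * p)⁻¹ + (2 * p)⁻¹ = p⁻¹ := by field_simp; norm_num
        rw [← ENNReal.coe_inv (by positivity), ← ENNReal.coe_inv hp, ← ENNReal.coe_add, this]
    simpa [Pi.mul_def] using (hY v (2 * p)).mul (hf (2 * p))

theorem integrable_eval [IsFiniteMeasure μ] {Y : V → Ω → ℂ}
    (hY : ∀ v, ∀ p : ℝ≥0, MemLp (Y v) p μ) (f : MvPolynomial V ℂ) :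
    Integrable (fun ω => eval (fun v => Y v ω) f) μ :=
  memLp_one_iff_integrable.1 (by simpa using memLp_eval hY f 1)

/-- The functional `f ↦ E f(Y)` on polynomials, for random variables with moments of all
orders. -/
noncomputable def expectation [IsFiniteMeasure μ] {Y : V → Ω → ℂ}
    (hY : ∀ v, ∀ p : ℝ≥0, MemLp (Y v) p μ) : MvPolynomial V ℂ →ₗ[ℂ] ℂ where
  toFun f := ∫ ω, eval (fun v => Y v ω) f ∂μ
  map_add' f g := by
    simp only [map_add]
    exact integral_add (integrable_eval hY f) (integrable_eval hY g)
  map_smul' c f := by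
    simp only [smul_eval, smul_eq_mul, RingHom.id_apply]
    exact integral_const_mul _ _

theorem expectation_monomial [Fintype V] [IsFiniteMeasure μ] {Y : V → Ω → ℂ}
    (hY : ∀ v, ∀ p : ℝ≥0, MemLp (Y v) p μ) (e : V →₀ ℕ) :
    expectation hY (monomial e 1) = ∫ ω, ∏ v, Y v ω ^ e v ∂μ := by
  simp [expectation, eval_monomial, Finsupp.prod_fintype]

/-- Gaussian integration by parts has to be checked on monomials only. -/
theorem isGaussianFunctional_expectation [Fintype V] [DecidableEq V] [IsProbabilityMeasure μ]
    {Y : V → Ω → ℂ} (hY : ∀ v, ∀ p : ℝ≥0, MemLp (Y v) p μ) {C : V → V → ℂ}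
    (h : ∀ v (e : V →₀ ℕ), ∫ ω, ∏ u, Y u ω ^ (e + Finsupp.single v 1 : V →₀ ℕ) u ∂μ =
      ∑ v', C v v' * e v' * ∫ ω, ∏ u, Y u ω ^ (e - Finsupp.single v' 1 : V →₀ ℕ) u ∂μ) :
    IsGaussianFunctional (expectation hY) C := by
  refine ⟨by simp [expectation], fun v f => ?_⟩
  induction f using MvPolynomial.induction_on' with
  | monomial e a =>
    have h1 : (X v * monomial e a : MvPolynomial V ℂ) =
        a • monomial (e + Finsupp.single v 1) 1 := by
      rw [X, monomial_mul, smul_monomial, add_comm]; simp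
    have h2 : ∀ v', pderiv v' (monomial e a) =
        (a * e v') • monomial (e - Finsupp.single v' 1) (1 : ℂ) := by
      intro v'
      rw [pderiv_monomial, smul_monomial]; simp
    simp only [h1, h2, map_smul, expectation_monomial, h, Finset.mul_sum, smul_eq_mul]
    exact Finset.sum_congr rfl fun v' _ => by ring
  | add p q hp hq => simp only [mul_add, map_add, hp, hq, Finset.sum_add_distrib]

/-- Integration by parts for a family made of independent blocks follows from integration by parts
in each of the blocks. Here `ρ v` is the block of `v`, and `Y v` is a function of `ξ (ρ v)`. -/
theorem isGaussianFunctional_of_blocks [Fintype V] [DecidableEq V] [IsProbabilityMeasure μ]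
    {J : Type*} [Fintype J] [DecidableEq J] {ξ : J → Ω → ℂ} (hξ : iIndepFun ξ μ)
    (hξm : ∀ r, Measurable (ξ r)) (ρ : V → J) {y : V → ℂ → ℂ} (hy : ∀ v, Measurable (y v))
    {Y : V → Ω → ℂ} (hY : ∀ v, ∀ p : ℝ≥0, MemLp (Y v) p μ)
    (hYy : ∀ v, Y v =ᵐ[μ] fun ω => y v (ξ (ρ v) ω)) {C : V → V → ℂ}
    (hC : ∀ v v', ρ v ≠ ρ v' → C v v' = 0)
    (h : ∀ v (e : V →₀ ℕ),
      ∫ ω, ∏ u with ρ u = ρ v, Y u ω ^ (e + Finsupp.single v 1 : V →₀ ℕ) u ∂μ =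
        ∑ v', C v v' * e v' * ∫ ω, ∏ u with ρ u = ρ v, Y u ω ^ (e - Finsupp.single v' 1 : V →₀ ℕ) u ∂μ) :
    IsGaussianFunctional (expectation hY) C := by
  have hall : ∀ᵐ ω ∂μ, ∀ v, Y v ω = y v (ξ (ρ v) ω) := ae_all_iff.2 fun v => hYy v
  have hprod : ∀ e : V →₀ ℕ, ∫ ω, ∏ u, Y u ω ^ e u ∂μ =
      ∏ r, ∫ ω, ∏ u with ρ u = r, Y u ω ^ e u ∂μ := by
    intro e
    have h1 : ∀ r, ∫ ω, ∏ u with ρ u = r, Y u ω ^ e u ∂μ =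
        ∫ ω, ∏ u with ρ u = r, y u (ξ r ω) ^ e u ∂μ := by
      intro r
      refine integral_congr_ae ?_
      filter_upwards [hall] with ω hω
      refine Finset.prod_congr rfl fun u hu => ?_
      rw [hω, (Finset.mem_filter.1 hu).2]
    simp only [h1]
    rw [← hξ.integral_fun_prod_comp (f := fun r z => ∏ u with ρ u = r, y u z ^ e u)
      (fun r => (hξm r).aemeasurable)
      (fun r => (Finset.measurable_fun_prod _ fun u _ =>
        (hy u).pow_const _).aestronglyMeasurable)]
    refine integral_congr_ae ?_
    filter_upwards [hall] with ω hω
    rw [← Finset.prod_fiberwise Finset.univ ρ]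
    refine Finset.prod_congr rfl fun r _ => Finset.prod_congr rfl fun u hu => ?_
    rw [hω, (Finset.mem_filter.1 hu).2]
  refine isGaussianFunctional_expectation hY fun v e => ?_
  have hother : ∀ e' : V →₀ ℕ, (∀ u, ρ u ≠ ρ v → e' u = e u) →
      ∫ ω, ∏ u, Y u ω ^ e' u ∂μ = (∫ ω, ∏ u with ρ u = ρ v, Y u ω ^ e' u ∂μ) *
        ∏ r ∈ Finset.univ.erase (ρ v), ∫ ω, ∏ u with ρ u = r, Y u ω ^ e u ∂μ := by
    intro e' he'
    rw [hprod, ← Finset.mul_prod_erase Finset.univ _ (Finset.mem_univ (ρ v))]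
    congr 1
    refine Finset.prod_congr rfl fun r hr => ?_
    congr 1
    ext ω
    refine Finset.prod_congr rfl fun u hu => ?_
    rw [he' u (by rw [(Finset.mem_filter.1 hu).2]; exact Finset.ne_of_mem_erase hr)]
  rw [hother (e + Finsupp.single v 1), h, Finset.sum_mul]
  · refine Finset.sum_congr rfl fun v' _ => ?_
    by_cases hv' : ρ v = ρ v'
    · rw [hother (e - Finsupp.single v' 1), mul_assoc]
      intro u hu
      have : v' ≠ u := fun h => hu (by rw [← h, hv'])
      simp [this]
    · simp [hC v v' hv']
  · intro u hu
    have : v ≠ u := fun h => hu (by rw [← h])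
    simp [this]

end GaussianMeasures

/-! ### The entries of a Gaussian random matrix form a Gaussian family -/

section GaussianMatrices

open MvPolynomial ComplexConjugate

theorem memLp_coord_gaussian_prod (v w : ℝ≥0) (b : Bool) (p : ℝ≥0) :
    MemLp (fun x : ℝ × ℝ => ((if b then x.2 else x.1 : ℝ) : ℂ)) p
      ((gaussianReal 0 v).prod (gaussianReal 0 w)) := by
  refine MemLp.ofReal ?_
  cases b
  · exact (memLp_id_gaussianReal p).comp_measurePreserving measurePreserving_fst
  · exact (memLp_id_gaussianReal p).comp_measurePreserving measurePreserving_snd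

theorem integral_ofReal_pow_succ_gaussianReal (v : ℝ≥0) (n : ℕ) :
    ∫ x : ℝ, (x : ℂ) ^ (n + 1) ∂(gaussianReal 0 v) =
      v * n * ∫ x : ℝ, (x : ℂ) ^ (n - 1) ∂(gaussianReal 0 v) := by
  have h := integral_pow_succ_gaussianReal v n
  have h' : ∀ k : ℕ, ∫ x : ℝ, (x : ℂ) ^ k ∂(gaussianReal 0 v) =
      ((∫ x, x ^ k ∂(gaussianReal 0 v) : ℝ) : ℂ) := by
    intro k
    have := integral_ofReal (μ := gaussianReal 0 v) (f := fun x : ℝ => x ^ k) (𝕜 := ℂ)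
    simpa using this
  rw [h', h', h]
  push_cast
  rfl

/-- Two independent real Gaussian variables form a Gaussian family. -/
theorem isGaussianFunctional_gaussian_prod (v : ℝ≥0) :
    IsGaussianFunctional (expectation (memLp_coord_gaussian_prod v v))
      (fun b b' => if b = b' then (v : ℂ) else 0) := by
  refine isGaussianFunctional_expectation _ fun b e => ?_
  have h : ∀ e : Bool →₀ ℕ, ∫ x : ℝ × ℝ, ∏ u : Bool, ((if u then x.2 else x.1 : ℝ) : ℂ) ^ e u
        ∂((gaussianReal 0 v).prod (gaussianReal 0 v)) =
      (∫ x : ℝ, (x : ℂ) ^ e false ∂(gaussianReal 0 v)) *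
        ∫ x : ℝ, (x : ℂ) ^ e true ∂(gaussianReal 0 v) := by
    intro e
    rw [← integral_prod_mul]
    simp [mul_comm]
  simp only [h]
  cases b
  · simp [integral_ofReal_pow_succ_gaussianReal, mul_assoc]
  · simp [integral_ofReal_pow_succ_gaussianReal]
    ring

/-- Integration by parts for a complex Gaussian variable and its conjugate. -/
theorem integral_complexGaussian (v : ℝ≥0) (a b : ℕ) :
    ∫ z, z ^ (a + 1) * conj z ^ b ∂(complexGaussian v) =
        v * b * ∫ z, z ^ a * conj z ^ (b - 1) ∂(complexGaussian v) ∧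
      ∫ z, z ^ a * conj z ^ (b + 1) ∂(complexGaussian v) =
        v * a * ∫ z, z ^ (a - 1) * conj z ^ b ∂(complexGaussian v) := by
  set M : Bool → Bool → ℂ := fun b j => if j then (if b then -Complex.I else Complex.I) else 1
    with hM
  have hE := (isGaussianFunctional_gaussian_prod (v / 2)).comp_linear M
  have hval : ∀ a b : ℕ, (expectation (memLp_coord_gaussian_prod (v / 2) (v / 2)) ∘ₗ
      (aeval fun b => ∑ j, M b j • (X j : MvPolynomial Bool ℂ)).toLinearMap)
        (X false ^ a * X true ^ b) = ∫ z, z ^ a * conj z ^ b ∂(complexGaussian v) := by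
    intro a b
    have hmeas : Measurable fun p : ℝ × ℝ => (⟨p.1, p.2⟩ : ℂ) :=
      Complex.measurableEquivRealProd.symm.measurable
    rw [complexGaussian, integral_map hmeas.aemeasurable (by fun_prop)]
    simp only [expectation, LinearMap.comp_apply, LinearMap.coe_mk, AddHom.coe_mk,
      AlgHom.toLinearMap_apply]
    congr 1
    ext p
    have h1 : (⟨p.1, p.2⟩ : ℂ) = p.1 + p.2 * Complex.I := Complex.mk_eq_add_mul_I _ _
    have h2 : conj (⟨p.1, p.2⟩ : ℂ) = p.1 - p.2 * Complex.I := by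
      rw [h1]; simp [sub_eq_add_neg]
    rw [h2, h1]
    simp [hM, smul_eval]
    ring
  have hcov : ∀ b b' : Bool, (∑ i, ∑ j, M b i * M b' j *
      (if i = j then ((v / 2 : ℝ≥0) : ℂ) else 0)) = if b = b' then 0 else (v : ℂ) := by
    intro b b'
    cases b <;> cases b' <;> simp [hM]
  have hpow : ∀ a b : ℕ, pderiv true (X false ^ a * X true ^ b : MvPolynomial Bool ℂ) =
      (b : ℂ) • (X false ^ a * X true ^ (b - 1)) ∧
      pderiv false (X false ^ a * X true ^ b : MvPolynomial Bool ℂ) =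
      (a : ℂ) • (X false ^ (a - 1) * X true ^ b) := by
    intro a b
    constructor <;>
    · simp [Derivation.leibniz, smul_eq_C_mul]
      ring
  simp only [hcov] at hE
  generalize (expectation (memLp_coord_gaussian_prod (v / 2) (v / 2)) ∘ₗ
      (aeval fun b => ∑ j, M b j • (X j : MvPolynomial Bool ℂ)).toLinearMap) = E at hE hval
  constructor
  · have := hE.map_X_mul false (X false ^ a * X true ^ b)
    rw [← mul_assoc, ← pow_succ', hval] at this
    rw [Fintype.sum_bool, (hpow a b).1, (hpow a b).2, map_smul, map_smul, hval, hval] at this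
    simpa [mul_assoc] using this
  · have := hE.map_X_mul true (X false ^ a * X true ^ b)
    rw [mul_left_comm, ← pow_succ', hval] at this
    rw [Fintype.sum_bool, (hpow a b).1, (hpow a b).2, map_smul, map_smul, hval, hval] at this
    simpa [mul_assoc] using this

variable {Ω : Type*} [MeasurableSpace Ω] {μ : Measure Ω} {N : ℕ}
  {G : Ω → Matrix (Fin N) (Fin N) ℂ}

theorem IsGaussianRandomMatrix.entry_swap (h : IsGaussianRandomMatrix μ G) (i j : Fin N) :
    ∀ᵐ ω ∂μ, G ω j i = conj (G ω i j) := by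
  filter_upwards [h.hermitian] with ω hω
  exact (hω.apply j i).symm

theorem IsGaussianRandomMatrix.entry_diag (h : IsGaussianRandomMatrix μ G) (i : Fin N) :
    ∀ᵐ ω ∂μ, G ω i i = ((G ω i i).re : ℂ) := by
  filter_upwards [h.entry_swap i i] with ω hω
  exact (Complex.conj_eq_iff_re.1 hω.symm).symm

theorem IsGaussianRandomMatrix.memLp_entry (h : IsGaussianRandomMatrix μ G)
    (p : Fin N × Fin N) (q : ℝ≥0) : MemLp (fun ω => G ω p.1 p.2) q μ := by
  have hlt : ∀ i j, i < j → MemLp (fun ω => G ω i j) q μ := by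
    intro i j hij
    have h1 : MemLp id q (μ.map fun ω => G ω i j) := by
      rw [h.law_offDiag i j hij, complexGaussian]
      have hmeas : Measurable fun p : ℝ × ℝ => (⟨p.1, p.2⟩ : ℂ) :=
        Complex.measurableEquivRealProd.symm.measurable
      rw [memLp_map_measure_iff (by fun_prop) hmeas.aemeasurable]
      have h2 := (memLp_coord_gaussian_prod ((N : ℝ≥0)⁻¹ / 2) ((N : ℝ≥0)⁻¹ / 2) false q).add
        ((memLp_coord_gaussian_prod ((N : ℝ≥0)⁻¹ / 2) ((N : ℝ≥0)⁻¹ / 2) true q).mul_const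
          Complex.I)
      refine h2.congr_norm (hmeas.aestronglyMeasurable) (Eventually.of_forall fun p => ?_)
      simp [Complex.mk_eq_add_mul_I]
    exact (memLp_map_measure_iff (by fun_prop) (h.measurable_entry i j).aemeasurable).1 h1
  obtain ⟨i, j⟩ := p
  rcases lt_trichotomy i j with hij | rfl | hij
  · exact hlt i j hij
  · have h1 : MemLp id q (μ.map fun ω => (G ω i i).re) := by
      rw [h.law_diag i]
      exact memLp_id_gaussianReal q
    have h2 := (memLp_map_measure_iff (by fun_prop)
      (Complex.measurable_re.comp (h.measurable_entry i i)).aemeasurable).1 h1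
    refine (h2.ofReal (K := ℂ)).ae_eq ?_
    filter_upwards [h.entry_diag i] with ω hω
    exact hω.symm
  · refine (hlt j i hij).congr_norm (h.measurable_entry i j).aestronglyMeasurable ?_
    filter_upwards [h.entry_swap j i] with ω hω
    simp [hω]

/-- The functional of expectation of polynomials in the entries of a Gaussian random matrix. -/
theorem IsGaussianRandomMatrix.isGaussianFunctional [IsProbabilityMeasure μ]
    (h : IsGaussianRandomMatrix μ G) :
    IsGaussianFunctional (expectation h.memLp_entry)
      (fun p q => if q = p.swap then (N : ℂ)⁻¹ else 0) := by
  set ρ : Fin N × Fin N → {p : Fin N × Fin N // p.1 ≤ p.2} := fun p =>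
    if hp : p.1 ≤ p.2 then ⟨p, hp⟩ else ⟨p.swap, (not_le.1 hp).le⟩ with hρ
  have hρ1 : ∀ p : Fin N × Fin N, p.1 ≤ p.2 → (ρ p).1 = p := fun p hp => by simp [hρ, hp]
  have hρ2 : ∀ p : Fin N × Fin N, ¬ p.1 ≤ p.2 → (ρ p).1 = p.swap := fun p hp => by simp [hρ, hp]
  have hρs : ∀ p q : Fin N × Fin N, ρ p = ρ q ↔ p = q ∨ p = q.swap := by
    intro p q
    rw [Subtype.ext_iff]
    constructor
    · intro hpq
      by_cases hp : p.1 ≤ p.2 <;> by_cases hq : q.1 ≤ q.2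
      · rw [hρ1 p hp, hρ1 q hq] at hpq; exact Or.inl hpq
      · rw [hρ1 p hp, hρ2 q hq] at hpq; exact Or.inr hpq
      · rw [hρ2 p hp, hρ1 q hq] at hpq; exact Or.inr (by rw [← hpq, Prod.swap_swap])
      · rw [hρ2 p hp, hρ2 q hq] at hpq; exact Or.inl (Prod.swap_injective hpq)
    · rintro (rfl | rfl)
      · rfl
      · rcases lt_trichotomy q.1 q.2 with hq | hq | hq
        · rw [hρ1 q hq.le, hρ2 _ (not_le.2 hq), Prod.swap_swap]
        · have : q.swap = q := Prod.ext hq.symm hq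
          rw [this]
        · rw [hρ2 q (not_le.2 hq), hρ1 _ hq.le]
  have hoff : ∀ i j, i < j → ∀ a b : ℕ, ∫ ω, G ω i j ^ a * G ω j i ^ b ∂μ =
      ∫ z, z ^ a * conj z ^ b ∂(complexGaussian (N : ℝ≥0)⁻¹) := by
    intro i j hij a b
    rw [← h.law_offDiag i j hij, integral_map (h.measurable_entry i j).aemeasurable (by fun_prop)]
    refine integral_congr_ae ?_
    filter_upwards [h.entry_swap i j] with ω hω
    rw [hω]
  have hdiag : ∀ i, ∀ a : ℕ, ∫ ω, G ω i i ^ a ∂μ =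
      ∫ x : ℝ, (x : ℂ) ^ a ∂(gaussianReal 0 (N : ℝ≥0)⁻¹) := by
    intro i a
    have hre : Measurable fun ω => (G ω i i).re :=
      Complex.measurable_re.comp (h.measurable_entry i i)
    rw [← h.law_diag i, integral_map hre.aemeasurable (by fun_prop)]
    refine integral_congr_ae ?_
    filter_upwards [h.entry_diag i] with ω hω
    conv_lhs => rw [hω]
  refine isGaussianFunctional_of_blocks h.indep (fun r => h.measurable_entry _ _) ρ
    (y := fun p z => if p.1 ≤ p.2 then z else conj z) ?_ h.memLp_entry ?_ ?_ ?_
  · intro p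
    split_ifs <;> fun_prop
  · intro p
    by_cases hp : p.1 ≤ p.2
    · simp only [hρ1 p hp, hp, if_true]
      rfl
    · simp only [hρ2 p hp, hp, if_false]
      exact h.entry_swap p.2 p.1
  · intro p q hpq
    rw [if_neg]
    rintro rfl
    exact hpq ((hρs _ _).2 (Or.inr (by simp)))
  · intro p e
    rw [Finset.sum_eq_single p.swap (fun q _ hq => by simp [hq]) (by simp), if_pos rfl]
    obtain ⟨i, j⟩ := p
    simp only [Prod.swap_prod_mk]
    by_cases hij : i = j
    · subst hij
      have hf : (Finset.univ.filter fun u => ρ u = ρ (i, i)) = {(i, i)} := by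
        ext u; simp [hρs]
      simp only [hf, Finset.prod_singleton, hdiag, Finsupp.add_apply, Finsupp.single_eq_same,
        Finsupp.tsub_apply]
      rw [integral_ofReal_pow_succ_gaussianReal]
      simp
    · have hne : (i, j) ≠ (j, i) := fun h => hij (Prod.mk.inj h).1
      have hf : (Finset.univ.filter fun u => ρ u = ρ (i, j)) = {(i, j), (j, i)} := by
        ext u; simp [hρs]
      simp only [hf, Finset.prod_pair hne]
      have e1 : (e + Finsupp.single (i, j) 1 : Fin N × Fin N →₀ ℕ) (i, j) = e (i, j) + 1 := by
        simp
      have e2 : (e + Finsupp.single (i, j) 1 : Fin N × Fin N →₀ ℕ) (j, i) = e (j, i) := by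
        simp [hne]
      have e3 : (e - Finsupp.single (j, i) 1 : Fin N × Fin N →₀ ℕ) (i, j) = e (i, j) := by
        simp [hne.symm]
      have e4 : (e - Finsupp.single (j, i) 1 : Fin N × Fin N →₀ ℕ) (j, i) = e (j, i) - 1 := by
        simp
      simp only [e1, e2, e3, e4]
      rcases lt_or_gt_of_ne hij with hlt | hlt
      · rw [hoff i j hlt, hoff i j hlt, (integral_complexGaussian _ _ _).1]
        simp
      · have hcomm : ∀ a b : ℕ, ∫ ω, G ω i j ^ a * G ω j i ^ b ∂μ =
            ∫ ω, G ω j i ^ b * G ω i j ^ a ∂μ := fun a b => by simp [mul_comm]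
        rw [hcomm, hcomm, hoff j i hlt, hoff j i hlt, (integral_complexGaussian _ _ _).2]
        simp

end GaussianMatrices

/-! ### Counting permutations subject to coincidences of values -/

section Counting

/-- If every free point of `Z` is tied to another point by `f`, at most one degree of freedom in two
survives among the functions that are prescribed off the free points. -/
theorem exists_card_tied_functions_le {Z α : Type*} [Fintype Z] [Fintype α]
    (known : Z → Prop) (c : Z → α) (f : Z → Z) (hf : ∀ z, ¬ known z → f z ≠ z)
    (Y : Finset (Z → α)) (hY1 : ∀ y ∈ Y, ∀ z, known z → y z = c z)
    (hY2 : ∀ y ∈ Y, ∀ z, ¬ known z → y (f z) = y z) :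
    ∃ q, 2 * q ≤ Nat.card {z // ¬ known z} ∧ Y.card ≤ Fintype.card α ^ q := by
  classical
  let r : Setoid Z := Relation.EqvGen.setoid fun a b => ¬ known a ∧ b = f a
  have hconst : ∀ y ∈ Y, ∀ a b, r a b → y a = y b := by
    intro y hy a b hab
    change Relation.EqvGen (fun a b => ¬ known a ∧ b = f a) a b at hab
    induction hab with
    | rel a b h => rw [h.2, hY2 y hy a h.1]
    | refl a => rfl
    | symm a b _ ih => exact ih.symm
    | trans a b c _ _ ih1 ih2 => exact ih1.trans ih2
  -- The classes of tied points that contain no prescribed point.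
  let Q := {c : Quotient r // ∀ z, (⟦z⟧ : Quotient r) = c → ¬ known z}
  have hout : ∀ c : Q, (⟦c.1.out⟧ : Quotient r) = c.1 := fun c => Quotient.out_eq _
  have hfout : ∀ c : Q, (⟦f c.1.out⟧ : Quotient r) = c.1 := by
    intro c
    rw [← hout c]
    refine Quotient.sound ?_
    rw [hout c]
    exact Relation.EqvGen.symm _ _ (Relation.EqvGen.rel _ _ ⟨c.2 _ (hout c), rfl⟩)
  refine ⟨Fintype.card Q, ?_, ?_⟩
  · let g : Q × Bool → {z // ¬ known z} := fun c =>
      if c.2 then ⟨c.1.1.out, c.1.2 _ (hout _)⟩ else ⟨f c.1.1.out, c.1.2 _ (hfout _)⟩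
    have hg : ∀ c, (⟦(g c).1⟧ : Quotient r) = c.1.1 := by
      rintro ⟨c, b⟩
      cases b
      · exact hfout c
      · exact hout c
    have hinj : Function.Injective g := by
      rintro ⟨c, b⟩ ⟨c', b'⟩ h
      have hc : c = c' := Subtype.ext (by rw [← hg (c, b), ← hg (c', b'), h])
      subst hc
      have h := congrArg Subtype.val h
      have hne := hf c.1.out (c.2 _ (hout c))
      cases b <;> cases b'
      · rfl
      · exact absurd h hne
      · exact absurd h.symm hne
      · rfl
    have := Fintype.card_le_of_injective g hinj
    rw [Nat.card_eq_fintype_card]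
    simpa [mul_comm] using this
  · rw [← Fintype.card_fun]
    refine Finset.card_le_card_of_injOn (fun y c => y c.1.out) (fun _ _ => Finset.mem_univ _) ?_
    intro y hy y' hy' h
    ext1 z
    by_cases hz : ∀ z', (⟦z'⟧ : Quotient r) = ⟦z⟧ → ¬ known z'
    · have h1 := congrFun h (⟨⟦z⟧, hz⟩ : Q)
      have h2 : r (⟦z⟧ : Quotient r).out z := Quotient.exact (Quotient.out_eq _)
      rw [← hconst y hy _ _ h2, ← hconst y' hy' _ _ h2]
      exact h1
    · push Not at hz
      obtain ⟨z', h1, h2⟩ := hz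
      have h3 : r z' z := Quotient.exact h1
      rw [← hconst y hy _ _ h3, ← hconst y' hy' _ _ h3, hY1 y hy _ h2, hY1 y' hy' _ h2]

/-- A random permutation takes prescribed values on a given set of `k` points with probability
`O(n⁻ᵏ)`. -/
theorem card_perm_prescribed_mul_le {X : Type*} [Fintype X] [DecidableEq X] (s : Finset X)
    (g : X → X) :
    (Finset.univ.filter fun σ : Equiv.Perm X => ∀ x ∈ s, σ x = g x).card *
      Fintype.card X ^ s.card ≤ s.card ^ s.card * (Fintype.card X).factorial := by
  have h1 : (Finset.univ.filter fun σ : Equiv.Perm X => ∀ x ∈ s, σ x = g x).card ≤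
      (Fintype.card X - s.card).factorial := by
    rcases Finset.eq_empty_or_nonempty
      (Finset.univ.filter fun σ : Equiv.Perm X => ∀ x ∈ s, σ x = g x) with h | ⟨σ₀, h₀⟩
    · rw [h]; simp
    · have hcard : Fintype.card {σ : Equiv.Perm X // ∀ a, ¬ (a ∉ s) → σ a = a} =
          (Fintype.card X - s.card).factorial := by
        rw [← Fintype.card_congr (Equiv.Perm.subtypeEquivSubtypePerm fun a => a ∉ s),
          Fintype.card_perm]
        congr 1
        rw [Fintype.card_subtype_compl]
        simp
      rw [← hcard, Fintype.card_subtype]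
      refine Finset.card_le_card_of_injOn (fun σ => σ₀⁻¹ * σ) ?_
        (fun _ _ _ _ h => mul_left_cancel h)
      intro σ hσ
      simp only [Finset.coe_filter, Finset.mem_univ, true_and, Set.mem_ofPred_eq,
        Finset.mem_filter] at hσ h₀ ⊢
      intro a ha
      rw [Equiv.Perm.mul_apply, hσ a (not_not.1 ha), ← h₀ a (not_not.1 ha)]
      simp
  set n := Fintype.card X
  set k := s.card
  have hkn : k ≤ n := Finset.card_le_univ s
  have h2 : n ^ k ≤ k ^ k * n.descFactorial k := by
    rcases Nat.eq_zero_or_pos k with hk | hk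
    · simp [hk]
    · have h3 : n ≤ k * (n + 1 - k) := by
        obtain ⟨m, hm⟩ := Nat.exists_eq_add_of_le hkn
        rw [hm, show k + m + 1 - k = m + 1 by omega]
        nlinarith
      calc n ^ k ≤ (k * (n + 1 - k)) ^ k := Nat.pow_le_pow_left h3 k
        _ = k ^ k * (n + 1 - k) ^ k := mul_pow _ _ _
        _ ≤ k ^ k * n.descFactorial k :=
          Nat.mul_le_mul_left _ (Nat.pow_sub_le_descFactorial n k)
  calc _ ≤ (n - k).factorial * (k ^ k * n.descFactorial k) := Nat.mul_le_mul h1 h2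
    _ = k ^ k * n.factorial := by rw [← Nat.factorial_mul_descFactorial hkn]; ring

theorem pow_self_le_pow_self {k m : ℕ} (h : k ≤ m) : k ^ k ≤ m ^ m := by
  rcases Nat.eq_zero_or_pos m with rfl | hm
  · rw [Nat.le_zero.1 h]
  · exact (Nat.pow_le_pow_left h k).trans (Nat.pow_le_pow_right hm h)

end Counting

/-! ### Coincidences of entries of the permuted matrices -/

section Entries

variable {N : ℕ}

/-- An indeterminate `(k, b)`, standing for one of the matrices `G, G^σ, G^τ` (`b = false`) or its
adjoint (`b = true`), together with the position of an entry. -/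
abbrev Entry (N : ℕ) := (Fin 3 × Bool) × (Fin N × Fin N)

/-- The position in `G` of the entry `v`, when the three matrices are `G ^ ρ k`. For an adjoint, the
`(i, j)` entry is the conjugate of the entry of `G` at `ρ k (j, i)`, which is the entry of `G` at the
transposed position, since `G` is Hermitian. -/
def entryPos (ρ : Fin 3 → Equiv.Perm (Fin N × Fin N)) (v : Entry N) : Fin N × Fin N :=
  if v.1.2 then (ρ v.1.1 v.2.swap).swap else ρ v.1.1 v.2

/-- Two entries are matched if they are the conjugate of one another whatever the permutations. -/
def Matched (v v' : Entry N) : Prop :=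
  v.1.1 = v'.1.1 ∧ (v.1.1 = 0 ∨ v.1.2 ≠ v'.1.2) ∧ v'.2 = v.2.swap

instance (v v' : Entry N) : Decidable (Matched v v') := by
  unfold Matched; infer_instance

theorem Matched.symm {v v' : Entry N} (h : Matched v v') : Matched v' v :=
  ⟨h.1.symm, h.2.1.imp (fun h0 => h.1.symm.trans h0) Ne.symm, by rw [h.2.2, Prod.swap_swap]⟩

/-- The argument at which the permutation is evaluated to get the position of `v`, with the label
of the permutation. -/
def node (v : Entry N) : Fin 3 × (Fin N × Fin N) :=
  (v.1.1, if v.1.2 then v.2.swap else v.2)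

theorem entryPos_eq (ρ : Fin 3 → Equiv.Perm (Fin N × Fin N)) (v : Entry N) :
    entryPos ρ v = if v.1.2 then (ρ (node v).1 (node v).2).swap else ρ (node v).1 (node v).2 := by
  simp only [entryPos, node]
  split_ifs <;> rfl

theorem entryPos_of_eq_zero {ρ : Fin 3 → Equiv.Perm (Fin N × Fin N)} (hρ : ρ 0 = 1) {v : Entry N}
    (hv : v.1.1 = 0) : entryPos ρ v = v.2 := by
  simp only [entryPos, hv, hρ]
  split_ifs <;> simp

theorem Matched.entryPos_eq_swap {ρ : Fin 3 → Equiv.Perm (Fin N × Fin N)} (hρ : ρ 0 = 1)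
    {v v' : Entry N} (h : Matched v v') : entryPos ρ v' = (entryPos ρ v).swap := by
  obtain ⟨h1, h2, h3⟩ := h
  rcases h2 with h2 | h2
  · rw [entryPos_of_eq_zero hρ h2, entryPos_of_eq_zero hρ (h1 ▸ h2), h3]
  · simp only [entryPos, h1, h3, Prod.swap_swap]
    cases hb : v.1.2 <;> cases hb' : v'.1.2 <;> simp_all

variable {S : Type*} [Fintype S]

/-- The sides `s` that are not matched with their partner `π s`. -/
def unmatched (v : S → Entry N) (π : S → S) : Finset S :=
  Finset.univ.filter fun s => ¬ Matched (v s) (v (π s))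

theorem mem_unmatched {v : S → Entry N} {π : S → S} {s : S} :
    s ∈ unmatched v π ↔ ¬ Matched (v s) (v (π s)) := by
  simp [unmatched]

/-- The label of a side. It is the node of the side if this is an entry of `G^σ`, `G^τ` or their
adjoints, and the node of the partner, tagged by `true`, if it is an entry of `G`. -/
def sideLabel (v : S → Entry N) (π : S → S) (s : S) : Bool × (Fin 3 × (Fin N × Fin N)) :=
  if (v s).1.1 = 0 then (true, node (v (π s))) else (false, node (v s))

/-- The number of pairs of permutations for which all the entries `v s` and `v (π s)` are conjugate
to one another is at most a fraction `O(N ^ (-ℓ))` of the total, where `ℓ` is the number of labels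
of the unmatched sides. -/
theorem card_perm_conjugate_mul_le [DecidableEq S] (hN : 1 ≤ N) (v : S → Entry N) (π : S → S)
    (hπ : ∀ s, π (π s) = s) :
    (Finset.univ.filter fun ρ : Equiv.Perm (Fin N × Fin N) × Equiv.Perm (Fin N × Fin N) =>
      ∀ s, entryPos ![1, ρ.1, ρ.2] (v (π s)) = (entryPos ![1, ρ.1, ρ.2] (v s)).swap).card *
        N ^ ((unmatched v π).image (sideLabel v π)).card ≤
      (Fintype.card S ^ Fintype.card S * (N * N).factorial) ^ 2 := by
  classical
  set good := Finset.univ.filter fun ρ : Equiv.Perm (Fin N × Fin N) × Equiv.Perm (Fin N × Fin N) =>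
    ∀ s, entryPos ![1, ρ.1, ρ.2] (v (π s)) = (entryPos ![1, ρ.1, ρ.2] (v s)).swap with hgood
  rcases good.eq_empty_or_nonempty with h0 | ⟨ρ₀, hρ₀⟩
  · rw [h0]; simp
  have hmem : ∀ ρ ∈ good, ∀ s,
      entryPos ![1, ρ.1, ρ.2] (v (π s)) = (entryPos ![1, ρ.1, ρ.2] (v s)).swap := fun ρ hρ =>
    (Finset.mem_filter.1 hρ).2
  set NL := unmatched v π with hNL
  have hNLπ : ∀ s ∈ NL, π s ∈ NL := by
    intro s hs
    rw [mem_unmatched] at hs ⊢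
    rw [hπ]
    exact fun h => hs h.symm
  have hzero : ∀ s ∈ NL, (v s).1.1 = 0 → (v (π s)).1.1 ≠ 0 := by
    intro s hs h1 h2
    have h3 := hmem ρ₀ hρ₀ s
    rw [entryPos_of_eq_zero rfl h1, entryPos_of_eq_zero rfl h2] at h3
    exact mem_unmatched.1 hs ⟨h1.trans h2.symm, Or.inl h1, h3⟩
  set U := (NL.filter fun s => (v s).1.1 ≠ 0).image fun s => node (v s) with hU
  set Uk := (NL.filter fun s => (v s).1.1 = 0).image fun s => node (v (π s)) with hUk
  have hUkU : Uk ⊆ U := by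
    intro u hu
    obtain ⟨s, hs, rfl⟩ := Finset.mem_image.1 hu
    rw [Finset.mem_filter] at hs
    exact Finset.mem_image.2 ⟨π s, Finset.mem_filter.2 ⟨hNLπ s hs.1, hzero s hs.1 hs.2⟩, rfl⟩
  have hΛ : (NL.image (sideLabel v π)).card ≤ U.card + Uk.card := by
    have : NL.image (sideLabel v π) ⊆ U.image (fun u => (false, u)) ∪ Uk.image fun u => (true, u) := by
      intro l hl
      obtain ⟨s, hs, rfl⟩ := Finset.mem_image.1 hl
      by_cases h : (v s).1.1 = 0
      · refine Finset.mem_union_right _ (Finset.mem_image.2 ⟨node (v (π s)),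
          Finset.mem_image.2 ⟨s, Finset.mem_filter.2 ⟨hs, h⟩, rfl⟩, ?_⟩)
        simp [sideLabel, h]
      · refine Finset.mem_union_left _ (Finset.mem_image.2 ⟨node (v s),
          Finset.mem_image.2 ⟨s, Finset.mem_filter.2 ⟨hs, h⟩, rfl⟩, ?_⟩)
        simp [sideLabel, h]
    exact (Finset.card_le_card this).trans ((Finset.card_union_le _ _).trans
      (add_le_add Finset.card_image_le Finset.card_image_le))
  -- The values of the permutations at the nodes, cut into their two coordinates.
  let val : Equiv.Perm (Fin N × Fin N) × Equiv.Perm (Fin N × Fin N) → U × Bool → Fin N :=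
    fun ρ z => if z.2 then (![1, ρ.1, ρ.2] z.1.1.1 z.1.1.2).2 else (![1, ρ.1, ρ.2] z.1.1.1 z.1.1.2).1
  have hval : ∀ ρ ρ' u (hu : u ∈ U), (∀ b, val ρ (⟨u, hu⟩, b) = val ρ' (⟨u, hu⟩, b)) →
      ![1, ρ.1, ρ.2] u.1 u.2 = ![1, ρ'.1, ρ'.2] u.1 u.2 := by
    intro ρ ρ' u hu h
    exact Prod.ext (h false) (h true)
  have hrep : ∀ u : U, ∃ s ∈ NL, (v s).1.1 ≠ 0 ∧ node (v s) = u.1 := by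
    intro u
    obtain ⟨s, hs, h⟩ := Finset.mem_image.1 u.2
    exact ⟨s, (Finset.mem_filter.1 hs).1, (Finset.mem_filter.1 hs).2, h⟩
  choose rep hrep1 hrep2 hrep3 using hrep
  have hfree : ∀ u : U, u.1 ∉ Uk → (v (π (rep u))).1.1 ≠ 0 := by
    intro u hu h
    refine hu (Finset.mem_image.2 ⟨π (rep u), Finset.mem_filter.2 ⟨hNLπ _ (hrep1 u), h⟩, ?_⟩)
    simp only [hπ, hrep3]
  let f : U × Bool → U × Bool := fun z => if hz : z.1.1 ∈ Uk then z else
    (⟨node (v (π (rep z.1))), Finset.mem_image.2 ⟨π (rep z.1), Finset.mem_filter.2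
      ⟨hNLπ _ (hrep1 z.1), hfree z.1 hz⟩, rfl⟩⟩,
      if (v (rep z.1)).1.2 = (v (π (rep z.1))).1.2 then !z.2 else z.2)
  obtain ⟨q, hq1, hq2⟩ := exists_card_tied_functions_le (fun z : U × Bool => z.1.1 ∈ Uk) (val ρ₀) f
    (by
      intro z hz h
      simp only [f, hz, dif_neg, not_false_eq_true] at h
      have h1 : node (v (π (rep z.1))) = node (v (rep z.1)) := by
        rw [hrep3]; exact congrArg (fun z => z.1.1) h
      have h2 := congrArg Prod.snd h
      simp only at h2
      split_ifs at h2 with hb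
      · simp at h2
      · refine mem_unmatched.1 (hrep1 z.1) ⟨(congrArg Prod.fst h1).symm, Or.inr hb, ?_⟩
        have h3 := congrArg Prod.snd h1
        simp only [node] at h3
        cases hb1 : (v (rep z.1)).1.2 <;> cases hb2 : (v (π (rep z.1))).1.2 <;>
          simp only [hb1, hb2, not_true_eq_false, if_true, Bool.false_eq_true, if_false] at hb h3
        · rw [← h3, Prod.swap_swap]
        · exact h3)
    (good.image val)
    (by
      intro y hy z hz
      obtain ⟨ρ, hρ, rfl⟩ := Finset.mem_image.1 hy
      obtain ⟨s, hs, hsz⟩ := Finset.mem_image.1 hz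
      have hs := Finset.mem_filter.1 hs
      have e1 := hmem ρ hρ s
      have e2 := hmem ρ₀ hρ₀ s
      rw [entryPos_of_eq_zero rfl hs.2, entryPos_eq] at e1 e2
      have e3 : ![1, ρ.1, ρ.2] z.1.1.1 z.1.1.2 = ![1, ρ₀.1, ρ₀.2] z.1.1.1 z.1.1.2 := by
        rw [← hsz]
        cases hb : (v (π s)).1.2
        · simp only [hb, Bool.false_eq_true, if_false] at e1 e2
          rw [e1, e2]
        · simp only [hb, if_true] at e1 e2
          exact Prod.swap_injective (e1.trans e2.symm)
      simp only [val, e3])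
    (by
      intro y hy z hz
      obtain ⟨ρ, hρ, rfl⟩ := Finset.mem_image.1 hy
      have e1 := hmem ρ hρ (rep z.1)
      rw [entryPos_eq, entryPos_eq, hrep3] at e1
      simp only [val, f, hz, dif_neg, not_false_eq_true]
      cases hb1 : (v (rep z.1)).1.2 <;> cases hb2 : (v (π (rep z.1))).1.2 <;>
        simp only [hb1, hb2, if_true, Bool.false_eq_true, if_false] at e1 <;>
        cases hz2 : z.2 <;> simp [hb1, hb2, hz2, Prod.ext_iff] at e1 ⊢ <;> simp [e1])
  -- The permutations with given values at the nodes.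
  have hfib : ∀ y ∈ good.image val, (good.filter fun ρ => val ρ = y).card * (N * N) ^ U.card ≤
      (Fintype.card S ^ Fintype.card S * (N * N).factorial) ^ 2 := by
    intro y hy
    obtain ⟨ρ₁, hρ₁, rfl⟩ := Finset.mem_image.1 hy
    let Uj : Fin 3 → Finset (Fin N × Fin N) := fun j => (U.filter fun u => u.1 = j).image Prod.snd
    have hUj : ∀ j x, x ∈ Uj j ↔ (j, x) ∈ U := by
      intro j x
      simp only [Uj, Finset.mem_image, Finset.mem_filter]
      constructor
      · rintro ⟨u, ⟨h1, rfl⟩, rfl⟩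
        exact h1
      · exact fun h => ⟨(j, x), ⟨h, rfl⟩, rfl⟩
    have hUcard : U.card ≤ (Uj 1).card + (Uj 2).card := by
      have : U ⊆ (Uj 1).image (fun x => (1, x)) ∪ (Uj 2).image fun x => (2, x) := by
        rintro ⟨j, x⟩ hu
        have hj : j ≠ 0 := by
          obtain ⟨s, hs, h⟩ := Finset.mem_image.1 hu
          have := congrArg Prod.fst h
          simp only [node] at this
          rw [← this]
          exact (Finset.mem_filter.1 hs).2
        have hj' : j = 1 ∨ j = 2 := by omega
        rcases hj' with rfl | rfl
        · exact Finset.mem_union_left _ (Finset.mem_image.2 ⟨x, (hUj _ _).2 hu, rfl⟩)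
        · exact Finset.mem_union_right _ (Finset.mem_image.2 ⟨x, (hUj _ _).2 hu, rfl⟩)
      exact (Finset.card_le_card this).trans ((Finset.card_union_le _ _).trans
        (add_le_add Finset.card_image_le Finset.card_image_le))
    have hUjS : ∀ j, (Uj j).card ≤ Fintype.card S := fun j =>
      Finset.card_image_le.trans ((Finset.card_filter_le _ _).trans (Finset.card_image_le.trans
        (Finset.card_le_univ _)))
    have hX : Fintype.card (Fin N × Fin N) = N * N := by simp
    have hF : ∀ j, ∀ g : Fin N × Fin N → Fin N × Fin N,
        (Finset.univ.filter fun σ : Equiv.Perm (Fin N × Fin N) => ∀ x ∈ Uj j, σ x = g x).card *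
          (N * N) ^ (Uj j).card ≤ Fintype.card S ^ Fintype.card S * (N * N).factorial := by
      intro j g
      have := card_perm_prescribed_mul_le (Uj j) g
      rw [hX] at this
      exact this.trans (Nat.mul_le_mul_right _ (pow_self_le_pow_self (hUjS j)))
    have hsub : (good.filter fun ρ => val ρ = val ρ₁) ⊆
        (Finset.univ.filter fun σ : Equiv.Perm (Fin N × Fin N) => ∀ x ∈ Uj 1, σ x = ρ₁.1 x) ×ˢ
        (Finset.univ.filter fun σ : Equiv.Perm (Fin N × Fin N) => ∀ x ∈ Uj 2, σ x = ρ₁.2 x) := by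
      intro ρ hρ
      have h := (Finset.mem_filter.1 hρ).2
      simp only [Finset.mem_product, Finset.mem_filter, Finset.mem_univ, true_and]
      exact ⟨fun x hx => hval ρ ρ₁ (1, x) ((hUj _ _).1 hx) fun b => congrFun h _,
        fun x hx => hval ρ ρ₁ (2, x) ((hUj _ _).1 hx) fun b => congrFun h _⟩
    have hcard := Finset.card_le_card hsub
    rw [Finset.card_product] at hcard
    calc _ ≤ _ := Nat.mul_le_mul hcard (Nat.pow_le_pow_right (Nat.mul_pos hN hN) hUcard)
      _ = _ := by rw [pow_add, mul_mul_mul_comm]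
      _ ≤ _ := Nat.mul_le_mul (hF 1 _) (hF 2 _)
      _ = _ := (sq _).symm
  have hcardfree : Nat.card {z : U × Bool // ¬ z.1.1 ∈ Uk} = 2 * (U.card - Uk.card) := by
    have h1 : Nat.card {z : U × Bool // ¬ z.1.1 ∈ Uk} =
        Nat.card ({u : U // ¬ u.1 ∈ Uk} × Bool) :=
      Nat.card_congr
        { toFun := fun z => (⟨z.1.1, z.2⟩, z.1.2)
          invFun := fun z => ⟨(z.1.1, z.2), z.1.2⟩
          left_inv := fun _ => rfl
          right_inv := fun _ => rfl }
    have h2 : Fintype.card {u : U // ¬ u.1 ∈ Uk} = U.card - Uk.card := by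
      rw [Fintype.card_subtype, ← Finset.card_sdiff_of_subset hUkU, ← Finset.card_map
        (Function.Embedding.subtype _)]
      congr 1
      ext u
      simp [and_comm]
    rw [h1, Nat.card_prod, Nat.card_eq_fintype_card, h2]
    simp [mul_comm]
  rw [hcardfree] at hq1
  rw [Fintype.card_fin] at hq2
  have hle := Finset.card_le_card hUkU
  obtain ⟨F, hF1, hF2⟩ : ∃ F, F * (N * N) ^ U.card ≤
      (Fintype.card S ^ Fintype.card S * (N * N).factorial) ^ 2 ∧
      good.card ≤ F * (good.image val).card := by
    let F := (good.image val).sup fun y => (good.filter fun ρ => val ρ = y).card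
    refine ⟨F, ?_, Finset.card_le_mul_card_image _ _ fun y hy =>
      Finset.le_sup (f := fun y => (good.filter fun ρ => val ρ = y).card) hy⟩
    obtain ⟨y, hy, hyF⟩ := Finset.exists_mem_eq_sup (good.image val)
      (Finset.image_nonempty.2 ⟨ρ₀, hρ₀⟩) fun y => (good.filter fun ρ => val ρ = y).card
    simp only [F]
    rw [hyF]
    exact hfib y hy
  calc good.card * N ^ (NL.image (sideLabel v π)).card
      ≤ (F * N ^ (U.card - Uk.card)) * N ^ (U.card + Uk.card) := by
        refine Nat.mul_le_mul (hF2.trans (Nat.mul_le_mul_left _ (hq2.trans ?_)))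
          (Nat.pow_le_pow_right hN hΛ)
        exact Nat.pow_le_pow_right hN (by omega)
    _ = F * (N * N) ^ U.card := by
        rw [mul_assoc, ← pow_add, ← sq, ← pow_mul]
        congr 2
        omega
    _ ≤ _ := hF1

end Entries

/-! ### Counting the vertices of closed walks with paired sides -/

section Walks

/-- If a function supported on `A` is zero as soon as it is annihilated by a family of linear
forms, then `A` has at most as many elements as the family. -/
theorem card_le_card_of_linear_forms {α T : Type*} [Fintype T] (A : Finset α)
    (φ : T → (α → ℚ) →ₗ[ℚ] ℚ)
    (h : ∀ f : α → ℚ, (∀ x, x ∉ A → f x = 0) → (∀ t, φ t f = 0) → ∀ x ∈ A, f x = 0) :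
    A.card ≤ Fintype.card T := by
  classical
  let ext : (A → ℚ) →ₗ[ℚ] (α → ℚ) :=
    { toFun := fun f x => if hx : x ∈ A then f ⟨x, hx⟩ else 0
      map_add' := fun f g => by
        ext x
        by_cases hx : x ∈ A <;> simp [hx]
      map_smul' := fun c f => by
        ext x
        by_cases hx : x ∈ A <;> simp [hx] }
  let Φ : (A → ℚ) →ₗ[ℚ] (T → ℚ) := LinearMap.pi fun t => φ t ∘ₗ ext
  have hΦ : Function.Injective Φ := by
    rw [injective_iff_map_eq_zero]
    intro f hf
    ext x
    have := h (ext f) (fun x hx => by simp [ext, hx]) (fun t => congrFun hf t) x.1 x.2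
    simpa [ext] using this
  have := LinearMap.finrank_le_finrank_of_injective hΦ
  simpa using this

/-- A fixed-point free involution cuts an invariant set into two halves. -/
theorem two_mul_card_filter_lt {n : ℕ} {π : Fin n → Fin n} (hπ : ∀ s, π (π s) = s)
    (hπ' : ∀ s, π s ≠ s) (F : Finset (Fin n)) (hF : ∀ s ∈ F, π s ∈ F) :
    2 * (F.filter fun s => s < π s).card = F.card := by
  have h1 : (F.filter fun s => s < π s).card = (F.filter fun s => ¬ s < π s).card := by
    refine Finset.card_bij (fun s _ => π s) ?_ ?_ ?_
    · intro s hs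
      rw [Finset.mem_filter] at hs ⊢
      exact ⟨hF s hs.1, by rw [hπ]; exact not_lt.2 hs.2.le⟩
    · intro s _ s' _ h
      rw [← hπ s, h, hπ]
    · intro s hs
      rw [Finset.mem_filter] at hs
      refine ⟨π s, Finset.mem_filter.2 ⟨hF s hs.1, ?_⟩, hπ s⟩
      rw [hπ]
      exact lt_of_le_of_ne (not_lt.1 hs.2) (hπ' s)
  rw [two_mul, ← Finset.card_filter_add_card_filter_not (s := F) (fun s => s < π s), ← h1]

/-- The main combinatorial estimate. The sides of a closed walk are paired by `π`; some pairs are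
glued together in opposite directions (`s ∉ NL`) and at least one is not. The other sides carry
labels which determine them up to orientation. Then the number of vertices outside a given set `K`
is at most `n / 2 - 1` plus the number of labels that are not known to be supported in `K`.

The proof counts the linear conditions which force a function of the vertices, vanishing on `K`, to
be constant along the walk. When no vertex lies in `K`, one more condition normalizes the constant;
it is compensated either by a second pair in `NL`, or, when there is only one, by the redundancy of
one of its conditions, because the increments along a closed walk add up to zero. -/
theorem two_mul_card_vertices_le {N n : ℕ} {Λ : Type*} [DecidableEq Λ] {π : Fin n → Fin n}
    (hπ : ∀ s, π (π s) = s) (hπ' : ∀ s, π s ≠ s) (i : Fin (n + 1) → Fin N)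
    (hi : i 0 = i (Fin.last n)) (p : Fin n → Fin N × Fin N)
    (hp : ∀ s, p s = (i s.castSucc, i s.succ)) (NL : Finset (Fin n)) (hNL : ∀ s ∈ NL, π s ∈ NL)
    (hglue : ∀ s, s ∉ NL → p (π s) = (p s).swap) (hne : NL.Nonempty) (lab : Fin n → Λ)
    (hlab : ∀ s ∈ NL, ∀ s' ∈ NL, lab s = lab s' → p s' = p s ∨ p s' = (p s).swap)
    (hlabπ : ∀ s ∈ NL, lab s = lab (π s) → p (π s) = p s) (K : Finset (Fin N)) (W : Finset Λ)
    (hW : ∀ s ∈ NL, lab s ∈ W → (p s).1 ∈ K ∧ (p s).2 ∈ K) :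
    2 * (Finset.univ.image i \ K).card + 2 ≤ 2 * (NL.image lab \ W).card + n := by
  classical
  set A := Finset.univ.image i \ K with hA
  set R := NLᶜ.filter fun s => s < π s with hR
  have hNLc : ∀ s ∈ NLᶜ, π s ∈ NLᶜ := by
    intro s hs
    rw [Finset.mem_compl] at hs ⊢
    exact fun h => hs (by rw [← hπ s]; exact hNL _ h)
  have hRcard : 2 * R.card + NL.card = n := by
    rw [hR, two_mul_card_filter_lt hπ hπ' _ hNLc, Finset.card_compl, Fintype.card_fin]
    have := Finset.card_le_univ NL
    rw [Fintype.card_fin] at this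
    omega
  have hNLcard := two_mul_card_filter_lt hπ hπ' NL hNL
  have hNLpos := hne.card_pos
  let pr : Fin N → (Fin N → ℚ) →ₗ[ℚ] ℚ := fun a => LinearMap.proj a
  let d : Fin n → (Fin N → ℚ) →ₗ[ℚ] ℚ := fun s =>
    pr (p s).2 - pr (p s).1
  have hd : ∀ s f, d s f = f (p s).2 - f (p s).1 := fun s f => rfl
  have hswap : ∀ s s' f, p s' = p s ∨ p s' = (p s).swap → d s f = 0 → d s' f = 0 := by
    intro s s' f h h0
    rw [hd] at h0 ⊢
    rcases h with h | h <;> rw [h]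
    · exact h0
    · simp only [Prod.fst_swap, Prod.snd_swap]; linarith
  have hglue0 : ∀ f, (∀ s ∈ R, d s f = 0) → ∀ s, s ∉ NL → d s f = 0 := by
    intro f hf s hs
    rcases lt_or_gt_of_ne (hπ' s) with h | h
    · refine hswap (π s) s f (Or.inr ?_) (hf _ ?_)
      · rw [hglue s hs, Prod.swap_swap]
      · rw [hR, Finset.mem_filter, hπ]
        exact ⟨hNLc s (Finset.mem_compl.2 hs), h⟩
    · exact hf s (Finset.mem_filter.2 ⟨Finset.mem_compl.2 hs, h⟩)
  have hconst : ∀ f, (∀ s, d s f = 0) → ∀ j, f (i j) = f (i 0) := by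
    intro f hf j
    induction j using Fin.induction with
    | zero => rfl
    | succ s ih =>
      have := hf s
      rw [hd, hp] at this
      rw [← ih]
      linarith
  -- One side for each label.
  have hside : ∀ l : ↥(NL.image lab), ∃ s ∈ NL, lab s = l.1 := fun l => Finset.mem_image.1 l.2
  choose side hside1 hside2 using hside
  have hlabel0 : ∀ f s (hs : s ∈ NL), d (side ⟨lab s, Finset.mem_image_of_mem lab hs⟩) f = 0 →
      d s f = 0 := fun f s hs h =>
    hswap _ s f (hlab _ (hside1 _) s hs (hside2 ⟨lab s, Finset.mem_image_of_mem lab hs⟩)) h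
  by_cases hK : ∃ j, i j ∈ K
  · obtain ⟨j₀, hj₀⟩ := hK
    have key := card_le_card_of_linear_forms (T := R ⊕ ↥(NL.image lab \ W)) A
      (Sum.elim (fun s => d s.1)
        fun l => d (side ⟨l.1, (Finset.mem_sdiff.1 l.2).1⟩)) (by
      intro f hf0 hf x hx
      have hK0 : ∀ x ∈ K, f x = 0 := fun x hx => hf0 x (by simp [hA, hx])
      have hall : ∀ s, d s f = 0 := by
        intro s
        by_cases hs : s ∈ NL
        · by_cases hsW : lab s ∈ W
          · obtain ⟨h1, h2⟩ := hW s hs hsW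
            rw [hd, hK0 _ h1, hK0 _ h2, sub_zero]
          · exact hlabel0 f s hs (hf (Sum.inr ⟨lab s, Finset.mem_sdiff.2
              ⟨Finset.mem_image_of_mem lab hs, hsW⟩⟩))
        · exact hglue0 f (fun s hs => hf (Sum.inl ⟨s, hs⟩)) s hs
      obtain ⟨j, _, rfl⟩ := Finset.mem_image.1 (Finset.mem_sdiff.1 hx).1
      rw [hconst f hall j, ← hconst f hall j₀, hK0 _ hj₀])
    simp only [Fintype.card_sum, Fintype.card_coe] at key
    omega
  · push Not at hK
    have hsW : ∀ s ∈ NL, lab s ∉ W := by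
      intro s hs h
      have := (hW s hs h).1
      rw [hp] at this
      exact hK _ this
    have hsdiff : NL.image lab \ W = NL.image lab := by
      rw [Finset.sdiff_eq_self_iff_disjoint, Finset.disjoint_left]
      intro l hl
      obtain ⟨s, hs, rfl⟩ := Finset.mem_image.1 hl
      exact hsW s hs
    rw [hsdiff]
    by_cases h4 : 4 ≤ NL.card
    · have key := card_le_card_of_linear_forms (T := Unit ⊕ (R ⊕ ↥(NL.image lab))) A
        (Sum.elim (fun _ => pr (i 0)) (Sum.elim (fun s => d s.1) fun l => d (side l))) (by
        intro f hf0 hf x hx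
        have hall : ∀ s, d s f = 0 := by
          intro s
          by_cases hs : s ∈ NL
          · exact hlabel0 f s hs (hf (Sum.inr (Sum.inr _)))
          · exact hglue0 f (fun s hs => hf (Sum.inr (Sum.inl ⟨s, hs⟩))) s hs
        obtain ⟨j, _, rfl⟩ := Finset.mem_image.1 (Finset.mem_sdiff.1 hx).1
        rw [hconst f hall j]
        exact hf (Sum.inl ()))
      simp only [Fintype.card_sum, Fintype.card_coe, Fintype.card_unit] at key
      omega
    · have h2 : NL.card = 2 := by omega
      obtain ⟨s₀, hs₀⟩ := hne
      have hNLeq : NL = {s₀, π s₀} := by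
        symm
        refine Finset.eq_of_subset_of_card_le ?_ ?_
        · intro s hs
          rcases Finset.mem_insert.1 hs with rfl | hs
          · exact hs₀
          · rw [Finset.mem_singleton.1 hs]; exact hNL _ hs₀
        · rw [h2, Finset.card_pair (hπ' s₀).symm]
      have key := card_le_card_of_linear_forms
        (T := Unit ⊕ (R ⊕ ↥((NL.image lab).erase (lab s₀)))) A
        (Sum.elim (fun _ => pr (i 0)) (Sum.elim (fun s => d s.1)
          fun l => d (side ⟨l.1, Finset.mem_of_mem_erase l.2⟩))) (by
        intro f hf0 hf x hx
        have hoff : ∀ s, s ∉ NL → d s f = 0 :=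
          hglue0 f fun s hs => hf (Sum.inr (Sum.inl ⟨s, hs⟩))
        have hsum : d s₀ f + d (π s₀) f = 0 := by
          have h1 : ∑ s, d s f = 0 := by
            have h3 := Fin.sum_univ_castSucc fun j => f (i j)
            rw [Fin.sum_univ_succ] at h3
            simp only [hd, hp, Finset.sum_sub_distrib]
            rw [hi] at h3
            linarith
          rw [← Finset.sum_subset (Finset.subset_univ NL) fun s _ hs => hoff s hs, hNLeq,
            Finset.sum_pair (hπ' s₀).symm] at h1
          exact h1
        have hs₀0 : d s₀ f = 0 := by
          by_cases hl : lab s₀ = lab (π s₀)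
          · have h3 := hlabπ s₀ hs₀ hl
            have h5 : d (π s₀) f = d s₀ f := by rw [hd, hd, h3]
            rw [h5] at hsum
            linarith
          · have h3 := hlabel0 f (π s₀) (hNL _ hs₀) (hf (Sum.inr (Sum.inr ⟨lab (π s₀),
              Finset.mem_erase.2 ⟨fun h => hl h.symm,
                Finset.mem_image_of_mem lab (hNL _ hs₀)⟩⟩)))
            rw [h3, add_zero] at hsum
            exact hsum
        have hall : ∀ s, d s f = 0 := by
          intro s
          by_cases hs : s ∈ NL
          · rw [hNLeq] at hs
            rcases Finset.mem_insert.1 hs with rfl | hs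
            · exact hs₀0
            · rw [Finset.mem_singleton.1 hs]
              rw [hs₀0, zero_add] at hsum
              exact hsum
          · exact hoff s hs
        obtain ⟨j, _, rfl⟩ := Finset.mem_image.1 (Finset.mem_sdiff.1 hx).1
        rw [hconst f hall j]
        exact hf (Sum.inl ()))
      simp only [Fintype.card_sum, Fintype.card_coe, Fintype.card_unit,
        Finset.card_erase_of_mem (Finset.mem_image_of_mem lab hs₀)] at key
      have hpos : 0 < (NL.image lab).card :=
        Finset.card_pos.2 ⟨_, Finset.mem_image_of_mem lab hs₀⟩
      omega

variable {N n : ℕ}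

/-- The sides of a walk on the letters of a word, as entries of the corresponding matrices. -/
def walkEntry (w : Fin n → Fin 3 × Bool) (i : Fin (n + 1) → Fin N) (s : Fin n) : Entry N :=
  (w s, (i s.castSucc, i s.succ))

theorem eq_or_eq_swap_of_sideLabel_eq {S : Type*} [Fintype S] {v : S → Entry N} {π : S → S}
    {ρ : Fin 3 → Equiv.Perm (Fin N × Fin N)} (hρ0 : ρ 0 = 1)
    (hρ : ∀ s, entryPos ρ (v (π s)) = (entryPos ρ (v s)).swap) {s s' : S}
    (h : sideLabel v π s = sideLabel v π s') : (v s').2 = (v s).2 ∨ (v s').2 = (v s).2.swap := by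
  have e1 := hρ s
  have e2 := hρ s'
  have aux : ∀ (b b' : Bool) (x y z : Fin N × Fin N), (if b then x.swap else x) = y →
      (if b' then x.swap else x) = z → z = y ∨ z = y.swap := by
    rintro b b' x y z rfl rfl
    cases b <;> cases b' <;> simp
  simp only [sideLabel] at h
  split_ifs at h with h1 h2 h2
  · have h3 : node (v (π s)) = node (v (π s')) := (Prod.mk.inj h).2
    rw [entryPos_of_eq_zero hρ0 h1, entryPos_eq] at e1
    rw [entryPos_of_eq_zero hρ0 h2, entryPos_eq, ← h3] at e2
    rcases aux _ _ _ _ _ e1 e2 with h4 | h4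
    · exact Or.inl (Prod.swap_injective h4)
    · exact Or.inr (Prod.swap_injective h4)
  · simp at h
  · simp at h
  · have h3 : node (v s) = node (v s') := (Prod.mk.inj h).2
    have h4 := congrArg Prod.snd h3
    simp only [node] at h4
    refine aux (v s).1.2 (v s').1.2 (node (v s)).2 _ _ ?_ ?_
    · simp only [node]
      split_ifs <;> simp
    · rw [h3]
      simp only [node]
      split_ifs <;> simp

theorem eq_of_sideLabel_eq_partner {S : Type*} [Fintype S] {v : S → Entry N} {π : S → S}
    {ρ : Fin 3 → Equiv.Perm (Fin N × Fin N)} (hρ0 : ρ 0 = 1)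
    (hρ : ∀ s, entryPos ρ (v (π s)) = (entryPos ρ (v s)).swap) {s : S} (hs : s ∈ unmatched v π)
    (h : sideLabel v π s = sideLabel v π (π s)) : (v (π s)).2 = (v s).2 := by
  rw [mem_unmatched] at hs
  simp only [sideLabel] at h
  split_ifs at h with h1 h2 h2
  · have e1 := hρ s
    rw [entryPos_of_eq_zero hρ0 h1, entryPos_of_eq_zero hρ0 h2] at e1
    exact absurd ⟨h1.trans h2.symm, Or.inl h1, e1⟩ hs
  · simp at h
  · simp at h
  · have h3 : node (v s) = node (v (π s)) := (Prod.mk.inj h).2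
    have h4 := congrArg Prod.snd h3
    by_cases hb : (v s).1.2 = (v (π s)).1.2
    · simp only [node, hb] at h4
      split_ifs at h4
      · exact Prod.swap_injective h4.symm
      · exact h4.symm
    · refine absurd ⟨(Prod.mk.inj h3).1, Or.inr hb, ?_⟩ hs
      simp only [node] at h4
      cases hb1 : (v s).1.2 <;> cases hb2 : (v (π s)).1.2 <;> simp_all

/-- Two closed walks, each with an unmatched side, and both compatible with some permutations, have
together at most `n - 2 + ℓ` vertices, where `ℓ` is the number of labels of the unmatched sides. -/
theorem card_vertices_pair_le {π : Fin n → Fin n} (hπ : ∀ s, π (π s) = s) (hπ' : ∀ s, π s ≠ s)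
    (w : Fin n → Fin 3 × Bool) (i : Bool → Fin (n + 1) → Fin N)
    (hi : ∀ b, i b 0 = i b (Fin.last n))
    (hun : ∀ b, ∃ s, ¬ Matched (walkEntry w (i b) s) (walkEntry w (i b) (π s)))
    {ρ : Fin 3 → Equiv.Perm (Fin N × Fin N)} (hρ0 : ρ 0 = 1)
    (hρ : ∀ b s, entryPos ρ (walkEntry w (i b) (π s)) = (entryPos ρ (walkEntry w (i b) s)).swap) :
    (Finset.univ.image fun x : Bool × Fin (n + 1) => i x.1 x.2).card + 2 ≤
      ((unmatched (fun x : Bool × Fin n => walkEntry w (i x.1) x.2) fun x => (x.1, π x.2)).image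
        (sideLabel (fun x : Bool × Fin n => walkEntry w (i x.1) x.2) fun x => (x.1, π x.2))).card
          + n := by
  set v : Bool × Fin n → Entry N := fun x => walkEntry w (i x.1) x.2 with hv
  set π₂ : Bool × Fin n → Bool × Fin n := fun x => (x.1, π x.2) with hπ₂
  have hvρ : ∀ x, entryPos ρ (v (π₂ x)) = (entryPos ρ (v x)).swap := fun x => hρ x.1 x.2
  set NL : Bool → Finset (Fin n) := fun b => Finset.univ.filter fun s => (b, s) ∈ unmatched v π₂
    with hNL
  have hmem : ∀ b s, s ∈ NL b ↔ (b, s) ∈ unmatched v π₂ := fun b s => by simp [hNL]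
  set lab : Bool → Fin n → Bool × (Fin 3 × (Fin N × Fin N)) := fun b s => sideLabel v π₂ (b, s)
    with hlab
  have main : ∀ b (K : Finset (Fin N)) (W : Finset (Bool × (Fin 3 × (Fin N × Fin N)))),
      (∀ s ∈ NL b, lab b s ∈ W → (v (b, s)).2.1 ∈ K ∧ (v (b, s)).2.2 ∈ K) →
      2 * (Finset.univ.image (i b) \ K).card + 2 ≤ 2 * ((NL b).image (lab b) \ W).card + n := by
    intro b K W hW
    refine two_mul_card_vertices_le hπ hπ' (i b) (hi b) (fun s => (v (b, s)).2) (fun s => rfl) (NL b)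
      ?_ ?_ ?_ (lab b) ?_ ?_ K W hW
    · intro s hs
      rw [hmem, mem_unmatched] at hs ⊢
      intro h
      refine hs ?_
      have := h.symm
      simp only [hπ₂, hπ] at this
      exact this
    · intro s hs
      rw [hmem, mem_unmatched, not_not] at hs
      exact hs.2.2
    · obtain ⟨s, hs⟩ := hun b
      exact ⟨s, (hmem b s).2 (mem_unmatched.2 hs)⟩
    · intro s _ s' _ h
      exact eq_or_eq_swap_of_sideLabel_eq hρ0 hvρ h
    · intro s hs h
      exact eq_of_sideLabel_eq_partner (π := π₂) hρ0 hvρ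
        ((hmem b s).1 hs) h
  have h1 := main false ∅ ∅ (by simp)
  have h2 := main true (Finset.univ.image (i false)) ((NL false).image (lab false)) (by
    intro s _ h
    obtain ⟨s', _, h'⟩ := Finset.mem_image.1 h
    have h3 := eq_or_eq_swap_of_sideLabel_eq hρ0 hvρ h'
    have ha : ∀ j, i false j ∈ Finset.univ.image (i false) := fun j =>
      Finset.mem_image_of_mem _ (Finset.mem_univ _)
    rcases h3 with h3 | h3 <;> rw [h3]
    · exact ⟨ha _, ha _⟩
    · exact ⟨ha _, ha _⟩)
  have hU : (Finset.univ.image fun x : Bool × Fin (n + 1) => i x.1 x.2) =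
      Finset.univ.image (i false) ∪ (Finset.univ.image (i true) \ Finset.univ.image (i false)) := by
    rw [Finset.union_sdiff_self_eq_union]
    ext x
    simp
  have hΛ : (unmatched v π₂).image (sideLabel v π₂) =
      (NL false).image (lab false) ∪ ((NL true).image (lab true) \ (NL false).image (lab false)) := by
    rw [Finset.union_sdiff_self_eq_union]
    ext x
    simp only [Finset.mem_image, Finset.mem_union, Prod.exists, Bool.exists_bool, hmem, hlab]
  rw [hU, hΛ, Finset.card_union_of_disjoint Finset.disjoint_sdiff,
    Finset.card_union_of_disjoint Finset.disjoint_sdiff]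
  simp only [Finset.sdiff_empty] at h1
  omega

end Walks

/-! ### Compatible walks with an unmatched side are rare -/

section RareWalks

open scoped ENNReal

theorem sum_inv_pow_card_image_le {J : Type*} [Fintype J] [DecidableEq J] {N : ℕ} (hN : 1 ≤ N) :
    ∑ i : J → Fin N, ((N : ℝ)⁻¹) ^ (Finset.univ.image i).card ≤
      (Fintype.card J : ℝ) ^ Fintype.card J := by
  classical
  have hNpos : (0 : ℝ) < N := by exact_mod_cast hN
  -- `c i j` is a representative of the class of `j` modulo equality of the values of `i`.
  have hrep : ∀ i : J → Fin N, ∃ c : J → J, i ∘ c = i ∧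
      (Finset.univ.image c).card = (Finset.univ.image i).card := by
    intro i
    have : ∀ x : ↥(Finset.univ.image i), ∃ j, i j = x.1 := fun x => by
      obtain ⟨j, _, hj⟩ := Finset.mem_image.1 x.2
      exact ⟨j, hj⟩
    choose g hg using this
    have hginj : Function.Injective g := fun x y h => Subtype.ext (by rw [← hg x, h, hg y])
    refine ⟨fun j => g ⟨i j, Finset.mem_image_of_mem i (Finset.mem_univ j)⟩, ?_, ?_⟩
    · funext j
      exact hg _
    · rw [← Fintype.card_coe (Finset.univ.image i), ← Finset.card_univ,
        ← Finset.card_image_of_injective _ hginj]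
      congr 1
      ext y
      simp only [Finset.mem_image, Finset.mem_univ, true_and]
      constructor
      · rintro ⟨j, rfl⟩
        exact ⟨_, rfl⟩
      · rintro ⟨x, rfl⟩
        exact ⟨g x, congrArg g (Subtype.ext (hg x))⟩
  choose c hc1 hc2 using hrep
  rw [← Finset.sum_fiberwise (s := Finset.univ) (g := c)]
  calc _ ≤ ∑ _c : J → J, (1 : ℝ) := by
        refine Finset.sum_le_sum fun d _ => ?_
        have h1 : ∑ i ∈ Finset.univ.filter (fun i => c i = d),
            ((N : ℝ)⁻¹) ^ (Finset.univ.image i).card =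
            ((Finset.univ.filter fun i => c i = d).card : ℝ) *
              ((N : ℝ)⁻¹) ^ (Finset.univ.image d).card := by
          rw [← nsmul_eq_mul, ← Finset.sum_const]
          refine Finset.sum_congr rfl fun i hi => ?_
          rw [← hc2, (Finset.mem_filter.1 hi).2]
        have h2 : (Finset.univ.filter fun i => c i = d).card ≤ N ^ (Finset.univ.image d).card := by
          have := Finset.card_le_card_of_injOn (s := Finset.univ.filter fun i => c i = d)
            (t := (Finset.univ : Finset (↥(Finset.univ.image d) → Fin N))) (fun i z => i z.1)
            (fun _ _ => Finset.mem_coe.2 (Finset.mem_univ _)) (by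
              intro i hi i' hi' h
              have e1 := (Finset.mem_filter.1 (Finset.mem_coe.1 hi)).2
              have e2 := (Finset.mem_filter.1 (Finset.mem_coe.1 hi')).2
              rw [← hc1 i, ← hc1 i', e1, e2]
              funext j
              exact congrFun h ⟨d j, Finset.mem_image_of_mem d (Finset.mem_univ j)⟩)
          rwa [Finset.card_univ, Fintype.card_fun, Fintype.card_fin, Fintype.card_coe] at this
        rw [h1, inv_pow, ← div_eq_mul_inv, div_le_one (by positivity)]
        exact_mod_cast h2
    _ = _ := by simp

variable {N n : ℕ}

/-- The closed walks on the letters of `w` along which `π` pairs conjugate entries of the GUE, once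
the entries have been permuted by `ρ`, although some pair of sides is not matched, so that it is the
permutations that make the two entries conjugate. -/
def unmatchedWalks (ρ : Equiv.Perm (Fin N × Fin N) × Equiv.Perm (Fin N × Fin N))
    (w : Fin n → Fin 3 × Bool) (π : Fin n → Fin n) : Finset (Fin (n + 1) → Fin N) :=
  Finset.univ.filter fun i => i 0 = i (Fin.last n) ∧
    (∀ s, entryPos ![1, ρ.1, ρ.2] (walkEntry w i (π s)) =
      (entryPos ![1, ρ.1, ρ.2] (walkEntry w i s)).swap) ∧
    ∃ s, ¬ Matched (walkEntry w i s) (walkEntry w i (π s))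

theorem sum_sq_card_unmatchedWalks_le (hN : 1 ≤ N) (w : Fin n → Fin 3 × Bool) {π : Fin n → Fin n}
    (hπ : ∀ s, π (π s) = s) (hπ' : ∀ s, π s ≠ s) :
    ∑ ρ : Equiv.Perm (Fin N × Fin N) × Equiv.Perm (Fin N × Fin N),
      ((unmatchedWalks ρ w π).card : ℝ) ^ 2 ≤
      (((2 * n : ℕ) ^ (2 * n) : ℝ) * (N * N).factorial) ^ 2 * N ^ n * ((N : ℝ)⁻¹) ^ 2 *
        ((2 * (n + 1) : ℕ) ^ (2 * (n + 1)) : ℝ) := by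
  classical
  have hNpos : (0 : ℝ) < N := by exact_mod_cast hN
  -- Expand the square as a sum over pairs of walks, and exchange it with the sum over `ρ`.
  let good : (Bool × Fin (n + 1) → Fin N) →
      Finset (Equiv.Perm (Fin N × Fin N) × Equiv.Perm (Fin N × Fin N)) := fun x =>
    Finset.univ.filter fun ρ => ∀ b, (fun j => x (b, j)) ∈ unmatchedWalks ρ w π
  have hgood : ∀ x, ((good x).card : ℝ) ≤
      (((2 * n : ℕ) ^ (2 * n) : ℝ) * (N * N).factorial) ^ 2 * N ^ n * ((N : ℝ)⁻¹) ^ 2 *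
        ((N : ℝ)⁻¹) ^ (Finset.univ.image x).card := by
    intro x
    rcases (good x).eq_empty_or_nonempty with h0 | ⟨ρ₀, hρ₀⟩
    · rw [h0, Finset.card_empty, Nat.cast_zero]
      positivity
    have hmem := fun ρ (hρ : ρ ∈ good x) b => (Finset.mem_filter.1 ((Finset.mem_filter.1 hρ).2 b)).2
    have h1 := card_vertices_pair_le hπ hπ' w (fun b j => x (b, j)) (fun b => (hmem ρ₀ hρ₀ b).1)
      (fun b => (hmem ρ₀ hρ₀ b).2.2) (ρ := ![1, ρ₀.1, ρ₀.2]) rfl fun b => (hmem ρ₀ hρ₀ b).2.1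
    have h2 := card_perm_conjugate_mul_le hN
      (fun y : Bool × Fin n => walkEntry w (fun j => x (y.1, j)) y.2) (fun y => (y.1, π y.2))
      fun y => by simp [hπ]
    set ℓ := ((unmatched (fun y : Bool × Fin n => walkEntry w (fun j => x (y.1, j)) y.2)
      fun y => (y.1, π y.2)).image (sideLabel (fun y : Bool × Fin n =>
        walkEntry w (fun j => x (y.1, j)) y.2) fun y => (y.1, π y.2))).card
    have h3 : (good x).card * N ^ ((Finset.univ.image x).card + 2) ≤
        ((2 * n) ^ (2 * n) * (N * N).factorial) ^ 2 * N ^ n := by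
      calc _ ≤ (good x).card * N ^ (ℓ + n) :=
            Nat.mul_le_mul_left _ (Nat.pow_le_pow_right hN h1)
        _ = (good x).card * N ^ ℓ * N ^ n := by rw [pow_add, mul_assoc]
        _ ≤ _ := by
            refine Nat.mul_le_mul_right _ ((Nat.mul_le_mul_right _ (Finset.card_le_card ?_)).trans
              (h2.trans_eq ?_))
            · intro ρ hρ
              exact Finset.mem_filter.2 ⟨Finset.mem_univ _, fun y => (hmem ρ hρ y.1).2.1 y.2⟩
            · simp
    have h4 : ((good x).card : ℝ) * N ^ ((Finset.univ.image x).card + 2) ≤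
        (((2 * n : ℕ) ^ (2 * n) : ℝ) * (N * N).factorial) ^ 2 * N ^ n := by exact_mod_cast h3
    rw [← le_div_iff₀ (by positivity)] at h4
    refine h4.trans_eq ?_
    rw [pow_add, div_eq_mul_inv, mul_inv, inv_pow, inv_pow]
    ring
  have hsq : ∀ ρ, ((unmatchedWalks ρ w π).card : ℝ) ^ 2 =
      ∑ x : Bool × Fin (n + 1) → Fin N, if ρ ∈ good x then (1 : ℝ) else 0 := by
    intro ρ
    rw [Finset.sum_boole, ← Nat.cast_pow]
    congr 1
    have : (unmatchedWalks ρ w π).card ^ 2 =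
        (Fintype.piFinset fun _ : Bool => unmatchedWalks ρ w π).card := by simp
    rw [this]
    refine Finset.card_bij' (fun i _ z => i z.1 z.2) (fun x _ b j => x (b, j)) ?_ ?_ ?_ ?_
    · intro i hi
      simp only [good, Finset.mem_filter, Finset.mem_univ, true_and]
      exact Fintype.mem_piFinset.1 hi
    · intro x hx
      simp only [good, Finset.mem_filter, Finset.mem_univ, true_and] at hx
      exact Fintype.mem_piFinset.2 hx
    · intros; rfl
    · intros; rfl
  simp only [hsq]
  rw [Finset.sum_comm]
  simp only [Finset.sum_boole, Finset.filter_mem_eq_inter, Finset.univ_inter]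
  refine (Finset.sum_le_sum fun x _ => hgood x).trans ?_
  rw [← Finset.mul_sum]
  refine mul_le_mul_of_nonneg_left ?_ (by positivity)
  have := sum_inv_pow_card_image_le (J := Bool × Fin (n + 1)) hN
  simpa using this

variable {Ω : Type*} [MeasurableSpace Ω] {P : Measure Ω}

theorem measure_perm_pair_eq {s t : Ω → Equiv.Perm (Fin N × Fin N)} (hs : IsUniformPerm P s)
    (ht : IsUniformPerm P t) (hst : IndepFun s t P)
    (ρ : Equiv.Perm (Fin N × Fin N) × Equiv.Perm (Fin N × Fin N)) :
    P ((fun ω => (s ω, t ω)) ⁻¹' {ρ}) = (((N * N).factorial : ℝ≥0∞)⁻¹) ^ 2 := by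
  have h := hst.measure_inter_preimage_eq_mul {ρ.1} {ρ.2} trivial trivial
  rw [hs.law, ht.law, ← sq, sq N] at h
  rw [← h]
  congr 1
  ext ω
  simp [Prod.ext_iff]

theorem lintegral_perm_pair {s t : Ω → Equiv.Perm (Fin N × Fin N)} (hs : IsUniformPerm P s)
    (ht : IsUniformPerm P t) (hst : IndepFun s t P)
    (F : Equiv.Perm (Fin N × Fin N) × Equiv.Perm (Fin N × Fin N) → ℝ≥0∞) :
    ∫⁻ ω, F (s ω, t ω) ∂P = (((N * N).factorial : ℝ≥0∞)⁻¹) ^ 2 * ∑ ρ, F ρ := by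
  have : DiscreteMeasurableSpace (Equiv.Perm (Fin N × Fin N)) := ⟨fun _ => trivial⟩
  have hm : Measurable fun ω => (s ω, t ω) := hs.measurable.prodMk ht.measurable
  rw [← lintegral_map (μ := P) (f := F) (g := fun ω => (s ω, t ω)) Measurable.of_discrete hm,
    lintegral_fintype, Finset.mul_sum]
  refine Finset.sum_congr rfl fun ρ _ => ?_
  rw [Measure.map_apply hm (measurableSet_singleton _), measure_perm_pair_eq hs ht hst, mul_comm]

/-- A nonnegative function of the two permutations whose mean is `O(N⁻²)` tends to zero almost
surely. -/
theorem ae_tendsto_zero_of_sum_le {σ τ : (N : ℕ) → Ω → Equiv.Perm (Fin N × Fin N)}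
    (hσ : ∀ N, IsUniformPerm P (σ N)) (hτ : ∀ N, IsUniformPerm P (τ N))
    (hστ : ∀ N, IndepFun (σ N) (τ N) P)
    (F : (N : ℕ) → Equiv.Perm (Fin N × Fin N) × Equiv.Perm (Fin N × Fin N) → ℝ)
    (hF0 : ∀ N ρ, 0 ≤ F N ρ) (K : ℝ)
    (hF : ∀ N, 1 ≤ N → ∑ ρ, F N ρ ≤ K * ((N * N).factorial : ℝ) ^ 2 * ((N : ℝ)⁻¹) ^ 2) :
    ∀ᵐ ω ∂P, Tendsto (fun N => F N (σ N ω, τ N ω)) atTop (𝓝 0) := by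
  have hmeas : ∀ N, Measurable fun ω => ENNReal.ofReal (F (N + 1) (σ (N + 1) ω, τ (N + 1) ω)) := by
    intro N
    have : DiscreteMeasurableSpace (Equiv.Perm (Fin (N + 1) × Fin (N + 1))) := ⟨fun _ => trivial⟩
    exact (Measurable.of_discrete (f := fun ρ => ENNReal.ofReal (F (N + 1) ρ))).comp
      ((hσ (N + 1)).measurable.prodMk (hτ (N + 1)).measurable)
  have hint : ∀ N, ∫⁻ ω, ENNReal.ofReal (F (N + 1) (σ (N + 1) ω, τ (N + 1) ω)) ∂P ≤
      ENNReal.ofReal (K * (((N + 1 : ℕ) : ℝ)⁻¹) ^ 2) := by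
    intro N
    have h := lintegral_perm_pair (hσ (N + 1)) (hτ (N + 1)) (hστ (N + 1))
      fun ρ => ENNReal.ofReal (F (N + 1) ρ)
    rw [h, ← ENNReal.ofReal_sum_of_nonneg fun ρ _ => hF0 _ _]
    set f : ℝ := (((N + 1) * (N + 1)).factorial : ℝ) with hf
    have hfpos : 0 < f := by rw [hf]; exact_mod_cast Nat.factorial_pos _
    have hfe : ((((N + 1) * (N + 1)).factorial : ℝ≥0∞)⁻¹) ^ 2 = ENNReal.ofReal ((f⁻¹) ^ 2) := by
      rw [ENNReal.ofReal_pow (by positivity), ENNReal.ofReal_inv_of_pos hfpos, hf,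
        ENNReal.ofReal_natCast]
    rw [hfe, ← ENNReal.ofReal_mul (by positivity)]
    refine ENNReal.ofReal_le_ofReal ?_
    calc (f⁻¹) ^ 2 * ∑ ρ, F (N + 1) ρ
        ≤ (f⁻¹) ^ 2 * (K * f ^ 2 * (((N + 1 : ℕ) : ℝ)⁻¹) ^ 2) :=
          mul_le_mul_of_nonneg_left (hF (N + 1) (by omega)) (by positivity)
      _ = _ := by field_simp
  have hsum : ∫⁻ ω, ∑' N, ENNReal.ofReal (F (N + 1) (σ (N + 1) ω, τ (N + 1) ω)) ∂P ≠ ∞ := by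
    rw [lintegral_tsum fun N => (hmeas N).aemeasurable]
    refine ne_top_of_le_ne_top ?_ (ENNReal.tsum_le_tsum hint)
    have hs : Summable fun N : ℕ => K * (((N + 1 : ℕ) : ℝ)⁻¹) ^ 2 := by
      refine Summable.mul_left K ?_
      have := (summable_nat_add_iff 1).2 (Real.summable_nat_pow_inv (p := 2).2 one_lt_two)
      simpa using this
    exact hs.tsum_ofReal_ne_top
  filter_upwards [ae_lt_top (Measurable.tsum hmeas) hsum] with ω hω
  have h1 := ENNReal.tendsto_atTop_zero_of_tsum_ne_top hω.ne
  rw [← tendsto_add_atTop_iff_nat 1]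
  have h2 := (ENNReal.tendsto_toReal ENNReal.zero_ne_top).comp h1
  simp only [Function.comp_def, ENNReal.toReal_zero, ENNReal.toReal_ofReal (hF0 _ _)] at h2
  exact h2

theorem ae_tendsto_card_unmatchedWalks {σ τ : (N : ℕ) → Ω → Equiv.Perm (Fin N × Fin N)}
    (hσ : ∀ N, IsUniformPerm P (σ N)) (hτ : ∀ N, IsUniformPerm P (τ N))
    (hστ : ∀ N, IndepFun (σ N) (τ N) P) {h : ℕ} (hn : n = 2 * h) (w : Fin n → Fin 3 × Bool)
    {π : Fin n → Fin n} (hπ : ∀ s, π (π s) = s) (hπ' : ∀ s, π s ≠ s) :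
    ∀ᵐ ω ∂P, Tendsto (fun N : ℕ =>
      ((unmatchedWalks (σ N ω, τ N ω) w π).card : ℝ) * ((N : ℝ)⁻¹) ^ h) atTop (𝓝 0) := by
  have key := ae_tendsto_zero_of_sum_le hσ hτ hστ
    (fun N ρ => (((unmatchedWalks ρ w π).card : ℝ) * ((N : ℝ)⁻¹) ^ h) ^ 2)
    (fun N ρ => sq_nonneg _)
    (((2 * n : ℕ) ^ (2 * n) : ℝ) ^ 2 * ((2 * (n + 1) : ℕ) ^ (2 * (n + 1)) : ℝ)) (by
      intro N hN
      have hNpos : (0 : ℝ) < N := by exact_mod_cast hN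
      simp only [mul_pow, ← Finset.sum_mul]
      have h1 := mul_le_mul_of_nonneg_right (sum_sq_card_unmatchedWalks_le hN w hπ hπ')
        (show 0 ≤ (((N : ℝ)⁻¹) ^ h) ^ 2 by positivity)
      refine h1.trans_eq ?_
      rw [← pow_mul, mul_comm h 2, ← hn, inv_pow]
      field_simp
      rw [← mul_pow, mul_one_div_cancel hNpos.ne', one_pow])
  filter_upwards [key] with ω hω
  have := (Real.continuous_sqrt.tendsto 0).comp hω
  simp only [Function.comp_def, Real.sqrt_zero] at this
  refine this.congr fun N => Real.sqrt_sq (by positivity)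

end RareWalks

/-! ### Moments of the permuted Gaussian matrices -/

section PermutedMoments

open MvPolynomial

theorem IsGaussianFunctional.rename {V V' : Type*} [Fintype V] [Fintype V']
    {E : MvPolynomial V' ℂ →ₗ[ℂ] ℂ} {C : V' → V' → ℂ} (h : IsGaussianFunctional E C) (f : V → V') :
    IsGaussianFunctional (E ∘ₗ (MvPolynomial.rename f).toLinearMap) fun v v' => C (f v) (f v') := by
  classical
  have e : MvPolynomial.rename f = (aeval fun v => ∑ j, (if j = f v then (1 : ℂ) else 0) •
      (X j : MvPolynomial V' ℂ)) := by
    refine MvPolynomial.algHom_ext fun v => ?_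
    simp
  have := h.comp_linear fun v j => if j = f v then 1 else 0
  rw [e]
  simpa only [ite_mul, mul_ite, one_mul, zero_mul, mul_zero, mul_one, Finset.sum_ite_eq',
    Finset.mem_univ, if_true] using this

theorem matrix_prod_ofFn_apply {R : Type*} [CommRing R] {N n : ℕ}
    (A : Fin n → Matrix (Fin N) (Fin N) R) (a b : Fin N) :
    (List.ofFn A).prod a b = ∑ i : Fin (n + 1) → Fin N, if i 0 = a ∧ i (Fin.last n) = b then
      ∏ s, A s (i s.castSucc) (i s.succ) else 0 := by
  induction n generalizing a with
  | zero =>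
    rw [← (Equiv.funUnique (Fin 1) (Fin N)).symm.sum_comp]
    simp [Matrix.one_apply, ite_and]
  | succ n ih =>
    rw [List.ofFn_succ, List.prod_cons, Matrix.mul_apply,
      ← (Fin.consEquiv fun _ => Fin N).sum_comp, Fintype.sum_prod_type]
    simp only [Fin.consEquiv_apply, Fin.cons_zero, Fin.prod_univ_succ, ih, Finset.mul_sum]
    symm
    rw [Finset.sum_eq_single a (fun x _ hx => by simp [hx]) (by simp), Finset.sum_comm]
    refine Finset.sum_congr rfl fun i _ => ?_
    rw [Finset.sum_eq_single (i 0) (fun x _ hx => by simp [hx.symm]) (by simp)]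
    simp [← Fin.succ_last]

variable {N n : ℕ}

/-- The closed walks of length `n` in `[N]`. -/
def closedWalks (N n : ℕ) : Finset (Fin (n + 1) → Fin N) :=
  Finset.univ.filter fun i => i 0 = i (Fin.last n)

theorem trace_genericWord_ofFn (w : Fin n → Fin 3 × Bool) :
    (genericWord N (List.ofFn w)).trace = ∑ i ∈ closedWalks N n,
      (((List.finRange n).map (walkEntry w i)).map X).prod := by
  have h : ∀ i : Fin (n + 1) → Fin N, (((List.finRange n).map (walkEntry w i)).map X).prod =
      ∏ s, genericMatrix N (w s) (i s.castSucc) (i s.succ) := by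
    intro i
    rw [List.map_map, ← List.ofFn_eq_map, List.prod_ofFn]
    rfl
  simp only [h, Matrix.trace, Matrix.diag_apply, genericWord, List.map_ofFn, matrix_prod_ofFn_apply,
    closedWalks, Finset.sum_filter]
  rw [Finset.sum_comm]
  refine Finset.sum_congr rfl fun i _ => ?_
  rw [Finset.sum_eq_single (i 0) (fun x _ hx => by simp [hx.symm]) (by simp)]
  simp [eq_comm]

theorem IsGaussianFunctional.map_trace_genericWord {E : MvPolynomial (Entry N) ℂ →ₗ[ℂ] ℂ}
    {C : Entry N → Entry N → ℂ} (h : IsGaussianFunctional E C) (w : Fin n → Fin 3 × Bool) :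
    E (genericWord N (List.ofFn w)).trace = ((pairings (List.finRange n)).map fun p =>
      ∑ i ∈ closedWalks N n,
        (p.map fun t => C (walkEntry w i t.1) (walkEntry w i t.2)).prod).sum := by
  rw [trace_genericWord_ofFn, map_sum, ← sum_list_sum_map]
  refine Finset.sum_congr rfl fun i _ => ?_
  rw [h.map_list_prod, pairings_map, List.map_map]
  simp [Function.comp_def]

theorem list_prod_ite {α R : Type*} [CommMonoidWithZero R] (l : List α) (r : α → Prop)
    [DecidablePred r] (x : R) :
    (l.map fun t => if r t then x else 0).prod = if ∀ t ∈ l, r t then x ^ l.length else 0 := by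
  induction l with
  | nil => simp
  | cons a l ih =>
    rw [List.map_cons, List.prod_cons, ih]
    by_cases h : r a <;> by_cases h' : ∀ t ∈ l, r t <;> simp [h, h', pow_succ']

/-- The covariance of the letters of `G, G^σ, G^τ` and their adjoints, in the large `N` limit:
`G` is self-adjoint, and the other two matrices behave as non-self-adjoint ones. -/
noncomputable def jointCov (a b : Fin 3 × Bool) : ℂ :=
  if a.1 = b.1 ∧ (a.1 = 0 ∨ a.2 ≠ b.2) then 1 else 0

theorem matrixCov_jointCov (v v' : Entry N) :
    matrixCov jointCov N v v' = if Matched v v' then (N : ℂ)⁻¹ else 0 := by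
  simp only [matrixCov, jointCov, Matched]
  split_ifs <;> simp_all

/-- The covariance of the entries of `G, G^σ, G^τ` and their adjoints. -/
noncomputable def permutedCov (ρ : Equiv.Perm (Fin N × Fin N) × Equiv.Perm (Fin N × Fin N))
    (v v' : Entry N) : ℂ :=
  if entryPos ![1, ρ.1, ρ.2] v' = (entryPos ![1, ρ.1, ρ.2] v).swap then (N : ℂ)⁻¹ else 0

/-- For each pairing, the walks that contribute for the permuted matrices but not for the limiting
Gaussian family are those with an unmatched side. -/
theorem exists_involution_sum_prod_sub {p : List (Fin n × Fin n)}
    (hp : p ∈ pairings (List.finRange n)) (w : Fin n → Fin 3 × Bool) :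
    n = 2 * p.length ∧ ∃ π : Fin n → Fin n, (∀ s, π (π s) = s) ∧ (∀ s, π s ≠ s) ∧
      ∀ (N : ℕ) (ρ : Equiv.Perm (Fin N × Fin N) × Equiv.Perm (Fin N × Fin N)),
        (∑ i ∈ closedWalks N n,
          (p.map fun t => permutedCov ρ (walkEntry w i t.1) (walkEntry w i t.2)).prod) -
        (∑ i ∈ closedWalks N n,
          (p.map fun t => matrixCov jointCov N (walkEntry w i t.1) (walkEntry w i t.2)).prod) =
        ((unmatchedWalks ρ w π).card : ℂ) * ((N : ℂ)⁻¹) ^ p.length := by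
  obtain ⟨hlen, π, hπ, hpπ⟩ := exists_involution_of_mem_pairings (List.nodup_finRange n) hp
  rw [List.length_finRange] at hlen
  refine ⟨hlen.symm, π, fun s => (hπ s (List.mem_finRange s)).2.1,
    fun s => (hπ s (List.mem_finRange s)).2.2.1, fun N ρ => ?_⟩
  have hiff : ∀ r : Entry N → Entry N → Prop, (∀ v v', r v v' → r v' v) → ∀ v : Fin n → Entry N,
      (∀ t ∈ p, r (v t.1) (v t.2)) ↔ ∀ s, r (v s) (v (π s)) := by
    intro r hr v
    constructor
    · intro h s
      rcases (hπ s (List.mem_finRange s)).2.2.2 with hs | hs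
      · exact h _ hs
      · exact hr _ _ (h _ hs)
    · intro h t ht
      rw [(hpπ t ht).2]
      exact h t.1
  have hconj : ∀ v v' : Entry N, entryPos ![1, ρ.1, ρ.2] v' = (entryPos ![1, ρ.1, ρ.2] v).swap →
      entryPos ![1, ρ.1, ρ.2] v = (entryPos ![1, ρ.1, ρ.2] v').swap := by
    intro v v' h
    rw [h, Prod.swap_swap]
  rw [← Finset.sum_sub_distrib]
  simp only [permutedCov, matrixCov_jointCov, list_prod_ite]
  have hterm : ∀ i : Fin (n + 1) → Fin N, i ∈ closedWalks N n →
      ((if ∀ t ∈ p, entryPos ![1, ρ.1, ρ.2] (walkEntry w i t.2) =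
          (entryPos ![1, ρ.1, ρ.2] (walkEntry w i t.1)).swap then ((N : ℂ)⁻¹) ^ p.length else 0) -
        if ∀ t ∈ p, Matched (walkEntry w i t.1) (walkEntry w i t.2) then
          ((N : ℂ)⁻¹) ^ p.length else 0) =
      if i ∈ unmatchedWalks ρ w π then ((N : ℂ)⁻¹) ^ p.length else 0 := by
    intro i hi
    have hi := (Finset.mem_filter.1 hi).2
    have h1 := hiff (fun v v' => entryPos ![1, ρ.1, ρ.2] v' =
      (entryPos ![1, ρ.1, ρ.2] v).swap) hconj (walkEntry w i)
    have h2 := hiff Matched (fun _ _ h => h.symm) (walkEntry w i)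
    simp only [h1, h2, unmatchedWalks, Finset.mem_filter, Finset.mem_univ, true_and, hi]
    by_cases hm : ∀ s, Matched (walkEntry w i s) (walkEntry w i (π s))
    · have hc : ∀ s, entryPos ![1, ρ.1, ρ.2] (walkEntry w i (π s)) =
          (entryPos ![1, ρ.1, ρ.2] (walkEntry w i s)).swap := fun s => (hm s).entryPos_eq_swap rfl
      have hm' : ¬ ∃ s, ¬ Matched (walkEntry w i s) (walkEntry w i (π s)) := by simpa using hm
      rw [if_pos hc, if_pos hm, if_neg fun h => hm' h.2, sub_self]
    · have hm' : ∃ s, ¬ Matched (walkEntry w i s) (walkEntry w i (π s)) := by simpa using hm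
      simp only [hm, hm', if_false, sub_zero, and_true]
  rw [Finset.sum_congr rfl fun i hi => (by convert hterm i hi), ← Finset.sum_filter,
    Finset.sum_const, nsmul_eq_mul]
  congr 3
  ext i
  simp only [Finset.mem_filter, closedWalks, unmatchedWalks, Finset.mem_univ, true_and]
  tauto

theorem tendsto_list_sum_zero {α β : Type*} {l : Filter β} (L : List α) (f : α → β → ℂ)
    (h : ∀ a ∈ L, Tendsto (f a) l (𝓝 0)) :
    Tendsto (fun x => (L.map fun a => f a x).sum) l (𝓝 0) := by
  induction L with
  | nil => exact tendsto_const_nhds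
  | cons a L ih =>
    simp only [List.map_cons, List.sum_cons]
    simpa using (h a List.mem_cons_self).add (ih fun b hb => h b (List.mem_cons_of_mem _ hb))

/-- The permutations `ρ N` are generic: compatible closed walks with an unmatched side are too rare
to contribute to the moments. -/
def IsGenericSequence
    (ρ : (N : ℕ) → Equiv.Perm (Fin N × Fin N) × Equiv.Perm (Fin N × Fin N)) : Prop :=
  ∀ (h : ℕ) (w : Fin (2 * h) → Fin 3 × Bool) (π : Fin (2 * h) → Fin (2 * h)),
    (∀ s, π (π s) = s) → (∀ s, π s ≠ s) →
      Tendsto (fun N : ℕ => ((unmatchedWalks (ρ N) w π).card : ℝ) * ((N : ℝ)⁻¹) ^ h) atTop (𝓝 0)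

theorem ae_isGenericSequence {Ω : Type*} [MeasurableSpace Ω] {P : Measure Ω}
    {σ τ : (N : ℕ) → Ω → Equiv.Perm (Fin N × Fin N)}
    (hσ : ∀ N, IsUniformPerm P (σ N)) (hτ : ∀ N, IsUniformPerm P (τ N))
    (hστ : ∀ N, IndepFun (σ N) (τ N) P) :
    ∀ᵐ ω ∂P, IsGenericSequence fun N => (σ N ω, τ N ω) := by
  simp only [IsGenericSequence, ae_all_iff]
  intro h w π hπ hπ'
  exact ae_tendsto_card_unmatchedWalks hσ hτ hστ rfl w hπ hπ'

/-- For generic permutations, the moments converge to those of a semicircular family, with an error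
`o(1 / N)`. -/
theorem tendsto_moment_word
    {ρ : (N : ℕ) → Equiv.Perm (Fin N × Fin N) × Equiv.Perm (Fin N × Fin N)}
    (hρ : IsGenericSequence ρ) {E E₀ : (N : ℕ) → MvPolynomial (Entry N) ℂ →ₗ[ℂ] ℂ}
    (hE : ∀ N, IsGaussianFunctional (E N) (permutedCov (ρ N)))
    (hE₀ : ∀ N, IsGaussianFunctional (E₀ N) (matrixCov jointCov N)) (w : List (Fin 3 × Bool)) :
    Tendsto (fun N : ℕ => (N : ℂ) * ((N : ℂ)⁻¹ * E N (genericWord N w).trace -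
      semicircularMoment jointCov w)) atTop (𝓝 0) := by
  obtain ⟨n, w, rfl⟩ : ∃ (n : ℕ) (w' : Fin n → Fin 3 × Bool), w = List.ofFn w' :=
    ⟨w.length, w.get, (List.ofFn_get w).symm⟩
  have h1 : Tendsto (fun N : ℕ => E N (genericWord N (List.ofFn w)).trace -
      E₀ N (genericWord N (List.ofFn w)).trace) atTop (𝓝 0) := by
    have hdiff : ∀ N, E N (genericWord N (List.ofFn w)).trace -
        E₀ N (genericWord N (List.ofFn w)).trace = ((pairings (List.finRange n)).map fun p =>
        (∑ i ∈ closedWalks N n,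
          (p.map fun t => permutedCov (ρ N) (walkEntry w i t.1) (walkEntry w i t.2)).prod) -
        (∑ i ∈ closedWalks N n,
          (p.map fun t => matrixCov jointCov N (walkEntry w i t.1)
            (walkEntry w i t.2)).prod)).sum := by
      intro N
      rw [(hE N).map_trace_genericWord, (hE₀ N).map_trace_genericWord]
      generalize pairings (List.finRange n) = L
      induction L with
      | nil => simp
      | cons p L ih =>
        simp only [List.map_cons, List.sum_cons, ← ih]
        ring
    simp only [hdiff]
    refine tendsto_list_sum_zero _ _ fun p hp => ?_
    obtain ⟨hn, π, hπ, hπ', h⟩ := exists_involution_sum_prod_sub hp w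
    simp only [h]
    generalize p.length = k at hn
    subst hn
    have := (Complex.continuous_ofReal.tendsto 0).comp (hρ k w π hπ hπ')
    simpa [Function.comp_def] using this
  have h2 : Tendsto (fun N : ℕ => (N : ℂ) * (E₀ N (traceProd N [List.ofFn w]) * ((N : ℂ)⁻¹) ^
      [List.ofFn w].length - ([List.ofFn w].map (semicircularMoment jointCov)).prod))
      atTop (𝓝 0) := by
    have hN : (fun N : ℕ => (N : ℂ)) =O[atTop] fun N : ℕ => (N : ℝ) :=
      Asymptotics.isBigO_of_le _ fun N => by simp
    refine (hN.mul (isBigO_traceProd hE₀ [List.ofFn w])).trans_tendsto ?_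
    refine (tendsto_inv_atTop_nhds_zero_nat (𝕜 := ℝ)).congr fun N => ?_
    rcases eq_or_ne (N : ℝ) 0 with h | h
    · simp [h]
    · field_simp
  have h3 := h1.add h2
  rw [add_zero] at h3
  refine h3.congr' ?_
  filter_upwards [eventually_ge_atTop 1] with N hN
  have hN0 : (N : ℂ) ≠ 0 := by
    have : N ≠ 0 := by omega
    exact_mod_cast this
  simp only [traceProd, List.map_cons, List.map_nil, List.prod_cons, List.prod_nil, mul_one,
    List.length_singleton, pow_one]
  field_simp
  ring

/-- The two blocks, among five, of the rows and columns where a letter is placed. -/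
def letterBlock : Fin 3 × Bool → Fin 5 × Fin 5
  | (0, _) => (0, 0)
  | (1, false) => (1, 2)
  | (1, true) => (2, 1)
  | (2, false) => (3, 4)
  | (2, true) => (4, 3)

/-- A GUE matrix of size `5 N` contains, as blocks, a GUE matrix and two independent
non-self-adjoint ones, so that the limiting Gaussian family exists. -/
theorem exists_isGaussianFunctional_matrixCov {E : MvPolynomial (Fin (5 * N) × Fin (5 * N)) ℂ →ₗ[ℂ] ℂ}
    (hE : IsGaussianFunctional E fun p q => if q = p.swap then ((5 * N : ℕ) : ℂ)⁻¹ else 0) :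
    ∃ E₀ : MvPolynomial (Entry N) ℂ →ₗ[ℂ] ℂ, IsGaussianFunctional E₀ (matrixCov jointCov N) := by
  let e : Entry N → Fin (5 * N) × Fin (5 * N) := fun v =>
    (finProdFinEquiv ((letterBlock v.1).1, v.2.1), finProdFinEquiv ((letterBlock v.1).2, v.2.2))
  have hblock : ∀ a b : Fin 3 × Bool, letterBlock b = (letterBlock a).swap ↔
      a.1 = b.1 ∧ (a.1 = 0 ∨ a.2 ≠ b.2) := by decide
  have he : ∀ v v', e v' = (e v).swap ↔ Matched v v' := by
    intro v v'
    have hb := hblock v.1 v'.1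
    simp only [Prod.ext_iff, Prod.fst_swap, Prod.snd_swap] at hb
    simp only [e, Matched, Prod.ext_iff, Prod.swap_prod_mk, EmbeddingLike.apply_eq_iff_eq,
      Prod.fst_swap, Prod.snd_swap]
    tauto
  -- The factor `√5` turns the variance `1 / (5 N)` into `1 / N`.
  have h := hE.comp_linear fun v q => if q = e v then ((Real.sqrt 5 : ℝ) : ℂ) else 0
  suffices hC : matrixCov jointCov N = fun v v' => ∑ i, ∑ j,
      (if i = e v then ((Real.sqrt 5 : ℝ) : ℂ) else 0) *
        (if j = e v' then ((Real.sqrt 5 : ℝ) : ℂ) else 0) *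
          (if j = i.swap then ((5 * N : ℕ) : ℂ)⁻¹ else 0) by
    rw [hC]
    exact ⟨_, h⟩
  funext v v'
  have h5 : ((Real.sqrt 5 : ℝ) : ℂ) * ((Real.sqrt 5 : ℝ) : ℂ) = 5 := by
    rw [← Complex.ofReal_mul, Real.mul_self_sqrt (by norm_num)]
    norm_num
  rw [Finset.sum_eq_single (e v) (fun i _ hi => by simp [hi]) (by simp),
    Finset.sum_eq_single (e v') (fun j _ hj => by simp [hj]) (by simp)]
  simp only [matrixCov_jointCov, if_true, he, h5]
  split_ifs
  · push_cast
    rw [mul_inv, ← mul_assoc, mul_inv_cancel₀ (by norm_num), one_mul]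
  · rw [mul_zero]

end PermutedMoments

/-! ### Asymptotic distribution of the permuted Gaussian matrices -/

section AsymptoticDistribution

open MvPolynomial

variable {Ω : Type*} [MeasurableSpace Ω] {P : Measure Ω} {N : ℕ}

/-- The trace of a non-commutative polynomial in the generic matrices. -/
noncomputable def genericTrace {κ : Type*} (N : ℕ) :
    FreeAlgebra ℂ κ →ₗ[ℂ] MvPolynomial (κ × (Fin N × Fin N)) ℂ :=
  Matrix.traceLinearMap (Fin N) ℂ _ ∘ₗ (FreeAlgebra.lift ℂ (genericMatrix N)).toLinearMap

theorem genericTrace_word {κ : Type*} (w : List κ) :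
    genericTrace N (word w) = (genericWord N w).trace := by
  simp [genericTrace, word, genericWord, map_list_prod, Function.comp_def]

theorem trace_lift_eq_eval_genericTrace {κ : Type*} (A : κ → Matrix (Fin N) (Fin N) ℂ)
    (Q : FreeAlgebra ℂ κ) : (FreeAlgebra.lift ℂ A Q).trace =
      eval (fun v => A v.1 v.2.1 v.2.2) (genericTrace N Q) := by
  have h : FreeAlgebra.lift ℂ A = ((MvPolynomial.aeval (R := ℂ) fun v : κ × (Fin N × Fin N) =>
      A v.1 v.2.1 v.2.2).mapMatrix).comp (FreeAlgebra.lift ℂ (genericMatrix N)) := by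
    refine FreeAlgebra.hom_ext ?_
    funext k
    ext i j
    simp [genericMatrix]
  rw [h]
  simp [genericTrace, Matrix.trace, MvPolynomial.aeval_eq_eval]

/-- The matrices `G, G^σ, G^τ` for `ρ = (σ, τ)`. -/
noncomputable def permutedFamily (G : Ω → Matrix (Fin N) (Fin N) ℂ)
    (ρ : Equiv.Perm (Fin N × Fin N) × Equiv.Perm (Fin N × Fin N)) :
    Fin 3 → Ω → Matrix (Fin N) (Fin N) ℂ :=
  fun k ω => permuteEntries (![1, ρ.1, ρ.2] k) (G ω)

theorem IsGaussianRandomMatrix.withAdjoints_apply {G : Ω → Matrix (Fin N) (Fin N) ℂ}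
    (hG : IsGaussianRandomMatrix P G)
    (ρ : Equiv.Perm (Fin N × Fin N) × Equiv.Perm (Fin N × Fin N)) :
    ∀ᵐ ω ∂P, ∀ v : Entry N, withAdjoints (permutedFamily G ρ) v.1 ω v.2.1 v.2.2 =
      G ω (entryPos ![1, ρ.1, ρ.2] v).1 (entryPos ![1, ρ.1, ρ.2] v).2 := by
  have h : ∀ᵐ ω ∂P, ∀ i j, G ω j i = (starRingEnd ℂ) (G ω i j) :=
    ae_all_iff.2 fun i => ae_all_iff.2 fun j => hG.entry_swap i j
  filter_upwards [h] with ω hω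
  rintro ⟨⟨k, b⟩, ⟨i, j⟩⟩
  cases b
  · simp [withAdjoints, permutedFamily, permuteEntries, entryPos]
  · simp only [withAdjoints, permutedFamily, permuteEntries, entryPos, if_true,
      Matrix.conjTranspose_apply, Matrix.of_apply, Prod.swap_prod_mk, Prod.fst_swap, Prod.snd_swap]
    rw [hω (![1, ρ.1, ρ.2] k (j, i)).1 (![1, ρ.1, ρ.2] k (j, i)).2]
    rfl

theorem IsGaussianRandomMatrix.trace_ae_eq {G : Ω → Matrix (Fin N) (Fin N) ℂ}
    (hG : IsGaussianRandomMatrix P G)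
    (ρ : Equiv.Perm (Fin N × Fin N) × Equiv.Perm (Fin N × Fin N)) (Q : FreeAlgebra ℂ (Fin 3 × Bool)) :
    (fun ω => (FreeAlgebra.lift ℂ (fun k => withAdjoints (permutedFamily G ρ) k ω) Q).trace) =ᵐ[P]
      fun ω => eval (fun p : Fin N × Fin N => G ω p.1 p.2)
        (MvPolynomial.rename (entryPos ![1, ρ.1, ρ.2]) (genericTrace N Q)) := by
  filter_upwards [hG.withAdjoints_apply ρ] with ω hω
  rw [trace_lift_eq_eval_genericTrace, eval_rename]
  congr 2
  funext v
  exact hω v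

theorem asymptoticallyCircular_permutedFamily
    {G : (N : ℕ) → Ω → Matrix (Fin N) (Fin N) ℂ}
    {ρ : (N : ℕ) → Equiv.Perm (Fin N × Fin N) × Equiv.Perm (Fin N × Fin N)}
    (h : HasAsymptoticInfinitesimalDistribution P
      (fun N => withAdjoints (permutedFamily (G N) (ρ N))) (semicircularFunctional jointCov) 0)
    {k : Fin 3} (hk : k ≠ 0) :
    AsymptoticallyCircularZeroInfinitesimal P fun N => permutedFamily (G N) (ρ N) k := by
  refine ⟨semicircularFunctional circularCov, fun Q => ?_, isCircular_ι⟩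
  have hcomp : semicircularFunctional circularCov = semicircularFunctional jointCov ∘ₗ
      (FreeAlgebra.lift ℂ fun a : Unit × Bool => FreeAlgebra.ι ℂ (k, a.2)).toLinearMap := by
    have := semicircularFunctional_eq_comp (c := circularCov) (d := jointCov)
      (fun a j => if j = (k, a.2) then 1 else 0) (by
        intro a b
        simp only [ite_mul, one_mul, zero_mul, mul_ite, mul_one, mul_zero]
        rw [Finset.sum_eq_single (k, a.2) (fun i _ hi => by simp [hi]) (by simp),
          Finset.sum_eq_single (k, b.2) (fun j _ hj => by simp [hj]) (by simp)]
        by_cases hab : a.2 = b.2 <;> simp [circularCov, jointCov, hk, hab])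
    simpa using this
  have hlift : ∀ N ω, FreeAlgebra.lift ℂ (fun a => withAdjoints (fun _ : Unit =>
      permutedFamily (G N) (ρ N) k) a ω) Q = FreeAlgebra.lift ℂ
        (fun a => withAdjoints (permutedFamily (G N) (ρ N)) a ω)
        (FreeAlgebra.lift ℂ (fun a : Unit × Bool => FreeAlgebra.ι ℂ (k, a.2)) Q) := by
    intro N ω
    rw [← AlgHom.comp_apply]
    congr 1
    refine FreeAlgebra.hom_ext ?_
    funext a
    simp [withAdjoints]
  have hQ := h (FreeAlgebra.lift ℂ (fun a : Unit × Bool => FreeAlgebra.ι ℂ (k, a.2)) Q)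
  rw [hcomp]
  simp only [traceMoment, hlift]
  exact hQ

/-- The expected polynomials in the entries of the permuted matrices and of their adjoints. -/
noncomputable def permutedExpectation [IsProbabilityMeasure P] {G : Ω → Matrix (Fin N) (Fin N) ℂ}
    (hG : IsGaussianRandomMatrix P G)
    (ρ : Equiv.Perm (Fin N × Fin N) × Equiv.Perm (Fin N × Fin N)) :
    MvPolynomial (Entry N) ℂ →ₗ[ℂ] ℂ :=
  expectation hG.memLp_entry ∘ₗ (MvPolynomial.rename (entryPos ![1, ρ.1, ρ.2])).toLinearMap

variable [IsProbabilityMeasure P]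

theorem IsGaussianRandomMatrix.isGaussianFunctional_permutedExpectation
    {G : Ω → Matrix (Fin N) (Fin N) ℂ} (hG : IsGaussianRandomMatrix P G)
    (ρ : Equiv.Perm (Fin N × Fin N) × Equiv.Perm (Fin N × Fin N)) :
    IsGaussianFunctional (permutedExpectation hG ρ) (permutedCov ρ) :=
  hG.isGaussianFunctional.rename _

theorem IsGaussianRandomMatrix.traceMoment_permutedFamily {G : Ω → Matrix (Fin N) (Fin N) ℂ}
    (hG : IsGaussianRandomMatrix P G)
    (ρ : Equiv.Perm (Fin N × Fin N) × Equiv.Perm (Fin N × Fin N)) (Q : FreeAlgebra ℂ (Fin 3 × Bool)) :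
    traceMoment P (withAdjoints (permutedFamily G ρ)) Q =
      (N : ℂ)⁻¹ * permutedExpectation hG ρ (genericTrace N Q) := by
  rw [traceMoment, integral_congr_ae (hG.trace_ae_eq ρ Q)]
  rfl

/-- For generic permutations, `G, G^σ, G^τ` behave to order `o(1 / N)` as a free family of a
semicircular and two circular elements. -/
theorem hasAsymptoticInfinitesimalDistribution_permutedFamily
    {G : (N : ℕ) → Ω → Matrix (Fin N) (Fin N) ℂ} (hG : ∀ N, IsGaussianRandomMatrix P (G N))
    {ρ : (N : ℕ) → Equiv.Perm (Fin N × Fin N) × Equiv.Perm (Fin N × Fin N)}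
    (hρ : IsGenericSequence ρ) :
    HasAsymptoticInfinitesimalDistribution P
      (fun N => withAdjoints (permutedFamily (G N) (ρ N))) (semicircularFunctional jointCov) 0 := by
  intro Q
  have hE₀ : ∀ N, ∃ E₀ : MvPolynomial (Entry N) ℂ →ₗ[ℂ] ℂ,
      IsGaussianFunctional E₀ (matrixCov jointCov N) := fun N =>
    exists_isGaussianFunctional_matrixCov (hG (5 * N)).isGaussianFunctional
  choose E₀ hE₀ using hE₀
  have hinf : Tendsto (fun N : ℕ => (N : ℂ) * (traceMoment P
      (withAdjoints (permutedFamily (G N) (ρ N))) Q - semicircularFunctional jointCov Q))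
      atTop (𝓝 0) := by
    simp only [(hG _).traceMoment_permutedFamily]
    induction Q using word_induction with
    | hw w =>
      simp only [genericTrace_word, semicircularFunctional_word]
      exact tendsto_moment_word hρ
        (fun N => (hG N).isGaussianFunctional_permutedExpectation (ρ N)) hE₀ w
    | hadd x y hx hy =>
      have := hx.add hy
      rw [add_zero] at this
      refine this.congr fun N => ?_
      simp only [map_add]
      ring
    | hsmul c x hx =>
      have := hx.const_mul c
      rw [mul_zero] at this
      refine this.congr fun N => ?_
      simp only [map_smul, smul_eq_mul]
      ring
  refine ⟨fun N => ?_, ?_, hinf⟩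
  · exact (integrable_congr ((hG N).trace_ae_eq (ρ N) Q)).2 (integrable_eval (hG N).memLp_entry _)
  · have h1 := (tendsto_inv_atTop_nhds_zero_nat (𝕜 := ℂ)).mul hinf
    have h2 := h1.add_const (semicircularFunctional jointCov Q)
    rw [mul_zero, zero_add] at h2
    refine h2.congr' ?_
    filter_upwards [eventually_ge_atTop 1] with N hN
    have hN0 : (N : ℂ) ≠ 0 := by
      have : N ≠ 0 := by omega
      exact_mod_cast this
    field_simp
    ring

theorem isInfinitesimallyFree_semicircularFunctional_jointCov :
    IsInfinitesimallyFree (semicircularFunctional jointCov) 0 fun k : Fin 3 =>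
      Algebra.adjoin ℂ {FreeAlgebra.ι ℂ (k, false), FreeAlgebra.ι ℂ (k, true)} := by
  have hB : (fun k : Fin 3 => Algebra.adjoin ℂ {FreeAlgebra.ι ℂ (k, false),
      FreeAlgebra.ι ℂ (k, true)}) = classAlgebra (Prod.fst : Fin 3 × Bool → Fin 3) := by
    funext k
    rw [classAlgebra]
    congr 1
    ext x
    simp only [Set.mem_insert_iff, Set.mem_singleton_iff, Set.mem_image, Set.mem_ofPred_eq,
      Prod.exists, Bool.exists_bool]
    constructor
    · rintro (rfl | rfl)
      · exact ⟨k, Or.inl ⟨rfl, rfl⟩⟩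
      · exact ⟨k, Or.inr ⟨rfl, rfl⟩⟩
    · rintro ⟨_, ⟨rfl, rfl⟩ | ⟨rfl, rfl⟩⟩
      · exact Or.inl rfl
      · exact Or.inr rfl
  rw [hB]
  refine ⟨isFree_classAlgebra fun a b hab => by simp [jointCov, hab], fun n i a _ _ _ => ?_⟩
  simp

end AsymptoticDistribution

/-- The expectation in the asymptotic notions is taken over the Gaussian matrices only: the
permutations are frozen at their values `σ N ω`, `τ N ω`, and "almost surely" refers to `ω`. -/
theorem theorem4p1 {Ω : Type*} [MeasurableSpace Ω] (P : Measure Ω) [IsProbabilityMeasure P]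
    (G : (N : ℕ) → Ω → Matrix (Fin N) (Fin N) ℂ)
    (σ τ : (N : ℕ) → Ω → Equiv.Perm (Fin N × Fin N))
    (hG : ∀ N, IsGaussianRandomMatrix P (G N))
    (hσ : ∀ N, IsUniformPerm P (σ N)) (hτ : ∀ N, IsUniformPerm P (τ N))
    (hστ : IndepFun (fun ω N => σ N ω) (fun ω N => τ N ω) P)
    (hindepG : IndepFun (fun ω => ((fun N => σ N ω), (fun N => τ N ω)))
      (fun ω (N : ℕ) (i j : Fin N) => G N ω i j) P) :
    ∀ᵐ ω ∂P,
      AsymptoticallyCircularZeroInfinitesimal P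
        (fun N ω' => permuteEntries (σ N ω) (G N ω')) ∧
      AsymptoticallyCircularZeroInfinitesimal P
        (fun N ω' => permuteEntries (τ N ω) (G N ω')) ∧
      AsymptoticallyInfinitesimallyFree P
        (fun N => ![fun ω' => G N ω',
          fun ω' => permuteEntries (σ N ω) (G N ω'),
          fun ω' => permuteEntries (τ N ω) (G N ω')]) := by
  have hστN : ∀ N, IndepFun (σ N) (τ N) P := fun N =>
    hστ.comp (measurable_pi_apply N) (measurable_pi_apply N)
  filter_upwards [ae_isGenericSequence hσ hτ hστN] with ω hω
  have h := hasAsymptoticInfinitesimalDistribution_permutedFamily hG hω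
  have hfam : ∀ N, permutedFamily (G N) (σ N ω, τ N ω) = ![fun ω' => G N ω',
      fun ω' => permuteEntries (σ N ω) (G N ω'), fun ω' => permuteEntries (τ N ω) (G N ω')] := by
    intro N
    funext k ω'
    fin_cases k
    · ext i j
      simp [permutedFamily, permuteEntries]
    · rfl
    · rfl
  refine ⟨asymptoticallyCircular_permutedFamily h (k := 1) (by decide),
    asymptoticallyCircular_permutedFamily h (k := 2) (by decide), _, _, ?_,
    isInfinitesimallyFree_semicircularFunctional_jointCov⟩
  simpa only [hfam] using h
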